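/- **Setting.** Let $n\ge 1$, $s\in(0,1)$, $\gamma\in(0,1]$, $n\neq 2s$, let $\Omega\subset\mathbb R^n$ be a nonempty bounded open set of class $C^{1,1}$, and let $\delta(x)=\mathrm{dist}(x,\partial\Omega)$. Let $\mathcal G_0$ be a measurable symmetric kernel, defined off the diagonal of $\Omega\times\Omega$, with $$\mathcal G_0(x,y)\asymp \frac1{|x-y|^{n-2s}}\Big(\frac{\delta^\gamma(x)}{|x-y|^\gamma}\wedge1\Big)\Big(\frac{\delta^\gamma(y)}{|x-y|^\gamma}\wedge1\Big),$$ and put $\mathbb G_0(f)(x)=\int_\Omega\mathcal G_0(x,y)f(y)\,dy$ (so $\mathbb G_0=\mathcal L^{-1}$). Let $0<\lambda_1\le\lambda_2\le\cdots$ be the eigenvalues of $\mathcal L$, repeated according to multiplicity, and $(\varphi_j)_{j\ge1}$ a corresponding orthonormal basis of $L^2(\Omega)$ with $\varphi_j=\lambda_j\mathbb G_0(\varphi_j)$; write $\Sigma=\{\lambda_j\}$. For $\lambda\in\mathbb R\setminus\Sigma$ let $$I=\min\{j:\lambda_j\ge\lambda,\ \lambda_{j+1}>\lambda_j\},\qquad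 \bar\lambda=\lambda_{I+1},\qquad \mathbb G_\lambda(\psi)=\sum_{j\ge1}\frac{\langle\psi,\varphi_j\rangle}{\lambda_j-\lambda}\varphi_j\quad(\psi\in L^2(\Omega)).$$ For a weight $w>0$ let $L^1(\Omega;w)=\{f: fw\in L^1(\Omega)\}$, and let $\widetilde{E^\perp}=\{f\in L^1(\Omega;\delta^\gamma):\int_\Omega f\varphi_j=0\text{ for }1\le j\le I\}$. For $f\in L^1(\Omega;\delta^\gamma)$, a $\mathbb G_\lambda(\delta^\gamma L^\infty(\Omega))$-weak solution of $\mathcal Lu-\lambda u=f$ with zero boundary datum is a function $u\in L^1(\Omega;\delta^\gamma)$ such that $\int_\Omega u\psi=\int_\Omega f\,\mathbb G_\lambda(\psi)$ for all $\psi\in\delta^\gamma L^\infty(\Omega)$. **Theorem (uniform estimate for low integrability data).** Let $m\in\mathbb R$. Let $\lambda\in\mathbb R\setminus\Sigma$ with $\lambda\ge -m$, let $f^\perp\in\widetilde{E^\perp}$, and let $u^\perp$ be a $\mathbb G_\lambda(\delta^\gamma L^\infty(\Omega))$-weak solution of $\mathcal Lu^\perp-\lambda u^\perp=f^\perp$ with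 zero boundary datum. Then $u^\perp\in\widetilde{E^\perp}$, and the following hold, with constants that depend on $\lambda$ only through $\bar\lambda$ (for given $m$ and a given operator $\mathcal L$ on $\Omega$); in particular they do not depend on $\mathrm{dist}(\lambda,\Sigma)$. 1. For every $\alpha>-1-\gamma$: if $f^\perp\in L^1(\Omega;\mathbb G_0(\delta^\alpha))$, then $u^\perp\in L^1(\Omega;\delta^\alpha)$ and $$\|u^\perp\delta^\alpha\|_{L^1(\Omega)}\le C(\bar\lambda,m)\,\|f^\perp\,\mathbb G_0(\delta^\alpha)\|_{L^1(\Omega)}.$$ 2. For every $p\in[1,\frac n{n-2s})$: if $f^\perp\in L^1(\Omega)$, then $u^\perp\in L^p(\Omega)$ and $\|u^\perp\|_{L^p(\Omega)}\le C(p,\bar\lambda,m)\|f^\perp\|_{L^1(\Omega)}$. 3. For every $p_0\in(1,\frac n{2s})$ and $\frac1{p_1}=\frac1{p_0}-\frac{2s}n$: if $f^\perp\in L^{p_0}(\Omega)$, then $u^\perp\in L^{p_1}(\Omega)$ and $\|u^\perp\|_{L^{p_1}(\Omega)}\le C(p_0,\bar\lambda,m)\|f^\perp\|_{L^{p_0}(\Omega)}$.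 4. If $\gamma<2s$, then for every $p\in[1,\frac n{n-2s+\gamma})$: $u^\perp\in L^p(\Omega)$ and $\|u^\perp\|_{L^p(\Omega)}\le C(p,\bar\lambda,m)\|f^\perp\delta^\gamma\|_{L^1(\Omega)}$. (The intervals in 2 and 3 are empty if $n<2s$. The lower bound $\lambda\ge-m$ matters only for negative $\lambda$.) -/

import Mathlib

open MeasureTheory Set

noncomputable section

/-- Bounded nonempty open sets of class `C^{1,1}`: near each boundary point `z` and in suitable
Euclidean coordinates (with inner direction `ν`), the set is the strict epigraph of a `C^1` function
with Lipschitz gradient of the coordinates orthogonal to `ν`. -/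
structure IsBoundedC11 {n : ℕ} (Ω : Set (EuclideanSpace ℝ (Fin n))) : Prop where
  isOpen : IsOpen Ω
  nonempty : Ω.Nonempty
  bounded : Bornology.IsBounded Ω
  chart : ∀ z ∈ frontier Ω, ∃ r : ℝ, 0 < r ∧ ∃ ν : EuclideanSpace ℝ (Fin n), ‖ν‖ = 1 ∧
    ∃ h : EuclideanSpace ℝ (Fin n) → ℝ, ContDiff ℝ 1 h ∧ (∃ L, LipschitzWith L (fderiv ℝ h)) ∧
      ∀ x ∈ Metric.ball z r,
        (x ∈ Ω ↔ h (x - z - (inner ℝ (x - z) ν : ℝ) • ν) < (inner ℝ (x - z) ν : ℝ))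

/-- The distance to the boundary of `Ω`. -/
def bdist {n : ℕ} (Ω : Set (EuclideanSpace ℝ (Fin n))) (x : EuclideanSpace ℝ (Fin n)) : ℝ :=
  Metric.infDist x (frontier Ω)

/-- The two-sided model for the Green function of an operator of order `2 s` with boundary
exponent `γ`. -/
def modelKernel {n : ℕ} (Ω : Set (EuclideanSpace ℝ (Fin n))) (s γ : ℝ)
    (x y : EuclideanSpace ℝ (Fin n)) : ℝ :=
  1 / ‖x - y‖ ^ ((n : ℝ) - 2 * s) *
    min (bdist Ω x ^ γ / ‖x - y‖ ^ γ) 1 * min (bdist Ω y ^ γ / ‖x - y‖ ^ γ) 1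

/-- The Green function `G` (whose values matter only off the diagonal of `Ω × Ω`) is symmetric and
comparable to the model kernel; in particular it is positive. -/
structure IsGreenFunction {n : ℕ} (Ω : Set (EuclideanSpace ℝ (Fin n))) (s γ : ℝ)
    (G : EuclideanSpace ℝ (Fin n) → EuclideanSpace ℝ (Fin n) → ℝ) : Prop where
  aemeasurable : AEMeasurable (Function.uncurry G)
    ((volume.restrict Ω).prod (volume.restrict Ω))
  symm : ∀ x ∈ Ω, ∀ y ∈ Ω, x ≠ y → G x y = G y x
  comparable : ∃ c : ℝ, 0 < c ∧ ∀ x ∈ Ω, ∀ y ∈ Ω, x ≠ y →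
    c⁻¹ * modelKernel Ω s γ x y ≤ G x y ∧ G x y ≤ c * modelKernel Ω s γ x y

/-- The Green operator `𝔾₀ f (x) = ∫_Ω G(x,y) f(y) dy`. -/
def greenOp {n : ℕ} (Ω : Set (EuclideanSpace ℝ (Fin n)))
    (G : EuclideanSpace ℝ (Fin n) → EuclideanSpace ℝ (Fin n) → ℝ)
    (f : EuclideanSpace ℝ (Fin n) → ℝ) (x : EuclideanSpace ℝ (Fin n)) : ℝ :=
  ∫ y in Ω, G x y * f y

/-- The real Hilbert space `L²(Ω)`. -/
abbrev L2 {n : ℕ} (Ω : Set (EuclideanSpace ℝ (Fin n))) : Type :=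
  Lp ℝ 2 ((volume : Measure (EuclideanSpace ℝ (Fin n))).restrict Ω)

/-- `ev` is the nondecreasing sequence of (positive) eigenvalues of the operator with Green function
`G`, repeated according to multiplicity, and the orthonormal basis `φ` of `L²(Ω)` consists of
corresponding eigenfunctions: `φ_j = ev_j 𝔾₀ φ_j`. The first index is `0`. -/
structure IsEigenbasis {n : ℕ} (Ω : Set (EuclideanSpace ℝ (Fin n)))
    (G : EuclideanSpace ℝ (Fin n) → EuclideanSpace ℝ (Fin n) → ℝ)
    (ev : ℕ → ℝ) (φ : HilbertBasis ℕ ℝ (L2 Ω)) : Prop where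
  pos : ∀ j, 0 < ev j
  mono : Monotone ev
  eigen : ∀ j, ∀ᵐ x ∂(volume.restrict Ω), (φ j : L2 Ω) x = ev j * greenOp Ω G (φ j : L2 Ω) x

/-- `I` is the least index with `lam ≤ ev I < ev (I + 1)`. -/
def IsCutIndex (ev : ℕ → ℝ) (lam : ℝ) (I : ℕ) : Prop :=
  IsLeast {j : ℕ | lam ≤ ev j ∧ ev j < ev (j + 1)} I

/-- The solution operator on `L²(Ω)`: `𝔾_lam ψ = ∑_j ⟨ψ, φ_j⟩ / (ev_j - lam) φ_j`. -/
def helmholtzOp {n : ℕ} {Ω : Set (EuclideanSpace ℝ (Fin n))} (ev : ℕ → ℝ)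
    (φ : HilbertBasis ℕ ℝ (L2 Ω)) (lam : ℝ) (ψ : L2 Ω) : L2 Ω :=
  ∑' j, ((inner ℝ (φ j) ψ : ℝ) / (ev j - lam)) • (φ j : L2 Ω)

/-- Membership in the weighted space `L¹(Ω; w)`. -/
def MemWeightedL1 {n : ℕ} (Ω : Set (EuclideanSpace ℝ (Fin n)))
    (w f : EuclideanSpace ℝ (Fin n) → ℝ) : Prop :=
  Integrable (fun x => f x * w x) (volume.restrict Ω)

/-- The functions of `L¹(Ω; δ^γ)` orthogonal to the eigenfunctions `φ_0, …, φ_I`. -/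
def MemPerp {n : ℕ} (Ω : Set (EuclideanSpace ℝ (Fin n))) (γ : ℝ)
    (φ : HilbertBasis ℕ ℝ (L2 Ω)) (I : ℕ) (f : EuclideanSpace ℝ (Fin n) → ℝ) : Prop :=
  MemWeightedL1 Ω (fun x => bdist Ω x ^ γ) f ∧
    ∀ j ≤ I, ∫ x in Ω, f x * (φ j : L2 Ω) x = 0

/-- `u` is a `𝔾_lam(δ^γ L^∞(Ω))`-weak solution of `ℒ u - lam u = f` with zero boundary datum. Since
`Ω` is bounded and `γ > 0`, the test space `δ^γ L^∞(Ω)` is a subspace of `L²(Ω)`. -/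
def IsWeakSolution {n : ℕ} (Ω : Set (EuclideanSpace ℝ (Fin n))) (γ : ℝ) (ev : ℕ → ℝ)
    (φ : HilbertBasis ℕ ℝ (L2 Ω)) (lam : ℝ) (f u : EuclideanSpace ℝ (Fin n) → ℝ) : Prop :=
  MemWeightedL1 Ω (fun x => bdist Ω x ^ γ) f ∧
  MemWeightedL1 Ω (fun x => bdist Ω x ^ γ) u ∧
  ∀ ψ : L2 Ω, (∃ M : ℝ, ∀ᵐ x ∂(volume.restrict Ω), |ψ x| ≤ M * bdist Ω x ^ γ) →
    ∫ x in Ω, u x * ψ x = ∫ x in Ω, f x * helmholtzOp ev φ lam ψ x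

end

/-! The theorem rests on one pointwise bound, uniform in λ: |u| ≤ C 𝕂(|f|) a.e., where 𝕂 is `pot`
with τ = 1, whose kernel is comparable to the Green function. The four estimates are then mapping
properties of 𝕂: symmetry of its kernel for the weighted bound, Hölder and Fubini for the two bounds
from (weighted) L¹, Hardy–Littlewood–Sobolev for the bound from L^{p₀}.

The pointwise bound comes from a truncated Neumann series. For an eigenvalue e, 1/(e-λ) = ∑_{i<2a}
λ^i/e^{i+1} + λ^{2a}/(e^{2a}(e-λ)) (`sum_pow_div_pow_add`). Above the cut index I the solution
operator is therefore ∑ λ^i 𝔾₀^{i+1} + λ^{2a} 𝔾₀^a R 𝔾₀^a, with R the resolvent on the modes beyond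
I. There e - λ ≥ ev (I+1) - ev I, since λ ≤ ev I, so the L² norm of R does not see the distance from
λ to the spectrum. The modes up to I, where 1/(e-λ) may be huge, only add eigenfunctions to which f
is orthogonal.

The remainder is controlled through the kernel. It is comparable to δ^γ(x) δ^γ(y) / d(x,y), where d
= |x-y|^{n-2s} max(|x-y|, δ(x), δ(y))^{2γ} is a quasi-metric (`exists_quasiDist_le_max`). Composing
with it turns the power d^{-τ} into d^{-(τ-ε)} (`exists_pot_pot_le`), so some iterate 𝔾₀^a is
dominated by the rank-one kernel δ^γ(x) δ^γ(y). Hence eigenfunctions are O(δ^γ), and the L² bounded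
R, placed between two such iterates, again yields the rank-one kernel, which is at most a multiple
of the kernel of 𝕂 (`IsEigenbasis.exists_helmholtzOp_decomposition`). Testing the weak formulation
with sign(u) δ^γ 1_S transfers the bound from the solution operator to u
(`IsEigenbasis.exists_enorm_le_pot`).

All this needs 2s < n. When n < 2s the hypotheses are contradictory: the kernel would tend to 0 at
the diagonal and be positive off it, so the difference of the indicators of two small balls would
have negative energy, although all eigenvalues are positive (`IsEigenbasis.two_mul_le`). -/

/-! ### Riesz potentials on the whole space and the Hardy–Littlewood–Sobolev inequality -/

lemma lintegral_eq_rpow_mul_lintegral_smul {n : ℕ} {R : ℝ} (hR : 0 < R)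
    {g : EuclideanSpace ℝ (Fin n) → ENNReal} (hg : Measurable g) :
    ∫⁻ z, g z = ENNReal.ofReal (R ^ (n : ℝ)) * ∫⁻ z, g (R • z) := by
  have h := Measure.map_addHaar_smul (volume : Measure (EuclideanSpace ℝ (Fin n))) hR.ne'
  have h2 : ∫⁻ z, g (R • z) = ∫⁻ z, g z ∂(Measure.map (R • ·) volume) :=
    (lintegral_map hg (measurable_const_smul R)).symm
  rw [h2, h, lintegral_smul_measure, smul_eq_mul, ← mul_assoc, ← ENNReal.ofReal_mul (by positivity),
    finrank_euclideanSpace_fin, abs_of_pos (by positivity), Real.rpow_natCast,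
    mul_inv_cancel₀ (by positivity), ENNReal.ofReal_one, one_mul]

lemma measurable_ofReal_norm_rpow {n : ℕ} (β : ℝ) :
    Measurable fun z : EuclideanSpace ℝ (Fin n) => ENNReal.ofReal (‖z‖ ^ β) := by
  fun_prop

/-- Dilation reduces to the unit ball, where integrability is the condition β < n. Adding 1 to the
unit integral makes the constant positive. -/
lemma exists_lintegral_ball_norm_rpow_le {n : ℕ} (hn : 1 ≤ n) {β : ℝ} (hβ : β < n) :
    ∃ C : ℝ, 0 < C ∧ ∀ R : ℝ, 0 < R →
      ∫⁻ z in Metric.ball (0 : EuclideanSpace ℝ (Fin n)) R, ENNReal.ofReal (‖z‖ ^ (-β)) ≤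
        ENNReal.ofReal (C * R ^ ((n : ℝ) - β)) := by
  set J : ENNReal := ∫⁻ z in Metric.ball (0 : EuclideanSpace ℝ (Fin n)) 1,
    ENNReal.ofReal (‖z‖ ^ (-β)) with hJ
  have hfin : J < ⊤ := by
    have h : IntegrableOn (fun z : EuclideanSpace ℝ (Fin n) => ‖z‖ ^ (-β)) (Metric.ball 0 1) := by
      refine integrableOn_ball_of_norm_le_rpow (C := 1) (α := β) (by simpa using hn)
        (by simpa using hβ) (ae_of_all _ fun x => ?_) ?_
      · rw [one_mul, Real.norm_of_nonneg (by positivity)]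
      · exact Measurable.aestronglyMeasurable (by fun_prop)
    have := h.lintegral_lt_top
    simpa [hJ] using this
  refine ⟨J.toReal + 1, by positivity, fun R hR => ?_⟩
  rw [← lintegral_indicator measurableSet_ball,
    lintegral_eq_rpow_mul_lintegral_smul hR
      ((measurable_ofReal_norm_rpow (-β)).indicator measurableSet_ball)]
  have h1 : ∀ z : EuclideanSpace ℝ (Fin n),
      (Metric.ball (0 : EuclideanSpace ℝ (Fin n)) R).indicator
        (fun z => ENNReal.ofReal (‖z‖ ^ (-β))) (R • z) = ENNReal.ofReal (R ^ (-β)) *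
      (Metric.ball (0 : EuclideanSpace ℝ (Fin n)) 1).indicator
        (fun z => ENNReal.ofReal (‖z‖ ^ (-β))) z := by
    intro z
    have hiff : R • z ∈ Metric.ball (0 : EuclideanSpace ℝ (Fin n)) R ↔
        z ∈ Metric.ball (0 : EuclideanSpace ℝ (Fin n)) 1 := by
      simp only [mem_ball_zero_iff, norm_smul, Real.norm_of_nonneg hR.le]
      exact mul_lt_iff_lt_one_right hR
    by_cases hz : z ∈ Metric.ball (0 : EuclideanSpace ℝ (Fin n)) 1
    · rw [indicator_of_mem hz, indicator_of_mem (hiff.2 hz), norm_smul, Real.norm_of_nonneg hR.le,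
        Real.mul_rpow hR.le (norm_nonneg _), ENNReal.ofReal_mul (by positivity)]
    · rw [indicator_of_notMem hz, indicator_of_notMem (fun h => hz (hiff.1 h)), mul_zero]
  simp_rw [h1]
  rw [lintegral_const_mul' _ _ ENNReal.ofReal_ne_top, lintegral_indicator measurableSet_ball,
    ← hJ, ← mul_assoc, ← ENNReal.ofReal_mul (by positivity), ← Real.rpow_add hR, ← sub_eq_add_neg,
    mul_comm, mul_comm _ (R ^ _), ENNReal.ofReal_mul (by positivity),
    mul_comm]
  gcongr
  rw [← ENNReal.ofReal_toReal hfin.ne]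
  exact ENNReal.ofReal_le_ofReal (by simp)

lemma exists_lintegral_compl_ball_norm_rpow_le {n : ℕ} {β : ℝ} (hβ : n < β) :
    ∃ C : ℝ, 0 < C ∧ ∀ R : ℝ, 0 < R →
      ∫⁻ z in (Metric.ball (0 : EuclideanSpace ℝ (Fin n)) R)ᶜ, ENNReal.ofReal (‖z‖ ^ (-β)) ≤
        ENNReal.ofReal (C * R ^ ((n : ℝ) - β)) := by
  have hβ0 : 0 < β := lt_of_le_of_lt (Nat.cast_nonneg n) hβ
  set J : ENNReal := ∫⁻ z in (Metric.ball (0 : EuclideanSpace ℝ (Fin n)) 1)ᶜ,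
    ENNReal.ofReal (‖z‖ ^ (-β)) with hJ
  have hfin : J < ⊤ := by
    have h : Integrable (fun z : EuclideanSpace ℝ (Fin n) => (1 + ‖z‖) ^ (-β)) :=
      integrable_one_add_norm (by simpa using hβ)
    have h2 := (h.const_mul (2 ^ β)).lintegral_lt_top
    refine lt_of_le_of_lt ?_ h2
    rw [hJ]
    refine le_trans ?_ (setLIntegral_le_lintegral (Metric.ball 0 1)ᶜ _)
    refine setLIntegral_mono' measurableSet_ball.compl fun z hz => ENNReal.ofReal_le_ofReal ?_
    have hz1 : 1 ≤ ‖z‖ := by simpa using hz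
    have hz0 : 0 < ‖z‖ := by linarith
    have : (2 : ℝ) ^ β * (1 + ‖z‖) ^ (-β) = ((1 + ‖z‖) / 2) ^ (-β) := by
      rw [Real.div_rpow (by positivity) (by norm_num), Real.rpow_neg (by norm_num : (0:ℝ) ≤ 2)]
      field_simp
    rw [this]
    exact Real.rpow_le_rpow_of_nonpos (by positivity) (by linarith) (by linarith)
  refine ⟨J.toReal + 1, by positivity, fun R hR => ?_⟩
  have hms : MeasurableSet (Metric.ball (0 : EuclideanSpace ℝ (Fin n)) R)ᶜ :=
    measurableSet_ball.compl
  have hms1 : MeasurableSet (Metric.ball (0 : EuclideanSpace ℝ (Fin n)) 1)ᶜ :=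
    measurableSet_ball.compl
  rw [← lintegral_indicator hms,
    lintegral_eq_rpow_mul_lintegral_smul hR ((measurable_ofReal_norm_rpow (-β)).indicator hms)]
  have h1 : ∀ z : EuclideanSpace ℝ (Fin n),
      (Metric.ball (0 : EuclideanSpace ℝ (Fin n)) R)ᶜ.indicator
        (fun z => ENNReal.ofReal (‖z‖ ^ (-β))) (R • z) = ENNReal.ofReal (R ^ (-β)) *
      (Metric.ball (0 : EuclideanSpace ℝ (Fin n)) 1)ᶜ.indicator
        (fun z => ENNReal.ofReal (‖z‖ ^ (-β))) z := by
    intro z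
    have hiff : R • z ∈ (Metric.ball (0 : EuclideanSpace ℝ (Fin n)) R)ᶜ ↔
        z ∈ (Metric.ball (0 : EuclideanSpace ℝ (Fin n)) 1)ᶜ := by
      simp only [mem_compl_iff, mem_ball_zero_iff, norm_smul, Real.norm_of_nonneg hR.le]
      exact not_congr (mul_lt_iff_lt_one_right hR)
    by_cases hz : z ∈ (Metric.ball (0 : EuclideanSpace ℝ (Fin n)) 1)ᶜ
    · rw [indicator_of_mem hz, indicator_of_mem (hiff.2 hz), norm_smul, Real.norm_of_nonneg hR.le,
        Real.mul_rpow hR.le (norm_nonneg _), ENNReal.ofReal_mul (by positivity)]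
    · rw [indicator_of_notMem hz, indicator_of_notMem (fun h => hz (hiff.1 h)), mul_zero]
  simp_rw [h1]
  rw [lintegral_const_mul' _ _ ENNReal.ofReal_ne_top, lintegral_indicator hms1,
    ← hJ, ← mul_assoc, ← ENNReal.ofReal_mul (by positivity), ← Real.rpow_add hR, ← sub_eq_add_neg,
    mul_comm, mul_comm _ (R ^ _), ENNReal.ofReal_mul (by positivity),
    mul_comm]
  gcongr
  rw [← ENNReal.ofReal_toReal hfin.ne]
  exact ENNReal.ofReal_le_ofReal (by simp)

lemma lintegral_comp_sub_left_restrict {n : ℕ} (x : EuclideanSpace ℝ (Fin n))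
    {S : Set (EuclideanSpace ℝ (Fin n))} (hS : MeasurableSet S)
    (g : EuclideanSpace ℝ (Fin n) → ENNReal) :
    ∫⁻ y, S.indicator g (x - y) = ∫⁻ z in S, g z := by
  rw [lintegral_sub_left_eq_self (fun z => S.indicator g z) x, lintegral_indicator hS]

lemma lintegral_Ioo_rpow_sub_one {e X : ℝ} (he : 0 < e) (hX : 0 ≤ X) :
    ∫⁻ t in Ioo 0 X, ENNReal.ofReal (t ^ (e - 1)) = ENNReal.ofReal (X ^ e / e) := by
  have h1 : IntegrableOn (fun t : ℝ => t ^ (e - 1)) (Ioo 0 X) := by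
    rcases hX.eq_or_lt with h | h
    · simp [← h]
    · rw [intervalIntegral.integrableOn_Ioo_rpow_iff h]; linarith
  rw [← ofReal_integral_eq_lintegral_ofReal h1
    ((ae_restrict_iff' measurableSet_Ioo).2 (ae_of_all _ fun t ht => Real.rpow_nonneg ht.1.le _)),
    ← integral_Ioc_eq_integral_Ioo, ← intervalIntegral.integral_of_le hX,
    integral_rpow (Or.inl (by linarith))]
  simp [Real.zero_rpow he.ne']

/-- The distributional estimate behind the Hardy–Littlewood–Sobolev inequality. -/
lemma exists_volume_lt_rieszPotential_le {n : ℕ} (hn : 1 ≤ n) {σ p q : ℝ} (hσ : 0 < σ) (hp : 1 < p)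
    (hpn : p < n / σ) (hq : 1 / q = 1 / p - σ / n) :
    ∃ C c : ℝ, 0 < C ∧ 0 < c ∧ ∀ f : EuclideanSpace ℝ (Fin n) → ℝ, Measurable f →
      ∫⁻ y, ENNReal.ofReal (f y) ^ p ≤ 1 → ∀ t : ℝ, 0 < t →
      volume {x | ENNReal.ofReal t <
          ∫⁻ y, ENNReal.ofReal (‖x - y‖ ^ (-((n : ℝ) - σ))) * ENNReal.ofReal (f y)} ≤
        ENNReal.ofReal (C * t ^ (-(q / p))) *
          ∫⁻ y in {y | c * t ^ (q / p) < f y}, ENNReal.ofReal (f y) := by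
  have hn0 : (0 : ℝ) < n := by exact_mod_cast hn
  have hp0 : 0 < p := by linarith
  have hpσ : p * σ < n := by rwa [lt_div_iff₀ hσ] at hpn
  have hq0 : 0 < q := by
    have : 0 < 1 / q := by
      rw [hq, sub_pos, div_lt_div_iff₀ hn0 hp0]; linarith
    simpa using this
  have hqσ : q * σ / n = q / p - 1 := by
    have := congrArg (q * ·) hq
    rw [mul_one_div_cancel hq0.ne'] at this
    rw [mul_div_assoc, div_eq_mul_one_div q p]
    linarith
  set b : ℝ := n - σ with hb
  set p' : ℝ := p / (p - 1) with hp'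
  have hconj : p'.HolderConjugate p := (Real.HolderConjugate.conjExponent hp).symm
  have hp'0 : 0 < p' := hconj.pos
  have hinv : 1 / p' = 1 - 1 / p := by rw [hp']; field_simp
  have hbp : (n : ℝ) < b * p' := by
    rw [hp', hb, mul_div_assoc', lt_div_iff₀ (by linarith)]; linarith
  obtain ⟨K₁, hK₁, hfar⟩ := exists_lintegral_compl_ball_norm_rpow_le hbp
  obtain ⟨K₂, hK₂, hnear⟩ := exists_lintegral_ball_norm_rpow_le hn (β := b) (by linarith)
  -- `K` and `a` are tuned so that, with radius R = a t^{-q/n}, Hölder's inequality bounds the part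
  -- |x-y| ≥ R of the potential by exactly t/4: K₁^{1/p'} R^{-n/q} = t/4.
  set K : ℝ := 4 * K₁ ^ (1 / p') with hK
  have hK0 : 0 < K := by positivity
  set a : ℝ := K ^ (q / n) with ha
  have ha0 : 0 < a := by positivity
  refine ⟨2 * K₂ * a ^ σ, 1 / (4 * K₂ * a ^ σ), by positivity, by positivity, ?_⟩
  intro f hf hf1 t ht
  set R : ℝ := a * t ^ (-(q / n)) with hR
  have hR0 : 0 < R := by positivity
  have hRσ : R ^ σ = a ^ σ * t ^ (1 - q / p) := by
    rw [hR, Real.mul_rpow ha0.le (by positivity), ← Real.rpow_mul ht.le]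
    congr 2
    linear_combination (-1) * hqσ
  set c : ℝ := 1 / (4 * K₂ * a ^ σ) with hc
  -- The height θ satisfies K₂ R^σ θ = t/4, so the values of f below θ contribute at most t/4 from
  -- the ball of radius R.
  set θ : ℝ := c * t ^ (q / p) with hθ
  set κ : EuclideanSpace ℝ (Fin n) → ENNReal := fun z => ENNReal.ofReal (‖z‖ ^ (-b)) with hκ
  have hκm : Measurable κ := measurable_ofReal_norm_rpow _
  set B := Metric.ball (0 : EuclideanSpace ℝ (Fin n)) R with hB
  have hBm : MeasurableSet B := measurableSet_ball
  set F : EuclideanSpace ℝ (Fin n) → ENNReal := fun y => ENNReal.ofReal (f y) with hF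
  have hFm : Measurable F := hf.ennreal_ofReal
  set S : Set (EuclideanSpace ℝ (Fin n)) := {y | θ < f y} with hS
  have hSm : MeasurableSet S := measurableSet_lt measurable_const hf
  set h : EuclideanSpace ℝ (Fin n) → ENNReal := fun x => ∫⁻ y, B.indicator κ (x - y) * S.indicator F y
  have hjm : Measurable (Function.uncurry fun x y : EuclideanSpace ℝ (Fin n) =>
      B.indicator κ (x - y) * S.indicator F y) := by
    have h1 : Measurable (B.indicator κ) := hκm.indicator hBm
    have h2 : Measurable (S.indicator F) := hFm.indicator hSm
    exact (h1.comp (measurable_fst.sub measurable_snd)).mul (h2.comp measurable_snd)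
  have hhm : Measurable h := hjm.lintegral_prod_right
  have hfarx : ∀ x, ∫⁻ y, Bᶜ.indicator κ (x - y) * F y ≤ ENNReal.ofReal (t / 4) := by
    intro x
    have hm1 : Measurable fun y => Bᶜ.indicator κ (x - y) :=
      (hκm.indicator hBm.compl).comp (measurable_const.sub measurable_id)
    refine (ENNReal.lintegral_mul_le_Lp_mul_Lq volume hconj hm1.aemeasurable
      hFm.aemeasurable).trans ?_
    have h1 : (∫⁻ y, F y ^ p) ^ (1 / p) ≤ 1 := by
      refine (ENNReal.rpow_le_rpow hf1 (by positivity)).trans (by simp)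
    have h2 : ∫⁻ y, Bᶜ.indicator κ (x - y) ^ p' ≤ ENNReal.ofReal (K₁ * R ^ (n - b * p')) := by
      refine le_trans (le_of_eq ?_) (hfar R hR0)
      rw [← lintegral_comp_sub_left_restrict x hBm.compl]
      congr 1; ext y
      by_cases hy : x - y ∈ Bᶜ
      · rw [indicator_of_mem hy, indicator_of_mem hy, hκ,
          ENNReal.ofReal_rpow_of_nonneg (by positivity) hp'0.le, ← Real.rpow_mul (norm_nonneg _),
          neg_mul]
      · rw [indicator_of_notMem hy, indicator_of_notMem hy, ENNReal.zero_rpow_of_pos hp'0]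
    calc _ ≤ (ENNReal.ofReal (K₁ * R ^ (n - b * p'))) ^ (1 / p') * 1 := by gcongr
      _ = ENNReal.ofReal (t / 4) := by
        rw [mul_one, ENNReal.ofReal_rpow_of_nonneg (by positivity) (by positivity),
          Real.mul_rpow (by positivity) (by positivity), ← Real.rpow_mul hR0.le]
        have he : ((n : ℝ) - b * p') * (1 / p') = -(n / q) := by
          rw [sub_mul, mul_assoc, mul_one_div_cancel hp'0.ne', hinv, hb]
          have : (n : ℝ) / q = n * (1 / q) := by ring
          rw [this, hq]
          field_simp; ring
        have hRq : R ^ (-((n : ℝ) / q)) = K⁻¹ * t := by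
          rw [hR, Real.mul_rpow ha0.le (by positivity), ← Real.rpow_mul ht.le, ha,
            ← Real.rpow_mul hK0.le]
          have e1 : q / n * -((n : ℝ) / q) = -1 := by field_simp
          have e2 : -(q / n) * -((n : ℝ) / q) = 1 := by field_simp
          rw [e1, e2, Real.rpow_one, Real.rpow_neg_one]
        rw [he, hRq, hK]
        congr 1
        field_simp
  have hnearI : ∀ x, ∫⁻ y, B.indicator κ (x - y) ≤ ENNReal.ofReal (K₂ * R ^ σ) := by
    intro x
    rw [lintegral_comp_sub_left_restrict x hBm]
    refine (hnear R hR0).trans (le_of_eq ?_)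
    congr 3
    rw [hb]; ring
  have hlow : ∀ x, ∫⁻ y, B.indicator κ (x - y) * Sᶜ.indicator F y ≤ ENNReal.ofReal (t / 4) := by
    intro x
    calc _ ≤ ∫⁻ y, B.indicator κ (x - y) * ENNReal.ofReal θ := by
          refine lintegral_mono fun y => mul_le_mul_right ?_ _
          by_cases hy : y ∈ Sᶜ
          · rw [indicator_of_mem hy]; exact ENNReal.ofReal_le_ofReal (not_lt.1 hy)
          · rw [indicator_of_notMem hy]; exact zero_le
      _ = (∫⁻ y, B.indicator κ (x - y)) * ENNReal.ofReal θ :=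
          lintegral_mul_const' _ _ ENNReal.ofReal_ne_top
      _ ≤ ENNReal.ofReal (K₂ * R ^ σ) * ENNReal.ofReal θ := by gcongr; exact hnearI x
      _ = ENNReal.ofReal (t / 4) := by
        rw [← ENNReal.ofReal_mul (by positivity), hRσ, hθ, hc]
        congr 1
        rw [Real.rpow_sub ht, Real.rpow_one]
        field_simp
  -- Where the potential exceeds t, the near part of the high values, `h`, must supply at least t/2.
  -- Markov's inequality and Tonelli then finish.
  have hsub : {x | ENNReal.ofReal t < ∫⁻ y, κ (x - y) * F y} ⊆
      {x | ENNReal.ofReal (t / 2) ≤ h x} := by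
    intro x hx
    have hsplit : ∫⁻ y, κ (x - y) * F y ≤ ENNReal.ofReal (t / 4) + (ENNReal.ofReal (t / 4) + h x) := by
      have hm1 : Measurable fun y => Bᶜ.indicator κ (x - y) * F y :=
        ((hκm.indicator hBm.compl).comp (measurable_const.sub measurable_id)).mul hFm
      have hm2 : Measurable fun y => B.indicator κ (x - y) * Sᶜ.indicator F y :=
        ((hκm.indicator hBm).comp (measurable_const.sub measurable_id)).mul
          (hFm.indicator hSm.compl)
      calc ∫⁻ y, κ (x - y) * F y
          = ∫⁻ y, Bᶜ.indicator κ (x - y) * F y + (B.indicator κ (x - y) * Sᶜ.indicator F y +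
            B.indicator κ (x - y) * S.indicator F y) := by
            congr 1; ext y
            by_cases h1 : x - y ∈ B <;> by_cases h2 : y ∈ S <;> simp [h1, h2]
        _ = (∫⁻ y, Bᶜ.indicator κ (x - y) * F y) +
            ((∫⁻ y, B.indicator κ (x - y) * Sᶜ.indicator F y) + h x) := by
            rw [lintegral_add_left hm1, lintegral_add_left hm2]
        _ ≤ _ := add_le_add (hfarx x) (add_le_add (hlow x) le_rfl)
    by_contra hcon
    have hcon' : h x < ENNReal.ofReal (t / 2) := not_le.1 hcon
    have : ENNReal.ofReal t < ENNReal.ofReal t := calc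
      ENNReal.ofReal t < _ := hx
      _ ≤ _ := hsplit
      _ = ENNReal.ofReal (t / 2) + h x := by
        rw [← add_assoc, ← ENNReal.ofReal_add (by positivity) (by positivity)]; congr 2; ring
      _ ≤ ENNReal.ofReal (t / 2) + ENNReal.ofReal (t / 2) := by gcongr
      _ = ENNReal.ofReal t := by
        rw [← ENNReal.ofReal_add (by positivity) (by positivity)]; congr 1; ring
    exact lt_irrefl _ this
  have hint : ∫⁻ x, h x ≤ ENNReal.ofReal (K₂ * R ^ σ) * ∫⁻ y in S, F y := by
    rw [lintegral_lintegral_swap hjm.aemeasurable]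
    have : ∀ y, ∫⁻ x, B.indicator κ (x - y) * S.indicator F y ≤
        ENNReal.ofReal (K₂ * R ^ σ) * S.indicator F y := by
      intro y
      have hm : Measurable fun x => B.indicator κ (x - y) :=
        (hκm.indicator hBm).comp (measurable_id.sub measurable_const)
      rw [lintegral_mul_const _ hm]
      gcongr
      rw [lintegral_sub_right_eq_self (fun z => B.indicator κ z) y]
      have := hnearI 0
      rwa [lintegral_sub_left_eq_self (fun z => B.indicator κ z) 0] at this
    refine (lintegral_mono this).trans (le_of_eq ?_)
    rw [lintegral_const_mul' _ _ ENNReal.ofReal_ne_top, lintegral_indicator hSm]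
  calc _ ≤ volume {x | ENNReal.ofReal (t / 2) ≤ h x} := measure_mono hsub
    _ ≤ (∫⁻ x, h x) / ENNReal.ofReal (t / 2) :=
      meas_ge_le_lintegral_div hhm.aemeasurable (by simpa using ht) ENNReal.ofReal_ne_top
    _ ≤ (ENNReal.ofReal (K₂ * R ^ σ) * ∫⁻ y in S, F y) / ENNReal.ofReal (t / 2) := by gcongr
    _ = _ := by
      rw [ENNReal.div_eq_inv_mul, ← mul_assoc, ← ENNReal.ofReal_inv_of_pos (by positivity),
        ← ENNReal.ofReal_mul (by positivity), hRσ]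
      congr 2
      have : t ^ (1 - q / p) = t * t ^ (-(q / p)) := by
        rw [sub_eq_add_neg, Real.rpow_add ht, Real.rpow_one]
      rw [this]
      field_simp

/-- The Hardy–Littlewood–Sobolev inequality, for normalized functions. -/
lemma exists_lintegral_rpow_le_of_le_rieszPotential {n : ℕ} (hn : 1 ≤ n) {σ p q : ℝ} (hσ : 0 < σ)
    (hp : 1 < p) (hpn : p < n / σ) (hq : 1 / q = 1 / p - σ / n) :
    ∃ C : ℝ, 0 < C ∧ ∀ f : EuclideanSpace ℝ (Fin n) → ℝ, Measurable f →
      ∫⁻ y, ENNReal.ofReal (f y) ^ p ≤ 1 → ∀ u : EuclideanSpace ℝ (Fin n) → ℝ, AEMeasurable u →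
      (∀ᵐ x, 0 ≤ u x) → (∀ᵐ x, ENNReal.ofReal (u x) ≤
          ∫⁻ y, ENNReal.ofReal (‖x - y‖ ^ (-((n : ℝ) - σ))) * ENNReal.ofReal (f y)) →
      ∫⁻ x, ENNReal.ofReal (u x ^ q) ≤ ENNReal.ofReal C := by
  have hn0 : (0 : ℝ) < n := by exact_mod_cast hn
  have hp0 : 0 < p := by linarith
  have hpσ : p * σ < n := by rwa [lt_div_iff₀ hσ] at hpn
  have hq0 : 0 < q := by
    have : 0 < 1 / q := by
      rw [hq, sub_pos, div_lt_div_iff₀ hn0 hp0]; linarith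
    simpa using this
  obtain ⟨C, c, hC, hc, hdist⟩ := exists_volume_lt_rieszPotential_le hn hσ hp hpn hq
  -- The layer-cake weight t^{q-1} times the factor t^{-q/p} of the distributional bound is t^{e-1},
  -- integrable at 0 because p > 1.
  set e : ℝ := q - q / p with he
  have he0 : 0 < e := by
    rw [he, sub_pos, div_lt_iff₀ hp0]; nlinarith
  refine ⟨q * (C * (c ^ (-(p - 1)) / e)), by positivity, ?_⟩
  intro f hf hf1 u hu hu0 huT
  rw [lintegral_rpow_eq_lintegral_meas_lt_mul volume hu0 hu hq0, ENNReal.ofReal_mul hq0.le]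
  gcongr
  set A : Set (ℝ × EuclideanSpace ℝ (Fin n)) := {z | c * z.1 ^ (q / p) < f z.2} with hA
  have hAm : MeasurableSet A :=
    measurableSet_lt (by fun_prop) (hf.comp measurable_snd)
  set H : ℝ → EuclideanSpace ℝ (Fin n) → ENNReal := fun t y =>
    ENNReal.ofReal (C * t ^ (e - 1)) * A.indicator (fun z => ENNReal.ofReal (f z.2)) (t, y) with hH
  have hHm : Measurable (Function.uncurry H) := by
    refine Measurable.mul (f := fun z : ℝ × _ => ENNReal.ofReal (C * z.1 ^ (e - 1))) (by fun_prop) ?_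
    exact Measurable.indicator (hf.comp measurable_snd).ennreal_ofReal hAm
  calc ∫⁻ t in Ioi 0, volume {x | t < u x} * ENNReal.ofReal (t ^ (q - 1))
      ≤ ∫⁻ t in Ioi 0, ∫⁻ y, H t y := by
        refine setLIntegral_mono' measurableSet_Ioi fun t ht => ?_
        have ht : 0 < t := ht
        have h1 : volume {x | t < u x} ≤ ENNReal.ofReal (C * t ^ (-(q / p))) *
            ∫⁻ y in {y | c * t ^ (q / p) < f y}, ENNReal.ofReal (f y) := by
          refine le_trans (measure_mono_ae ?_) (hdist f hf hf1 t ht)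
          filter_upwards [huT] with x hx htx
          exact lt_of_lt_of_le ((ENNReal.ofReal_lt_ofReal_iff (ht.trans htx)).2 htx) hx
        have h2 : ∫⁻ y in {y | c * t ^ (q / p) < f y}, ENNReal.ofReal (f y) =
            ∫⁻ y, A.indicator (fun z => ENNReal.ofReal (f z.2)) (t, y) := by
          rw [← lintegral_indicator (measurableSet_lt measurable_const hf)]
          rfl
        simp only [hH]
        rw [lintegral_const_mul' _ _ ENNReal.ofReal_ne_top, ← h2]
        refine (mul_le_mul_left h1 _).trans (le_of_eq ?_)
        rw [mul_right_comm, ← ENNReal.ofReal_mul (by positivity), mul_assoc C, ← Real.rpow_add ht]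
        congr 4
        rw [he]; ring
    _ = ∫⁻ y, ∫⁻ t in Ioi 0, H t y := lintegral_lintegral_swap hHm.aemeasurable
    _ ≤ ∫⁻ y, ENNReal.ofReal (C * (c ^ (-(p - 1)) / e)) * ENNReal.ofReal (f y) ^ p := by
        refine lintegral_mono fun y => ?_
        rcases le_or_gt (f y) 0 with hy | hy
        · have : ∀ t, H t y = 0 := by
            intro t
            simp only [hH]
            by_cases hz : (t, y) ∈ A
            · rw [indicator_of_mem hz]; simp [ENNReal.ofReal_of_nonpos hy]
            · rw [indicator_of_notMem hz, mul_zero]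
          simp [this]
        -- After exchanging integrals, a fixed y contributes only for t < X. Since (p/q) e = p - 1,
        -- the power X^e is a multiple of f(y)^{p-1}, and the remaining factor f(y) completes
        -- f(y)^p.
        set X : ℝ := (f y / c) ^ (p / q) with hX
        have hmem : ∀ t, 0 < t → (t, y) ∈ A → t < X := by
          intro t ht htA
          have h3 : t ^ (q / p) < f y / c := by
            rw [lt_div_iff₀ hc, mul_comm]; exact htA
          have h4 := Real.rpow_lt_rpow (by positivity) h3 (show 0 < p / q by positivity)
          rw [← Real.rpow_mul ht.le] at h4
          have : q / p * (p / q) = 1 := by field_simp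
          rwa [this, Real.rpow_one] at h4
        calc ∫⁻ t in Ioi 0, H t y
            ≤ ∫⁻ t in Ioi 0, (Ioo 0 X).indicator (fun t => ENNReal.ofReal (C * f y) *
                ENNReal.ofReal (t ^ (e - 1))) t := by
              refine setLIntegral_mono' measurableSet_Ioi fun t ht => ?_
              have ht : 0 < t := ht
              simp only [hH]
              by_cases hz : (t, y) ∈ A
              · rw [indicator_of_mem hz, indicator_of_mem (show t ∈ Ioo 0 X from ⟨ht, hmem t ht hz⟩),
                  ← ENNReal.ofReal_mul (by positivity), ← ENNReal.ofReal_mul (by positivity)]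
                apply le_of_eq; congr 1; ring
              · rw [indicator_of_notMem hz, mul_zero]; exact zero_le
          _ = ENNReal.ofReal (C * f y) * ENNReal.ofReal (X ^ e / e) := by
              rw [setLIntegral_indicator measurableSet_Ioo,
                inter_eq_self_of_subset_left (show Ioo 0 X ⊆ Ioi 0 from Ioo_subset_Ioi_self),
                lintegral_const_mul' _ _ ENNReal.ofReal_ne_top,
                lintegral_Ioo_rpow_sub_one he0 (by positivity)]
          _ = _ := by
              rw [ENNReal.ofReal_rpow_of_nonneg hy.le hp0.le, ← ENNReal.ofReal_mul (by positivity),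
                ← ENNReal.ofReal_mul (by positivity)]
              congr 1
              have h5 : X ^ e = c ^ (-(p - 1)) * f y ^ (p - 1) := by
                rw [hX, ← Real.rpow_mul (by positivity)]
                have : p / q * e = p - 1 := by rw [he]; field_simp
                rw [this, Real.div_rpow hy.le hc.le, Real.rpow_neg hc.le]
                field_simp
              have h6 : f y ^ p = f y * f y ^ (p - 1) := by
                rw [Real.rpow_sub_one hy.ne']; field_simp
              rw [h5, h6]; ring
    _ ≤ _ := by
        rw [lintegral_const_mul' _ _ ENNReal.ofReal_ne_top]
        exact mul_le_of_le_one_right' hf1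

/-! ### The model kernel as the inverse of a quasi-metric -/

section Kernel

variable {n : ℕ} {Ω : Set (EuclideanSpace ℝ (Fin n))} {s γ : ℝ}

lemma continuous_bdist : Continuous (bdist Ω) := Metric.continuous_infDist_pt _

lemma bdist_nonneg (x : EuclideanSpace ℝ (Fin n)) : 0 ≤ bdist Ω x := Metric.infDist_nonneg

lemma bdist_le_add (x y : EuclideanSpace ℝ (Fin n)) : bdist Ω x ≤ bdist Ω y + ‖x - y‖ := by
  rw [← dist_eq_norm]; exact Metric.infDist_le_infDist_add_dist

namespace IsBoundedC11

lemma frontier_nonempty (hΩ : IsBoundedC11 Ω) (hn : 1 ≤ n) : (frontier Ω).Nonempty := by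
  have : Nontrivial (EuclideanSpace ℝ (Fin n)) :=
    Module.nontrivial_of_finrank_pos (R := ℝ) (by simpa using Nat.lt_of_lt_of_le Nat.zero_lt_one hn)
  refine nonempty_frontier_iff.2 ⟨hΩ.nonempty, fun h => ?_⟩
  exact NormedSpace.unbounded_univ ℝ (EuclideanSpace ℝ (Fin n)) (h ▸ hΩ.bounded)

lemma bdist_pos (hΩ : IsBoundedC11 Ω) (hn : 1 ≤ n) {x : EuclideanSpace ℝ (Fin n)} (hx : x ∈ Ω) :
    0 < bdist Ω x := by
  refine (isClosed_frontier.notMem_iff_infDist_pos (hΩ.frontier_nonempty hn)).1 fun h => ?_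
  rw [hΩ.isOpen.frontier_eq] at h
  exact h.2 hx

lemma exists_bound (hΩ : IsBoundedC11 Ω) (hn : 1 ≤ n) :
    ∃ D : ℝ, 1 ≤ D ∧ (∀ x ∈ Ω, bdist Ω x ≤ D) ∧ ∀ x ∈ Ω, ∀ y ∈ Ω, ‖x - y‖ ≤ D := by
  have hb : Bornology.IsBounded (closure Ω) := hΩ.bounded.closure
  refine ⟨Metric.diam (closure Ω) + 1, by linarith [Metric.diam_nonneg (s := closure Ω)], ?_, ?_⟩
  · intro x hx
    obtain ⟨z, hz⟩ := hΩ.frontier_nonempty hn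
    have h1 : bdist Ω x ≤ dist x z := Metric.infDist_le_dist_of_mem hz
    have h2 := Metric.dist_le_diam_of_mem hb (subset_closure hx) (frontier_subset_closure hz)
    linarith
  · intro x hx y hy
    have h2 := Metric.dist_le_diam_of_mem hb (subset_closure hx) (subset_closure hy)
    rw [← dist_eq_norm]; linarith

lemma volume_lt_top (hΩ : IsBoundedC11 Ω) : volume Ω < ⊤ := hΩ.bounded.measure_lt_top

end IsBoundedC11

/-- The largest of `|x - y|`, `δ(x)`, `δ(y)`. -/
noncomputable def maxDist (Ω : Set (EuclideanSpace ℝ (Fin n))) (x y : EuclideanSpace ℝ (Fin n)) :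
    ℝ :=
  max ‖x - y‖ (max (bdist Ω x) (bdist Ω y))

/-- The quasi-metric whose inverse, multiplied by `δ^γ(x) δ^γ(y)`, is comparable to the model
kernel. -/
noncomputable def quasiDist (Ω : Set (EuclideanSpace ℝ (Fin n))) (s γ : ℝ)
    (x y : EuclideanSpace ℝ (Fin n)) : ℝ :=
  ‖x - y‖ ^ ((n : ℝ) - 2 * s) * maxDist Ω x y ^ (2 * γ)

lemma maxDist_comm (x y : EuclideanSpace ℝ (Fin n)) : maxDist Ω x y = maxDist Ω y x := by
  rw [maxDist, maxDist, norm_sub_rev, max_comm (bdist Ω x)]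

lemma quasiDist_comm (x y : EuclideanSpace ℝ (Fin n)) :
    quasiDist Ω s γ x y = quasiDist Ω s γ y x := by
  rw [quasiDist, quasiDist, maxDist_comm, norm_sub_rev]

lemma maxDist_nonneg (x y : EuclideanSpace ℝ (Fin n)) : 0 ≤ maxDist Ω x y :=
  le_max_of_le_left (norm_nonneg _)

lemma quasiDist_nonneg (x y : EuclideanSpace ℝ (Fin n)) : 0 ≤ quasiDist Ω s γ x y :=
  mul_nonneg (Real.rpow_nonneg (norm_nonneg _) _) (Real.rpow_nonneg (maxDist_nonneg _ _) _)

lemma maxDist_pos {x y : EuclideanSpace ℝ (Fin n)} (hxy : x ≠ y) : 0 < maxDist Ω x y :=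
  lt_max_of_lt_left (norm_pos_iff.2 (sub_ne_zero.2 hxy))

lemma quasiDist_pos {x y : EuclideanSpace ℝ (Fin n)} (hxy : x ≠ y) : 0 < quasiDist Ω s γ x y :=
  mul_pos (Real.rpow_pos_of_pos (norm_pos_iff.2 (sub_ne_zero.2 hxy)) _)
    (Real.rpow_pos_of_pos (maxDist_pos hxy) _)

lemma measurable_quasiDist :
    Measurable fun z : EuclideanSpace ℝ (Fin n) × EuclideanSpace ℝ (Fin n) =>
      quasiDist Ω s γ z.1 z.2 := by
  have h : Measurable (bdist Ω) := continuous_bdist.measurable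
  have h1 : Measurable fun z : EuclideanSpace ℝ (Fin n) × EuclideanSpace ℝ (Fin n) =>
    bdist Ω z.1 := h.comp measurable_fst
  have h2 : Measurable fun z : EuclideanSpace ℝ (Fin n) × EuclideanSpace ℝ (Fin n) =>
    bdist Ω z.2 := h.comp measurable_snd
  have h3 : Measurable fun z : EuclideanSpace ℝ (Fin n) × EuclideanSpace ℝ (Fin n) =>
    ‖z.1 - z.2‖ := by fun_prop
  exact (h3.pow_const _).mul ((h3.max (h1.max h2)).pow_const _)

lemma maxDist_le_three_mul {x y z : EuclideanSpace ℝ (Fin n)} (h : ‖x - y‖ ≤ 2 * ‖x - z‖) :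
    maxDist Ω x y ≤ 3 * maxDist Ω x z := by
  have h1 : ‖x - z‖ ≤ maxDist Ω x z := le_max_left _ _
  have h2 : bdist Ω x ≤ maxDist Ω x z := le_max_of_le_right (le_max_left _ _)
  have h3 := bdist_le_add (Ω := Ω) y x
  rw [norm_sub_rev] at h3
  have h4 := maxDist_nonneg (Ω := Ω) x z
  refine max_le (by linarith) (max_le (by linarith) (by linarith))

lemma quasiDist_le_of_norm_le (hns : 2 * s < n) (hγ : 0 < γ) {x y z : EuclideanSpace ℝ (Fin n)}
    (h : ‖x - y‖ ≤ 2 * ‖x - z‖) :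
    quasiDist Ω s γ x y ≤ 2 ^ ((n : ℝ) - 2 * s) * 3 ^ (2 * γ) * quasiDist Ω s γ x z := by
  have h1 : ‖x - y‖ ^ ((n : ℝ) - 2 * s) ≤ (2 * ‖x - z‖) ^ ((n : ℝ) - 2 * s) :=
    Real.rpow_le_rpow (norm_nonneg _) h (by linarith)
  have h2 : maxDist Ω x y ^ (2 * γ) ≤ (3 * maxDist Ω x z) ^ (2 * γ) :=
    Real.rpow_le_rpow (maxDist_nonneg _ _) (maxDist_le_three_mul h) (by linarith)
  rw [Real.mul_rpow (by norm_num) (norm_nonneg _)] at h1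
  rw [Real.mul_rpow (by norm_num) (maxDist_nonneg _ _)] at h2
  refine (mul_le_mul h1 h2 (Real.rpow_nonneg (maxDist_nonneg _ _) _) (by positivity)).trans
    (le_of_eq ?_)
  rw [quasiDist]; ring

/-- The longer of the legs x–z and z–y has at least half the length of x–y. Comparing from the
endpoint on that leg, the 1-Lipschitz δ also changes the largest distance by at most a factor 3; 2s
< n makes d increasing in both factors. -/
lemma exists_quasiDist_le_max (hns : 2 * s < n) (hγ : 0 < γ) :
    ∃ Q : ℝ, 1 ≤ Q ∧ ∀ x y z : EuclideanSpace ℝ (Fin n),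
      quasiDist Ω s γ x y ≤ Q * max (quasiDist Ω s γ x z) (quasiDist Ω s γ z y) := by
  have hQ0 : (0 : ℝ) ≤ 2 ^ ((n : ℝ) - 2 * s) * 3 ^ (2 * γ) := by positivity
  refine ⟨2 ^ ((n : ℝ) - 2 * s) * 3 ^ (2 * γ), ?_, fun x y z => ?_⟩
  · exact one_le_mul_of_one_le_of_one_le (Real.one_le_rpow (by norm_num) (by linarith))
      (Real.one_le_rpow (by norm_num) (by linarith))
  · have htri := norm_sub_le_norm_sub_add_norm_sub x z y
    rcases le_total ‖z - y‖ ‖x - z‖ with h | h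
    · exact (quasiDist_le_of_norm_le hns hγ (by linarith)).trans
        (mul_le_mul_of_nonneg_left (le_max_left _ _) hQ0)
    · rw [quasiDist_comm x y, quasiDist_comm z y]
      rw [norm_sub_rev x y, norm_sub_rev z y] at htri
      rw [norm_sub_rev z y] at h
      exact (quasiDist_le_of_norm_le hns hγ (by linarith)).trans
        (mul_le_mul_of_nonneg_left (le_max_right _ _) hQ0)

/-- The three-point inequality, for a = d(x,z), b = d(z,y), d = d(x,y). The larger of a and b is at
least d/Q and pays for d^{-(τ-ε)}; what is left of the exponents, 1 + ε in total, is shifted onto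
the smaller one. -/
lemma inv_mul_rpow_neg_le {a b d Q ε τ : ℝ} (ha : 0 < a) (hb : 0 < b) (hd : 0 < d) (hQ : 1 ≤ Q)
    (h : d ≤ Q * max a b) (hε : 0 ≤ ε) (hετ : ε ≤ τ) (hτ : τ ≤ 1) :
    a ^ (-1 : ℝ) * b ^ (-τ) ≤ Q * d ^ (-(τ - ε)) * (a ^ (-(1 + ε)) + b ^ (-(1 + ε))) := by
  have hQ0 : 0 < Q := by linarith
  have hm : 0 < max a b := lt_max_of_lt_left ha
  have h1 : (max a b) ^ (-(τ - ε)) ≤ Q * d ^ (-(τ - ε)) := by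
    have h2 : (Q * max a b) ^ (-(τ - ε)) ≤ d ^ (-(τ - ε)) :=
      Real.rpow_le_rpow_of_nonpos hd h (by linarith)
    rw [Real.mul_rpow hQ0.le hm.le] at h2
    have h3 : Q ^ (τ - ε) ≤ Q := by
      conv_rhs => rw [← Real.rpow_one Q]
      exact Real.rpow_le_rpow_of_exponent_le hQ (by linarith)
    calc (max a b) ^ (-(τ - ε)) = Q ^ (τ - ε) * (Q ^ (-(τ - ε)) * (max a b) ^ (-(τ - ε))) := by
          rw [← mul_assoc, ← Real.rpow_add hQ0]; simp
      _ ≤ Q * d ^ (-(τ - ε)) := by gcongr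
  rcases le_total a b with hab | hab
  · rw [max_eq_right hab] at h1
    have e1 : b ^ (-τ) = b ^ (-(τ - ε)) * b ^ (-ε) := by rw [← Real.rpow_add hb]; congr 1; ring
    have e2 : a ^ (-(1 + ε)) = a ^ (-1 : ℝ) * a ^ (-ε) := by
      rw [← Real.rpow_add ha]; congr 1; ring
    have h4 : b ^ (-ε) ≤ a ^ (-ε) := Real.rpow_le_rpow_of_nonpos ha hab (by linarith)
    calc a ^ (-1 : ℝ) * b ^ (-τ) = b ^ (-(τ - ε)) * (a ^ (-1 : ℝ) * b ^ (-ε)) := by rw [e1]; ring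
      _ ≤ Q * d ^ (-(τ - ε)) * (a ^ (-1 : ℝ) * a ^ (-ε)) := by gcongr
      _ ≤ _ := by rw [← e2]; gcongr; exact le_add_of_nonneg_right (by positivity)
  · rw [max_eq_left hab] at h1
    have e1 : a ^ (-1 : ℝ) = a ^ (-(τ - ε)) * a ^ (-(1 - τ + ε)) := by
      rw [← Real.rpow_add ha]; congr 1; ring
    have e2 : b ^ (-(1 + ε)) = b ^ (-(1 - τ + ε)) * b ^ (-τ) := by
      rw [← Real.rpow_add hb]; congr 1; ring
    have h4 : a ^ (-(1 - τ + ε)) ≤ b ^ (-(1 - τ + ε)) :=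
      Real.rpow_le_rpow_of_nonpos hb hab (by linarith)
    calc a ^ (-1 : ℝ) * b ^ (-τ) = a ^ (-(τ - ε)) * (a ^ (-(1 - τ + ε)) * b ^ (-τ)) := by
          rw [e1]; ring
      _ ≤ Q * d ^ (-(τ - ε)) * (b ^ (-(1 - τ + ε)) * b ^ (-τ)) := by gcongr
      _ ≤ _ := by rw [← e2]; gcongr; exact le_add_of_nonneg_left (by positivity)

/-- The powers of the quasi-metric, weighted by `δ^γ`. -/
noncomputable def potKernel (Ω : Set (EuclideanSpace ℝ (Fin n))) (s γ τ : ℝ)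
    (x y : EuclideanSpace ℝ (Fin n)) : ℝ :=
  bdist Ω x ^ γ * bdist Ω y ^ γ * quasiDist Ω s γ x y ^ (-τ)

lemma potKernel_nonneg {τ : ℝ} (x y : EuclideanSpace ℝ (Fin n)) : 0 ≤ potKernel Ω s γ τ x y :=
  mul_nonneg (mul_nonneg (Real.rpow_nonneg (bdist_nonneg _) _)
    (Real.rpow_nonneg (bdist_nonneg _) _)) (Real.rpow_nonneg (quasiDist_nonneg _ _) _)

lemma potKernel_comm {τ : ℝ} (x y : EuclideanSpace ℝ (Fin n)) :
    potKernel Ω s γ τ x y = potKernel Ω s γ τ y x := by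
  rw [potKernel, potKernel, quasiDist_comm, mul_comm (bdist Ω x ^ γ)]

lemma measurable_potKernel {τ : ℝ} :
    Measurable fun z : EuclideanSpace ℝ (Fin n) × EuclideanSpace ℝ (Fin n) =>
      potKernel Ω s γ τ z.1 z.2 := by
  have h : Measurable (bdist Ω) := continuous_bdist.measurable
  exact (((h.comp measurable_fst).pow_const γ).mul ((h.comp measurable_snd).pow_const γ)).mul
    (measurable_quasiDist.pow_const _)

/-- Let a be the larger of the two. If a ≤ r, both quotients are kept. If r ≤ a ≤ 2r, r may be
replaced by a at the cost of a factor 2. If a ≥ 2r, then b ≥ a/2 because a and b differ by at most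
r. -/
lemma min_div_mul_min_div_le {a b r : ℝ} (ha : 0 < a) (hb : 0 < b) (hr : 0 < r)
    (hab : a ≤ b + r) (hba : b ≤ a + r) :
    min (a / r) 1 * min (b / r) 1 ≤ 4 * (a * b / max r (max a b) ^ 2) := by
  wlog hle : b ≤ a generalizing a b
  · have := this hb ha hba hab (le_of_not_ge hle)
    rwa [mul_comm, mul_comm a b, max_comm a b]
  rw [max_eq_left hle]
  have hm : 0 ≤ min (b / r) 1 := le_min (by positivity) zero_le_one
  rcases le_total a r with har | har
  · rw [max_eq_left har]
    calc min (a / r) 1 * min (b / r) 1 ≤ (a / r) * (b / r) :=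
          mul_le_mul (min_le_left _ _) (min_le_left _ _) hm (by positivity)
      _ = a * b / r ^ 2 := by field_simp
      _ ≤ _ := by linarith [show 0 ≤ a * b / r ^ 2 by positivity]
  · rw [max_eq_right har]
    have h1 : min (a / r) 1 * min (b / r) 1 ≤ min (b / r) 1 :=
      mul_le_of_le_one_left hm (min_le_right _ _)
    have h2 : 4 * (a * b / a ^ 2) = 4 * (b / a) := by field_simp
    rw [h2]
    refine h1.trans ?_
    rcases le_total a (2 * r) with h3 | h3
    · refine (min_le_left _ _).trans ?_
      rw [mul_div_assoc', div_le_div_iff₀ hr ha]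
      nlinarith
    · refine (min_le_right _ _).trans ?_
      rw [mul_div_assoc', le_div_iff₀ ha]
      linarith

lemma modelKernel_eq {x y : EuclideanSpace ℝ (Fin n)} (hγ : 0 < γ) (hxy : x ≠ y) :
    modelKernel Ω s γ x y = ‖x - y‖ ^ (-((n : ℝ) - 2 * s)) *
      (min (bdist Ω x / ‖x - y‖) 1 * min (bdist Ω y / ‖x - y‖) 1) ^ γ := by
  have hr : 0 < ‖x - y‖ := norm_pos_iff.2 (sub_ne_zero.2 hxy)
  have key : ∀ a : ℝ, 0 ≤ a → min (a ^ γ / ‖x - y‖ ^ γ) 1 = (min (a / ‖x - y‖) 1) ^ γ := by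
    intro a ha
    rw [← Real.div_rpow ha hr.le]
    rcases le_total (a / ‖x - y‖) 1 with h | h
    · rw [min_eq_left h, min_eq_left (Real.rpow_le_one (by positivity) h hγ.le)]
    · rw [min_eq_right h, min_eq_right (Real.one_le_rpow h hγ.le), Real.one_rpow]
  have hm : ∀ a : ℝ, 0 ≤ a → 0 ≤ min (a / ‖x - y‖) 1 :=
    fun a ha => le_min (by positivity) zero_le_one
  rw [modelKernel, key _ (bdist_nonneg _), key _ (bdist_nonneg _),
    Real.mul_rpow (hm _ (bdist_nonneg _)) (hm _ (bdist_nonneg _)), Real.rpow_neg hr.le, one_div,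
    mul_assoc]

lemma potKernel_one_eq {x y : EuclideanSpace ℝ (Fin n)} (hxy : x ≠ y) :
    potKernel Ω s γ 1 x y = ‖x - y‖ ^ (-((n : ℝ) - 2 * s)) *
      (bdist Ω x * bdist Ω y / maxDist Ω x y ^ 2) ^ γ := by
  have hr : 0 < ‖x - y‖ := norm_pos_iff.2 (sub_ne_zero.2 hxy)
  have hM := maxDist_pos (Ω := Ω) hxy
  rw [potKernel, quasiDist, Real.mul_rpow (by positivity) (by positivity), ← Real.rpow_mul hr.le,
    ← Real.rpow_mul hM.le, Real.div_rpow (mul_nonneg (bdist_nonneg _) (bdist_nonneg _))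
    (by positivity), Real.mul_rpow (bdist_nonneg _) (bdist_nonneg _), ← Real.rpow_natCast,
    ← Real.rpow_mul hM.le, mul_neg_one, mul_neg_one, Real.rpow_neg hM.le, div_eq_mul_inv]
  push_cast
  ring

lemma modelKernel_le_potKernel (hΩ : IsBoundedC11 Ω) (hn : 1 ≤ n) (hγ : γ ∈ Ioc (0 : ℝ) 1)
    {x y : EuclideanSpace ℝ (Fin n)} (hx : x ∈ Ω) (hy : y ∈ Ω) (hxy : x ≠ y) :
    modelKernel Ω s γ x y ≤ 4 * potKernel Ω s γ 1 x y := by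
  have hr : 0 < ‖x - y‖ := norm_pos_iff.2 (sub_ne_zero.2 hxy)
  have hxp := hΩ.bdist_pos hn hx
  have hyp := hΩ.bdist_pos hn hy
  have h1 := min_div_mul_min_div_le hxp hyp hr (bdist_le_add x y)
    (by rw [norm_sub_rev]; exact bdist_le_add y x)
  change _ ≤ 4 * (_ / maxDist Ω x y ^ 2) at h1
  rw [modelKernel_eq hγ.1 hxy, potKernel_one_eq hxy]
  have h0 : 0 ≤ min (bdist Ω x / ‖x - y‖) 1 * min (bdist Ω y / ‖x - y‖) 1 :=
    mul_nonneg (le_min (by positivity) zero_le_one) (le_min (by positivity) zero_le_one)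
  have h2 := Real.rpow_le_rpow h0 h1 hγ.1.le
  have hM := maxDist_pos (Ω := Ω) hxy
  have h4 : (4 : ℝ) ^ γ ≤ 4 := by
    conv_rhs => rw [← Real.rpow_one 4]
    exact Real.rpow_le_rpow_of_exponent_le (by norm_num) hγ.2
  rw [Real.mul_rpow (x := 4) (by norm_num) (by positivity)] at h2
  have h3 : 0 ≤ (bdist Ω x * bdist Ω y / maxDist Ω x y ^ 2) ^ γ := by positivity
  calc _ ≤ ‖x - y‖ ^ (-((n : ℝ) - 2 * s)) *
        (4 * (bdist Ω x * bdist Ω y / maxDist Ω x y ^ 2) ^ γ) := by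
        exact mul_le_mul_of_nonneg_left (h2.trans (mul_le_mul_of_nonneg_right h4 h3))
          (by positivity)
    _ = _ := by ring

lemma potKernel_le_modelKernel (hΩ : IsBoundedC11 Ω) (hn : 1 ≤ n) (hγ : γ ∈ Ioc (0 : ℝ) 1)
    {x y : EuclideanSpace ℝ (Fin n)} (hx : x ∈ Ω) (hy : y ∈ Ω) (hxy : x ≠ y) :
    potKernel Ω s γ 1 x y ≤ modelKernel Ω s γ x y := by
  have hr : 0 < ‖x - y‖ := norm_pos_iff.2 (sub_ne_zero.2 hxy)
  have hxp := hΩ.bdist_pos hn hx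
  have hyp := hΩ.bdist_pos hn hy
  have hM := maxDist_pos (Ω := Ω) hxy
  rw [modelKernel_eq hγ.1 hxy, potKernel_one_eq hxy]
  have key : ∀ a, 0 < a → a ≤ maxDist Ω x y → a / maxDist Ω x y ≤ min (a / ‖x - y‖) 1 := by
    intro a ha haM
    refine le_min (div_le_div_of_nonneg_left ha.le hr (le_max_left _ _)) ?_
    rwa [div_le_one hM]
  have h1 := key _ hxp (le_max_of_le_right (le_max_left _ _))
  have h2 := key _ hyp (le_max_of_le_right (le_max_right _ _))
  have h3 : bdist Ω x * bdist Ω y / maxDist Ω x y ^ 2 ≤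
      min (bdist Ω x / ‖x - y‖) 1 * min (bdist Ω y / ‖x - y‖) 1 := by
    calc bdist Ω x * bdist Ω y / maxDist Ω x y ^ 2
        = bdist Ω x / maxDist Ω x y * (bdist Ω y / maxDist Ω x y) := by field_simp
      _ ≤ _ := mul_le_mul h1 h2 (by positivity) (le_trans (by positivity) h1)
  exact mul_le_mul_of_nonneg_left (Real.rpow_le_rpow (by positivity) h3 hγ.1.le) (by positivity)

end Kernel

/-! ### Potentials with kernel δ^γ(x) δ^γ(y) d(x,y)^{-τ} and their composition -/

section Potential

variable {n : ℕ} {Ω : Set (EuclideanSpace ℝ (Fin n))} {s γ : ℝ}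

lemma exists_lintegral_norm_sub_rpow_le (hΩ : IsBoundedC11 Ω) (hn : 1 ≤ n) {β : ℝ} (hβ : β < n) :
    ∃ C : ℝ, 0 < C ∧ ∀ x ∈ Ω, ∫⁻ y in Ω, ENNReal.ofReal (‖x - y‖ ^ (-β)) ≤ ENNReal.ofReal C := by
  obtain ⟨D, hD1, -, hD⟩ := hΩ.exists_bound hn
  obtain ⟨C, hC, hball⟩ := exists_lintegral_ball_norm_rpow_le hn hβ
  have hD0 : 0 < D + 1 := by linarith
  refine ⟨C * (D + 1) ^ ((n : ℝ) - β), by positivity, fun x hx => ?_⟩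
  refine le_trans ?_ (hball (D + 1) hD0)
  rw [← lintegral_comp_sub_left_restrict x measurableSet_ball, ← lintegral_indicator
    hΩ.isOpen.measurableSet]
  refine lintegral_mono fun y => ?_
  by_cases hy : y ∈ Ω
  · rw [indicator_of_mem hy, indicator_of_mem]
    rw [mem_ball_zero_iff]
    linarith [hD x hx y hy]
  · rw [indicator_of_notMem hy]; exact zero_le

/-- The weight δ(z)^{2γ} produced by composing two kernels absorbs one factor max^{-2γ} of the
quasi-metric. Only a Riesz kernel remains, locally integrable when ε is small. -/
lemma quasiDist_rpow_mul_bdist_rpow_le (hΩ : IsBoundedC11 Ω) (hn : 1 ≤ n) (hγ : 0 < γ) {ε : ℝ}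
    (hε : 0 ≤ ε) {x z : EuclideanSpace ℝ (Fin n)} (hz : z ∈ Ω) (hxz : x ≠ z) :
    quasiDist Ω s γ x z ^ (-(1 + ε)) * bdist Ω z ^ (2 * γ) ≤
      ‖x - z‖ ^ (-(((n : ℝ) - 2 * s) * (1 + ε) + 2 * γ * ε)) := by
  have hr : 0 < ‖x - z‖ := norm_pos_iff.2 (sub_ne_zero.2 hxz)
  have hM := maxDist_pos (Ω := Ω) hxz
  have hzp := hΩ.bdist_pos hn hz
  have hrM : ‖x - z‖ ≤ maxDist Ω x z := le_max_left _ _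
  have hzM : bdist Ω z ≤ maxDist Ω x z := le_max_of_le_right (le_max_right _ _)
  rw [quasiDist, Real.mul_rpow (by positivity) (by positivity), ← Real.rpow_mul hr.le,
    ← Real.rpow_mul hM.le]
  have e1 : maxDist Ω x z ^ (2 * γ * -(1 + ε)) =
      maxDist Ω x z ^ (-(2 * γ)) * maxDist Ω x z ^ (-(2 * γ * ε)) := by
    rw [← Real.rpow_add hM]; congr 1; ring
  have e2 : ‖x - z‖ ^ (-(((n : ℝ) - 2 * s) * (1 + ε) + 2 * γ * ε)) =
      ‖x - z‖ ^ (((n : ℝ) - 2 * s) * -(1 + ε)) * ‖x - z‖ ^ (-(2 * γ * ε)) := by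
    rw [← Real.rpow_add hr]; congr 1; ring
  have h1 : maxDist Ω x z ^ (-(2 * γ * ε)) ≤ ‖x - z‖ ^ (-(2 * γ * ε)) :=
    Real.rpow_le_rpow_of_nonpos hr hrM (by nlinarith [mul_nonneg hγ.le hε])
  have h2 : maxDist Ω x z ^ (-(2 * γ)) * bdist Ω z ^ (2 * γ) ≤ 1 := by
    rw [Real.rpow_neg hM.le, inv_mul_le_one₀ (by positivity)]
    exact Real.rpow_le_rpow hzp.le hzM (by linarith)
  rw [e1, e2]
  calc _ = ‖x - z‖ ^ (((n : ℝ) - 2 * s) * -(1 + ε)) * (maxDist Ω x z ^ (-(2 * γ * ε)) *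
        (maxDist Ω x z ^ (-(2 * γ)) * bdist Ω z ^ (2 * γ))) := by ring
    _ ≤ ‖x - z‖ ^ (((n : ℝ) - 2 * s) * -(1 + ε)) * (‖x - z‖ ^ (-(2 * γ * ε)) * 1) := by gcongr
    _ = _ := by ring

/-- The potential with kernel `potKernel` on `Ω`. -/
noncomputable def pot (Ω : Set (EuclideanSpace ℝ (Fin n))) (s γ τ : ℝ)
    (g : EuclideanSpace ℝ (Fin n) → ENNReal) (x : EuclideanSpace ℝ (Fin n)) : ENNReal :=
  ∫⁻ y in Ω, ENNReal.ofReal (potKernel Ω s γ τ x y) * g y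

lemma pot_mono_ae {τ : ℝ} {g g' : EuclideanSpace ℝ (Fin n) → ENNReal}
    (h : ∀ᵐ y ∂(volume.restrict Ω), g y ≤ g' y) (x : EuclideanSpace ℝ (Fin n)) :
    pot Ω s γ τ g x ≤ pot Ω s γ τ g' x := by
  refine lintegral_mono_ae ?_
  filter_upwards [h] with y hy
  gcongr

lemma pot_const_mul {τ : ℝ} {c : ENNReal} (hc : c ≠ ⊤) (g : EuclideanSpace ℝ (Fin n) → ENNReal)
    (x : EuclideanSpace ℝ (Fin n)) :
    pot Ω s γ τ (fun y => c * g y) x = c * pot Ω s γ τ g x := by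
  rw [pot, pot, ← lintegral_const_mul' _ _ hc]
  congr 1; ext y; ring

lemma aemeasurable_uncurry_potKernel_mul {τ : ℝ} {g : EuclideanSpace ℝ (Fin n) → ENNReal}
    (hg : AEMeasurable g (volume.restrict Ω)) (ν : Measure (EuclideanSpace ℝ (Fin n))) [SFinite ν] :
    AEMeasurable (Function.uncurry fun x y => ENNReal.ofReal (potKernel Ω s γ τ x y) * g y)
      (ν.prod (volume.restrict Ω)) :=
  measurable_potKernel.ennreal_ofReal.aemeasurable.mul hg.comp_snd

lemma lintegral_mul_pot {τ : ℝ} {g h : EuclideanSpace ℝ (Fin n) → ENNReal}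
    (hg : AEMeasurable g (volume.restrict Ω)) (hh : AEMeasurable h (volume.restrict Ω)) :
    ∫⁻ x in Ω, h x * pot Ω s γ τ g x = ∫⁻ x in Ω, pot Ω s γ τ h x * g x := by
  have hm1 : ∀ x, AEMeasurable (fun y => ENNReal.ofReal (potKernel Ω s γ τ x y) * g y)
      (volume.restrict Ω) := fun x =>
    (measurable_potKernel.comp measurable_prodMk_left).ennreal_ofReal.aemeasurable.mul hg
  have hm2 : ∀ x, AEMeasurable (fun y => ENNReal.ofReal (potKernel Ω s γ τ x y) * h y)
      (volume.restrict Ω) := fun x =>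
    (measurable_potKernel.comp measurable_prodMk_left).ennreal_ofReal.aemeasurable.mul hh
  calc ∫⁻ x in Ω, h x * pot Ω s γ τ g x
      = ∫⁻ x in Ω, ∫⁻ y in Ω, h x * (ENNReal.ofReal (potKernel Ω s γ τ x y) * g y) := by
        congr 1; ext x; rw [pot, lintegral_const_mul'' _ (hm1 x)]
    _ = ∫⁻ y in Ω, ∫⁻ x in Ω, h x * (ENNReal.ofReal (potKernel Ω s γ τ x y) * g y) :=
        lintegral_lintegral_swap (hh.comp_fst.mul (aemeasurable_uncurry_potKernel_mul hg _))
    _ = _ := by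
        congr 1; ext y
        rw [pot, ← lintegral_mul_const'' _ (hm2 y)]
        congr 1; ext x
        rw [potKernel_comm x y]; ring

/-- The smoothing step. The three-point inequality extracts d(x,y)^{-(τ-ε)}, and the integral over
the middle point reduces to two Riesz integrals bounded uniformly on Ω. The constant does not depend
on τ. -/
lemma exists_pot_pot_le (hΩ : IsBoundedC11 Ω) (hn : 1 ≤ n) (hs : 2 * s < n)
    (hγ : 0 < γ) {ε : ℝ} (hε : 0 ≤ ε) (hεn : ((n : ℝ) - 2 * s) * (1 + ε) + 2 * γ * ε < n) :
    ∃ C : ℝ, 0 < C ∧ ∀ τ : ℝ, ε ≤ τ → τ ≤ 1 → ∀ g : EuclideanSpace ℝ (Fin n) → ENNReal,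
      AEMeasurable g (volume.restrict Ω) → ∀ x ∈ Ω,
        pot Ω s γ 1 (pot Ω s γ τ g) x ≤ ENNReal.ofReal C * pot Ω s γ (τ - ε) g x := by
  have : Nontrivial (EuclideanSpace ℝ (Fin n)) :=
    Module.nontrivial_of_finrank_pos (R := ℝ) (by simpa using Nat.lt_of_lt_of_le Nat.zero_lt_one hn)
  obtain ⟨Q, hQ1, hQ⟩ := exists_quasiDist_le_max (Ω := Ω) hs hγ
  obtain ⟨C, hC, hR⟩ := exists_lintegral_norm_sub_rpow_le hΩ hn hεn
  refine ⟨Q * (2 * C), by positivity, fun τ hετ hτ g hg x hx => ?_⟩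
  have hne : ∀ a : EuclideanSpace ℝ (Fin n), ∀ᵐ z ∂(volume.restrict Ω), z ≠ a := fun a =>
    ae_restrict_of_ae (Measure.ae_ne volume a)
  have hmem : ∀ᵐ z ∂(volume.restrict Ω), z ∈ Ω := ae_restrict_mem hΩ.isOpen.measurableSet
  set ρ : EuclideanSpace ℝ (Fin n) → EuclideanSpace ℝ (Fin n) → ENNReal := fun x z =>
    ENNReal.ofReal (‖x - z‖ ^ (-(((n : ℝ) - 2 * s) * (1 + ε) + 2 * γ * ε))) with hρ
  have hρm : ∀ a, Measurable (ρ a) := fun a => by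
    simp only [hρ]; fun_prop
  have hkm : ∀ (t : ℝ) (a : EuclideanSpace ℝ (Fin n)),
      Measurable fun y => ENNReal.ofReal (potKernel Ω s γ t a y) :=
    fun t a => (measurable_potKernel.comp measurable_prodMk_left).ennreal_ofReal
  have hpt : ∀ y ∈ Ω, x ≠ y → ∀ z ∈ Ω, z ≠ x → z ≠ y →
      ENNReal.ofReal (potKernel Ω s γ 1 x z) * ENNReal.ofReal (potKernel Ω s γ τ z y) ≤
        ENNReal.ofReal (Q * potKernel Ω s γ (τ - ε) x y) * (ρ x z + ρ y z) := by
    intro y hy hxy z hz hzx hzy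
    have hzp := hΩ.bdist_pos hn hz
    have hδx := Real.rpow_nonneg (bdist_nonneg (Ω := Ω) x) γ
    have hδy := Real.rpow_nonneg (bdist_nonneg (Ω := Ω) y) γ
    have key := inv_mul_rpow_neg_le (quasiDist_pos (Ω := Ω) (s := s) (γ := γ) hzx.symm)
      (quasiDist_pos (Ω := Ω) (s := s) (γ := γ) hzy) (quasiDist_pos (Ω := Ω) (s := s) (γ := γ) hxy)
      hQ1 (hQ x y z) hε hετ hτ
    have k1 := quasiDist_rpow_mul_bdist_rpow_le (s := s) hΩ hn hγ hε hz hzx.symm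
    have k2 := quasiDist_rpow_mul_bdist_rpow_le (s := s) hΩ hn hγ hε hz hzy.symm
    rw [quasiDist_comm y z] at k2
    simp only [hρ]
    rw [← ENNReal.ofReal_add (by positivity) (by positivity),
      ← ENNReal.ofReal_mul (potKernel_nonneg _ _),
      ← ENNReal.ofReal_mul (mul_nonneg (by linarith) (potKernel_nonneg _ _))]
    refine ENNReal.ofReal_le_ofReal ?_
    have hzz : bdist Ω z ^ (2 * γ) = bdist Ω z ^ γ * bdist Ω z ^ γ := by
      rw [← Real.rpow_add hzp]; congr 1; ring
    have hd := Real.rpow_nonneg (quasiDist_nonneg (Ω := Ω) (s := s) (γ := γ) x y) (-(τ - ε))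
    have hQ0 : 0 ≤ Q := by linarith
    calc potKernel Ω s γ 1 x z * potKernel Ω s γ τ z y
        = bdist Ω x ^ γ * bdist Ω y ^ γ * bdist Ω z ^ (2 * γ) *
          (quasiDist Ω s γ x z ^ (-1 : ℝ) * quasiDist Ω s γ z y ^ (-τ)) := by
          rw [potKernel, potKernel, hzz]; ring
      _ ≤ bdist Ω x ^ γ * bdist Ω y ^ γ * bdist Ω z ^ (2 * γ) *
          (Q * quasiDist Ω s γ x y ^ (-(τ - ε)) * (quasiDist Ω s γ x z ^ (-(1 + ε)) +
            quasiDist Ω s γ z y ^ (-(1 + ε)))) :=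
          mul_le_mul_of_nonneg_left key (by positivity)
      _ = Q * potKernel Ω s γ (τ - ε) x y * (quasiDist Ω s γ x z ^ (-(1 + ε)) * bdist Ω z ^ (2 * γ)
            + quasiDist Ω s γ z y ^ (-(1 + ε)) * bdist Ω z ^ (2 * γ)) := by
          rw [potKernel]; ring
      _ ≤ _ := mul_le_mul_of_nonneg_left (add_le_add k1 k2)
          (mul_nonneg hQ0 (potKernel_nonneg _ _))
  have hin : ∀ y ∈ Ω, x ≠ y → ∫⁻ z in Ω, ENNReal.ofReal (potKernel Ω s γ 1 x z) *
      ENNReal.ofReal (potKernel Ω s γ τ z y) ≤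
        ENNReal.ofReal (Q * (2 * C)) * ENNReal.ofReal (potKernel Ω s γ (τ - ε) x y) := by
    intro y hy hxy
    calc _ ≤ ∫⁻ z in Ω, ENNReal.ofReal (Q * potKernel Ω s γ (τ - ε) x y) * (ρ x z + ρ y z) := by
          refine lintegral_mono_ae ?_
          filter_upwards [hne x, hne y, hmem] with z h1 h2 h3
          exact hpt y hy hxy z h3 h1 h2
      _ = ENNReal.ofReal (Q * potKernel Ω s γ (τ - ε) x y) *
          ((∫⁻ z in Ω, ρ x z) + ∫⁻ z in Ω, ρ y z) := by
          rw [lintegral_const_mul' _ _ ENNReal.ofReal_ne_top, lintegral_add_left (hρm x)]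
      _ ≤ ENNReal.ofReal (Q * potKernel Ω s γ (τ - ε) x y) *
          (ENNReal.ofReal C + ENNReal.ofReal C) := by
          gcongr
          exacts [hR x hx, hR y hy]
      _ = _ := by
          rw [← ENNReal.ofReal_add hC.le hC.le, ← ENNReal.ofReal_mul
            (mul_nonneg (by linarith) (potKernel_nonneg _ _)), ← ENNReal.ofReal_mul (by positivity)]
          congr 1; ring
  calc pot Ω s γ 1 (pot Ω s γ τ g) x
      = ∫⁻ z in Ω, ∫⁻ y in Ω, ENNReal.ofReal (potKernel Ω s γ 1 x z) *
          (ENNReal.ofReal (potKernel Ω s γ τ z y) * g y) := by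
        rw [pot]; congr 1; ext z
        rw [pot, lintegral_const_mul' _ _ ENNReal.ofReal_ne_top]
    _ = ∫⁻ y in Ω, ∫⁻ z in Ω, ENNReal.ofReal (potKernel Ω s γ 1 x z) *
          (ENNReal.ofReal (potKernel Ω s γ τ z y) * g y) :=
        lintegral_lintegral_swap (((hkm 1 x).comp measurable_fst).aemeasurable.mul
          (aemeasurable_uncurry_potKernel_mul hg _))
    _ = ∫⁻ y in Ω, (∫⁻ z in Ω, ENNReal.ofReal (potKernel Ω s γ 1 x z) *
          ENNReal.ofReal (potKernel Ω s γ τ z y)) * g y := by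
        congr 1; ext y
        have hm : Measurable fun z => ENNReal.ofReal (potKernel Ω s γ 1 x z) *
            ENNReal.ofReal (potKernel Ω s γ τ z y) :=
          (hkm 1 x).mul (measurable_potKernel.comp measurable_prodMk_right).ennreal_ofReal
        rw [← lintegral_mul_const _ hm]
        congr 1; ext z; ring
    _ ≤ ∫⁻ y in Ω, ENNReal.ofReal (Q * (2 * C)) *
          (ENNReal.ofReal (potKernel Ω s γ (τ - ε) x y) * g y) := by
        refine lintegral_mono_ae ?_
        filter_upwards [hne x, hmem] with y h1 h2
        rw [← mul_assoc]
        gcongr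
        exact hin y h2 h1.symm
    _ = _ := by rw [lintegral_const_mul' _ _ ENNReal.ofReal_ne_top]; rfl

lemma exists_potKernel_le (hΩ : IsBoundedC11 Ω) (hn : 1 ≤ n) (hs : 2 * s < n) (hγ : 0 < γ) :
    ∃ C : ℝ, 1 ≤ C ∧ ∀ τ τ' : ℝ, 0 ≤ τ → τ ≤ τ' → τ' ≤ 1 → ∀ x ∈ Ω, ∀ y ∈ Ω, x ≠ y →
      potKernel Ω s γ τ x y ≤ C * potKernel Ω s γ τ' x y := by
  obtain ⟨D, hD1, hδ, hD⟩ := hΩ.exists_bound hn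
  have hD0 : 0 ≤ D := by linarith
  have hC : 1 ≤ D ^ ((n : ℝ) - 2 * s) * D ^ (2 * γ) :=
    one_le_mul_of_one_le_of_one_le (Real.one_le_rpow hD1 (by linarith))
      (Real.one_le_rpow hD1 (by linarith))
  refine ⟨_, hC, fun τ τ' hτ hττ hτ' x hx y hy hxy => ?_⟩
  have hd := quasiDist_pos (Ω := Ω) (s := s) (γ := γ) hxy
  have hle : quasiDist Ω s γ x y ≤ D ^ ((n : ℝ) - 2 * s) * D ^ (2 * γ) := by
    refine mul_le_mul (Real.rpow_le_rpow (norm_nonneg _) (hD x hx y hy) (by linarith))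
      (Real.rpow_le_rpow (maxDist_nonneg _ _)
        (max_le (hD x hx y hy) (max_le (hδ x hx) (hδ y hy))) (by linarith))
      (Real.rpow_nonneg (maxDist_nonneg _ _) _) (by positivity)
  have h1 : quasiDist Ω s γ x y ^ (-τ) ≤
      D ^ ((n : ℝ) - 2 * s) * D ^ (2 * γ) * quasiDist Ω s γ x y ^ (-τ') := by
    have e : quasiDist Ω s γ x y ^ (-τ) =
        quasiDist Ω s γ x y ^ (τ' - τ) * quasiDist Ω s γ x y ^ (-τ') := by
      rw [← Real.rpow_add hd]; congr 1; ring
    rw [e]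
    gcongr
    calc quasiDist Ω s γ x y ^ (τ' - τ)
        ≤ (D ^ ((n : ℝ) - 2 * s) * D ^ (2 * γ)) ^ (τ' - τ) :=
          Real.rpow_le_rpow hd.le hle (by linarith)
      _ ≤ (D ^ ((n : ℝ) - 2 * s) * D ^ (2 * γ)) ^ (1 : ℝ) :=
          Real.rpow_le_rpow_of_exponent_le hC (by linarith)
      _ = _ := Real.rpow_one _
  have h0 : 0 ≤ bdist Ω x ^ γ * bdist Ω y ^ γ :=
    mul_nonneg (Real.rpow_nonneg (bdist_nonneg _) _) (Real.rpow_nonneg (bdist_nonneg _) _)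
  calc potKernel Ω s γ τ x y ≤ bdist Ω x ^ γ * bdist Ω y ^ γ *
        (D ^ ((n : ℝ) - 2 * s) * D ^ (2 * γ) * quasiDist Ω s γ x y ^ (-τ')) :=
        mul_le_mul_of_nonneg_left h1 h0
    _ = _ := by rw [potKernel]; ring

/-- On the bounded set Ω the quasi-metric is bounded, so a weaker singularity is dominated by a
stronger one. -/
lemma exists_pot_le_pot (hΩ : IsBoundedC11 Ω) (hn : 1 ≤ n) (hs : 2 * s < n) (hγ : 0 < γ) :
    ∃ C : ℝ, 1 ≤ C ∧ ∀ τ τ' : ℝ, 0 ≤ τ → τ ≤ τ' → τ' ≤ 1 →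
      ∀ g : EuclideanSpace ℝ (Fin n) → ENNReal, ∀ x ∈ Ω,
        pot Ω s γ τ g x ≤ ENNReal.ofReal C * pot Ω s γ τ' g x := by
  have : Nontrivial (EuclideanSpace ℝ (Fin n)) :=
    Module.nontrivial_of_finrank_pos (R := ℝ) (by simpa using Nat.lt_of_lt_of_le Nat.zero_lt_one hn)
  obtain ⟨C, hC, hk⟩ := exists_potKernel_le hΩ hn hs hγ
  refine ⟨C, hC, fun τ τ' h0 h1 h2 g x hx => ?_⟩
  rw [pot, pot, ← lintegral_const_mul' _ _ ENNReal.ofReal_ne_top]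
  refine lintegral_mono_ae ?_
  filter_upwards [ae_restrict_of_ae (Measure.ae_ne volume x),
    ae_restrict_mem hΩ.isOpen.measurableSet] with y hy hyΩ
  rw [← mul_assoc, ← ENNReal.ofReal_mul (by linarith)]
  gcongr
  exact hk τ τ' h0 h1 h2 x hx y hyΩ hy.symm

/-- At τ = 0 the kernel splits as a product: this rank-one form is the end point of the iteration.
-/
lemma pot_zero (g : EuclideanSpace ℝ (Fin n) → ENNReal) (x : EuclideanSpace ℝ (Fin n)) :
    pot Ω s γ 0 g x = ENNReal.ofReal (bdist Ω x ^ γ) *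
      ∫⁻ y in Ω, ENNReal.ofReal (bdist Ω y ^ γ) * g y := by
  rw [pot, ← lintegral_const_mul' _ _ ENNReal.ofReal_ne_top]
  congr 1; ext y
  rw [potKernel, neg_zero, Real.rpow_zero, mul_one,
    ENNReal.ofReal_mul (Real.rpow_nonneg (bdist_nonneg _) _), mul_assoc]

end Potential

/-! ### Integrability of powers of the distance to the boundary -/

section Boundary

variable {n : ℕ} {Ω : Set (EuclideanSpace ℝ (Fin n))}

/-- Fubini along ν without coordinates. The integral is averaged over the translations by t ν, 0 < t
< 1. For fixed x the value F x + t moves at unit speed through (0, R), where τ^β is integrable, and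
only x in a bounded ball contribute. -/
lemma lintegral_lt_top_of_translate {A : Set (EuclideanSpace ℝ (Fin n))} (hA : MeasurableSet A)
    (hAb : Bornology.IsBounded A) {F : EuclideanSpace ℝ (Fin n) → ℝ} (hF : Measurable F)
    {ν : EuclideanSpace ℝ (Fin n)} (hFν : ∀ x (t : ℝ), F (x + t • ν) = F x + t)
    {R β : ℝ} (hβ : -1 < β) (hFA : ∀ x ∈ A, F x ∈ Ioo 0 R) :
    ∫⁻ x in A, ENNReal.ofReal (F x ^ β) < ⊤ := by
  rcases A.eq_empty_or_nonempty with rfl | ⟨a, ha⟩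
  · simp
  have hR : 0 < R := (hFA a ha).1.trans (hFA a ha).2
  set g : EuclideanSpace ℝ (Fin n) → ENNReal := A.indicator fun x => ENNReal.ofReal (F x ^ β)
    with hg
  have hgm : Measurable g := (hF.pow_const _).ennreal_ofReal.indicator hA
  obtain ⟨ρ, hρ⟩ := hAb.subset_ball 0
  set B := Metric.ball (0 : EuclideanSpace ℝ (Fin n)) (ρ + ‖ν‖) with hB
  set k : ℝ → ENNReal := (Ioo 0 R).indicator fun τ => ENNReal.ofReal (τ ^ (β + 1 - 1)) with hk
  have hjm : Measurable (Function.uncurry fun (t : ℝ) (x : EuclideanSpace ℝ (Fin n)) =>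
      g (x + t • ν)) := hgm.comp (by fun_prop)
  have hpt : ∀ x, ∀ t ∈ Ioo (0 : ℝ) 1, g (x + t • ν) ≤ B.indicator 1 x * k (F x + t) := by
    intro x t ht
    by_cases hx : x + t • ν ∈ A
    · have h1 : x ∈ B := by
        rw [hB, mem_ball_zero_iff]
        have h2 := mem_ball_zero_iff.1 (hρ hx)
        have h3 : ‖x‖ ≤ ‖x + t • ν‖ + ‖t • ν‖ := by
          simpa using norm_sub_le (x + t • ν) (t • ν)
        have h4 : ‖t • ν‖ ≤ ‖ν‖ := by
          rw [norm_smul, Real.norm_of_nonneg ht.1.le]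
          exact mul_le_of_le_one_left (norm_nonneg _) ht.2.le
        linarith
      have h5 := hFA _ hx
      rw [hFν] at h5
      rw [hg, indicator_of_mem hx, indicator_of_mem h1, hk, indicator_of_mem h5, hFν]
      simp
    · rw [hg, indicator_of_notMem hx]; exact zero_le
  have hmain : ∫⁻ x, g x ≤ ∫⁻ x, B.indicator 1 x * ENNReal.ofReal (R ^ (β + 1) / (β + 1)) := by
    calc ∫⁻ x, g x = ∫⁻ t in Ioo (0 : ℝ) 1, ∫⁻ x, g (x + t • ν) := by
          have : ∀ t : ℝ, ∫⁻ x, g (x + t • ν) = ∫⁻ x, g x :=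
            fun t => lintegral_add_right_eq_self g (t • ν)
          simp [this]
      _ = ∫⁻ x, ∫⁻ t in Ioo (0 : ℝ) 1, g (x + t • ν) := lintegral_lintegral_swap hjm.aemeasurable
      _ ≤ ∫⁻ x, B.indicator 1 x * ENNReal.ofReal (R ^ (β + 1) / (β + 1)) := by
          refine lintegral_mono fun x => ?_
          calc ∫⁻ t in Ioo (0 : ℝ) 1, g (x + t • ν)
              ≤ ∫⁻ t in Ioo (0 : ℝ) 1, B.indicator 1 x * k (F x + t) :=
                setLIntegral_mono' measurableSet_Ioo (hpt x)
            _ ≤ ∫⁻ t, B.indicator 1 x * k (F x + t) := setLIntegral_le_lintegral _ _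
            _ = B.indicator 1 x * ∫⁻ t, k (F x + t) := by
                rw [lintegral_const_mul']
                by_cases hx : x ∈ B <;> simp [hx]
            _ = _ := by
                rw [lintegral_add_left_eq_self k (F x), hk, lintegral_indicator measurableSet_Ioo,
                  lintegral_Ioo_rpow_sub_one (by linarith) hR.le]
  rw [← lintegral_indicator hA]
  refine hmain.trans_lt ?_
  rw [lintegral_mul_const' _ _ ENNReal.ofReal_ne_top, lintegral_indicator_one measurableSet_ball]
  exact ENNReal.mul_lt_top Metric.isBounded_ball.measure_lt_top ENNReal.ofReal_lt_top

/-- The height F above the boundary graph is Lipschitz near z and nonpositive at boundary points, so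
F ≤ C δ inside Ω. As β ≤ 0, δ^β is dominated by F^β, to which the translation argument applies. -/
lemma IsBoundedC11.exists_lintegral_bdist_rpow_lt_top (hΩ : IsBoundedC11 Ω) {β : ℝ}
    (hβ : -1 < β) (hβ0 : β ≤ 0) {z : EuclideanSpace ℝ (Fin n)} (hz : z ∈ frontier Ω) :
    ∃ ρ > 0, ∫⁻ x in Metric.ball z ρ ∩ Ω, ENNReal.ofReal (bdist Ω x ^ β) < ⊤ := by
  obtain ⟨r, hr, ν, hν, h, hh, ⟨L, hL⟩, hchart⟩ := hΩ.chart z hz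
  refine ⟨r / 2, by positivity, ?_⟩
  set π : EuclideanSpace ℝ (Fin n) → EuclideanSpace ℝ (Fin n) :=
    fun v => v - (inner ℝ v ν : ℝ) • ν with hπ
  set F : EuclideanSpace ℝ (Fin n) → ℝ :=
    fun x => (inner ℝ (x - z) ν : ℝ) - h (π (x - z)) with hF
  have hinn : ∀ v, |(inner ℝ v ν : ℝ)| ≤ ‖v‖ := fun v => by
    simpa [hν] using abs_real_inner_le_norm v ν
  have hπn : ∀ v, ‖π v‖ ≤ 2 * ‖v‖ := by
    intro v
    have h1 : ‖(inner ℝ v ν : ℝ) • ν‖ ≤ ‖v‖ := by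
      rw [norm_smul, hν, mul_one]; exact hinn v
    have := norm_sub_le v ((inner ℝ v ν : ℝ) • ν)
    simp only [hπ]; linarith
  have hπs : ∀ v w, π v - π w = π (v - w) := by
    intro v w
    simp only [hπ, inner_sub_left, sub_smul]; abel
  have hπc : Continuous π := by fun_prop
  have hhc : Continuous h := hh.continuous
  have hFc : Continuous F := by
    have : Continuous fun x => π (x - z) := hπc.comp (by fun_prop)
    exact (by fun_prop : Continuous fun x => (inner ℝ (x - z) ν : ℝ)).sub (hhc.comp this)
  have hνν : (inner ℝ ν ν : ℝ) = 1 := by rw [real_inner_self_eq_norm_sq, hν]; norm_num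
  have hFν : ∀ x (t : ℝ), F (x + t • ν) = F x + t := by
    intro x t
    have e1 : x + t • ν - z = (x - z) + t • ν := by abel
    have e2 : (inner ℝ (x + t • ν - z) ν : ℝ) = inner ℝ (x - z) ν + t := by
      rw [e1, inner_add_left, inner_smul_left, hνν]; simp
    have e3 : π (x + t • ν - z) = π (x - z) := by
      simp only [hπ]
      rw [e2, e1, add_smul]; abel
    simp only [hF]
    rw [e2, e3]; ring
  -- `K` bounds the derivative of `h` on the ball of radius 2r, which contains all projections π (x
  -- - z) with |x - z| < r because ‖π v‖ ≤ 2 ‖v‖.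
  set K : ℝ := ‖fderiv ℝ h 0‖ + L * (2 * r) with hK
  have hK0 : 0 ≤ K := by positivity
  have hlip : ∀ v ∈ Metric.ball (0 : EuclideanSpace ℝ (Fin n)) (2 * r),
      ∀ w ∈ Metric.ball (0 : EuclideanSpace ℝ (Fin n)) (2 * r), ‖h v - h w‖ ≤ K * ‖v - w‖ := by
    intro v hv w hw
    refine (convex_ball 0 (2 * r)).norm_image_sub_le_of_norm_fderiv_le
      (fun x _ => hh.differentiable (by norm_num) x) (fun x hx => ?_) hw hv
    have h1 := hL.dist_le_mul x 0
    rw [dist_eq_norm, dist_zero_right] at h1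
    have h2 : ‖fderiv ℝ h x‖ ≤ ‖fderiv ℝ h 0‖ + ‖fderiv ℝ h x - fderiv ℝ h 0‖ := by
      simpa using norm_add_le (fderiv ℝ h 0) (fderiv ℝ h x - fderiv ℝ h 0)
    have h3 : ‖x‖ ≤ 2 * r := (mem_ball_zero_iff.1 hx).le
    have h4 : L * ‖x‖ ≤ L * (2 * r) := by gcongr
    linarith
  have hπball : ∀ x ∈ Metric.ball z r, π (x - z) ∈ Metric.ball 0 (2 * r) := by
    intro x hx
    rw [mem_ball_zero_iff]
    rw [mem_ball_iff_norm] at hx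
    linarith [hπn (x - z)]
  have hFlip : ∀ x ∈ Metric.ball z r, ∀ y ∈ Metric.ball z r,
      F x - F y ≤ (1 + 2 * K) * ‖x - y‖ := by
    intro x hx y hy
    have h1 := hlip _ (hπball y hy) _ (hπball x hx)
    rw [hπs] at h1
    have e : y - z - (x - z) = y - x := by abel
    rw [e] at h1
    have h2 := hπn (y - x)
    rw [norm_sub_rev y x] at h2
    have h3 := (le_abs_self _).trans (hinn (x - y))
    have e2 : (inner ℝ (x - z) ν : ℝ) - inner ℝ (y - z) ν = inner ℝ (x - y) ν := by
      rw [← inner_sub_left]; congr 1; abel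
    have h4 := le_of_abs_le h1
    have h5 : K * ‖π (y - x)‖ ≤ K * (2 * ‖x - y‖) := by gcongr
    simp only [hF]
    linarith
  have hkey : ∀ x ∈ Metric.ball z (r / 2) ∩ Ω, 0 < F x ∧ F x ≤ (1 + 2 * K) * bdist Ω x := by
    rintro x ⟨hx, hxΩ⟩
    have hxr : x ∈ Metric.ball z r := Metric.ball_subset_ball (by linarith) hx
    refine ⟨sub_pos.2 ((hchart x hxr).1 hxΩ), ?_⟩
    -- The nearest boundary point is at distance at most |x - z| < r/2 from x, hence still inside
    -- the chart ball of radius r; this is why x is confined to half the radius.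
    obtain ⟨y, hy, hxy⟩ := isClosed_frontier.exists_infDist_eq_dist ⟨z, hz⟩ x
    have h1 : dist x y ≤ dist x z := hxy ▸ Metric.infDist_le_dist_of_mem hz
    have hyr : y ∈ Metric.ball z r := by
      have := dist_triangle_left y z x
      rw [Metric.mem_ball] at hx ⊢
      linarith
    have hyΩ : y ∉ Ω := by
      rw [hΩ.isOpen.frontier_eq] at hy; exact hy.2
    have hFy : F y ≤ 0 := by
      by_contra hcon
      exact hyΩ ((hchart y hyr).2 (sub_pos.1 (not_le.1 hcon)))
    have h2 := hFlip x hxr y hyr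
    rw [bdist, hxy, dist_eq_norm]
    linarith
  have hA : MeasurableSet (Metric.ball z (r / 2) ∩ Ω) :=
    measurableSet_ball.inter hΩ.isOpen.measurableSet
  have hfin := lintegral_lt_top_of_translate hA (hΩ.bounded.subset inter_subset_right)
    hFc.measurable hFν (R := (1 + 2 * K) * r) hβ (fun x hx => ⟨(hkey x hx).1, by
      refine (hkey x hx).2.trans_lt ?_
      have h1 : bdist Ω x ≤ dist x z := Metric.infDist_le_dist_of_mem hz
      have h2 := Metric.mem_ball.1 hx.1
      gcongr
      linarith⟩)
  refine lt_of_le_of_lt ?_ (ENNReal.mul_lt_top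
    (ENNReal.ofReal_lt_top (r := (1 + 2 * K) ^ (-β))) hfin)
  rw [← lintegral_const_mul' _ _ ENNReal.ofReal_ne_top]
  refine setLIntegral_mono' hA fun x hx => ?_
  obtain ⟨h1, h2⟩ := hkey x hx
  rw [← ENNReal.ofReal_mul (by positivity)]
  refine ENNReal.ofReal_le_ofReal ?_
  have h3 : ((1 + 2 * K) * bdist Ω x) ^ β ≤ F x ^ β := Real.rpow_le_rpow_of_nonpos h1 h2 hβ0
  rw [Real.mul_rpow (by positivity) (bdist_nonneg _)] at h3
  calc bdist Ω x ^ β = (1 + 2 * K) ^ (-β) * ((1 + 2 * K) ^ β * bdist Ω x ^ β) := by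
        rw [← mul_assoc, ← Real.rpow_add (by positivity)]; simp
    _ ≤ _ := by gcongr

/-- For negative β, compactness of the closure reduces to small neighbourhoods: interior points,
near which δ is bounded below, and boundary points, covered by the chart estimate. -/
lemma IsBoundedC11.lintegral_bdist_rpow_lt_top (hΩ : IsBoundedC11 Ω) (hn : 1 ≤ n) {β : ℝ}
    (hβ : -1 < β) : ∫⁻ x in Ω, ENNReal.ofReal (bdist Ω x ^ β) < ⊤ := by
  rcases le_total 0 β with h0 | h0
  · obtain ⟨D, hD1, hD, -⟩ := hΩ.exists_bound hn
    calc ∫⁻ x in Ω, ENNReal.ofReal (bdist Ω x ^ β) ≤ ∫⁻ x in Ω, ENNReal.ofReal (D ^ β) := by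
          refine setLIntegral_mono' hΩ.isOpen.measurableSet fun x hx => ENNReal.ofReal_le_ofReal ?_
          exact Real.rpow_le_rpow (bdist_nonneg _) (hD x hx) h0
      _ = ENNReal.ofReal (D ^ β) * volume Ω := setLIntegral_const _ _
      _ < ⊤ := ENNReal.mul_lt_top ENNReal.ofReal_lt_top hΩ.volume_lt_top
  have hcomp : IsCompact (closure Ω) := hΩ.bounded.isCompact_closure
  have key : ∫⁻ x in closure Ω ∩ Ω, ENNReal.ofReal (bdist Ω x ^ β) < ⊤ := by
    refine hcomp.induction_on (p := fun S => ∫⁻ x in S ∩ Ω, ENNReal.ofReal (bdist Ω x ^ β) < ⊤)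
      (by simp) ?_ ?_ ?_
    · intro S T hST hT
      exact (lintegral_mono_set (inter_subset_inter_left _ hST)).trans_lt hT
    · intro S T hS hT
      rw [union_inter_distrib_right]
      exact (lintegral_union_le _ _ _).trans_lt (ENNReal.add_lt_top.2 ⟨hS, hT⟩)
    · intro x hx
      by_cases hxΩ : x ∈ Ω
      · have hp := hΩ.bdist_pos hn hxΩ
        refine ⟨Metric.ball x (bdist Ω x / 2),
          mem_nhdsWithin_of_mem_nhds (Metric.ball_mem_nhds _ (by positivity)), ?_⟩
        calc _ ≤ ∫⁻ y in Metric.ball x (bdist Ω x / 2) ∩ Ω,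
              ENNReal.ofReal ((bdist Ω x / 2) ^ β) := by
              refine setLIntegral_mono' (measurableSet_ball.inter hΩ.isOpen.measurableSet)
                fun y hy => ENNReal.ofReal_le_ofReal ?_
              refine Real.rpow_le_rpow_of_nonpos (by positivity) ?_ h0
              have h1 := bdist_le_add (Ω := Ω) x y
              have h2 := Metric.mem_ball'.1 hy.1
              rw [dist_eq_norm] at h2
              linarith
          _ = ENNReal.ofReal ((bdist Ω x / 2) ^ β) *
              volume (Metric.ball x (bdist Ω x / 2) ∩ Ω) := setLIntegral_const _ _
          _ < ⊤ := ENNReal.mul_lt_top ENNReal.ofReal_lt_top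
              ((measure_mono inter_subset_right).trans_lt hΩ.volume_lt_top)
      · have hxf : x ∈ frontier Ω := by
          rw [hΩ.isOpen.frontier_eq]; exact ⟨hx, hxΩ⟩
        obtain ⟨ρ, hρ, hfin⟩ := hΩ.exists_lintegral_bdist_rpow_lt_top hβ h0 hxf
        exact ⟨_, mem_nhdsWithin_of_mem_nhds (Metric.ball_mem_nhds _ hρ), hfin⟩
  rwa [inter_eq_self_of_subset_right subset_closure] at key

end Boundary

/-! ### The Green operator on L²(Ω) -/

section GreenOperator

variable {n : ℕ} {Ω : Set (EuclideanSpace ℝ (Fin n))} {s γ : ℝ}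
  {G : EuclideanSpace ℝ (Fin n) → EuclideanSpace ℝ (Fin n) → ℝ}

lemma ae_mem_and_ne (hΩ : IsBoundedC11 Ω) (hn : 1 ≤ n) (x : EuclideanSpace ℝ (Fin n)) :
    ∀ᵐ y ∂(volume.restrict Ω), y ∈ Ω ∧ x ≠ y := by
  have : Nontrivial (EuclideanSpace ℝ (Fin n)) :=
    Module.nontrivial_of_finrank_pos (R := ℝ) (by simpa using Nat.lt_of_lt_of_le Nat.zero_lt_one hn)
  filter_upwards [ae_restrict_of_ae (Measure.ae_ne volume x),
    ae_restrict_mem hΩ.isOpen.measurableSet] with y hy hyΩ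
  exact ⟨hyΩ, hy.symm⟩

lemma modelKernel_nonneg (x y : EuclideanSpace ℝ (Fin n)) : 0 ≤ modelKernel Ω s γ x y := by
  have h : ∀ a : ℝ, 0 ≤ a → 0 ≤ min (a ^ γ / ‖x - y‖ ^ γ) 1 :=
    fun a ha => le_min (by positivity) zero_le_one
  exact mul_nonneg (mul_nonneg (by positivity) (h _ (bdist_nonneg _))) (h _ (bdist_nonneg _))

lemma modelKernel_le_norm_rpow (x y : EuclideanSpace ℝ (Fin n)) :
    modelKernel Ω s γ x y ≤ ‖x - y‖ ^ (-((n : ℝ) - 2 * s)) := by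
  have h : ∀ a : ℝ, 0 ≤ a → 0 ≤ min (a ^ γ / ‖x - y‖ ^ γ) 1 :=
    fun a ha => le_min (by positivity) zero_le_one
  have h0 : (0 : ℝ) ≤ 1 / ‖x - y‖ ^ ((n : ℝ) - 2 * s) := by positivity
  rw [Real.rpow_neg (norm_nonneg _), ← one_div]
  exact (mul_le_of_le_one_right (mul_nonneg h0 (h _ (bdist_nonneg _))) (min_le_right _ _)).trans
    (mul_le_of_le_one_right h0 (min_le_right _ _))

namespace IsGreenFunction

lemma exists_bounds (hG : IsGreenFunction Ω s γ G) (hΩ : IsBoundedC11 Ω) (hn : 1 ≤ n)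
    (hγ : γ ∈ Ioc (0 : ℝ) 1) :
    ∃ c : ℝ, 0 < c ∧ ∀ x ∈ Ω, ∀ y ∈ Ω, x ≠ y → 0 ≤ G x y ∧ potKernel Ω s γ 1 x y ≤ c * G x y ∧
      G x y ≤ c * potKernel Ω s γ 1 x y ∧ G x y ≤ c * ‖x - y‖ ^ (-((n : ℝ) - 2 * s)) ∧
      modelKernel Ω s γ x y ≤ c * G x y := by
  obtain ⟨c, hc, h⟩ := hG.comparable
  refine ⟨4 * c, by positivity, fun x hx y hy hxy => ?_⟩
  obtain ⟨h1, h2⟩ := h x hx y hy hxy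
  have h3 := potKernel_le_modelKernel (s := s) hΩ hn hγ hx hy hxy
  have h4 := modelKernel_le_potKernel (s := s) hΩ hn hγ hx hy hxy
  have h5 := modelKernel_nonneg (Ω := Ω) (s := s) (γ := γ) x y
  have h6 := modelKernel_le_norm_rpow (Ω := Ω) (s := s) (γ := γ) x y
  have h7 : modelKernel Ω s γ x y ≤ c * G x y := by rwa [inv_mul_le_iff₀ hc] at h1
  have h8 : 0 ≤ G x y := le_trans (by positivity) h1
  have h9 : c * modelKernel Ω s γ x y ≤ c * (4 * potKernel Ω s γ 1 x y) := by gcongr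
  have h10 : c * modelKernel Ω s γ x y ≤ c * ‖x - y‖ ^ (-((n : ℝ) - 2 * s)) := by gcongr
  have h11 : 0 ≤ c * ‖x - y‖ ^ (-((n : ℝ) - 2 * s)) := by positivity
  have h12 : 0 ≤ c * G x y := by positivity
  exact ⟨h8, by linarith, by linarith, by linarith, by linarith⟩

lemma enorm_greenOp_le (hΩ : IsBoundedC11 Ω) (hn : 1 ≤ n)
    {k : EuclideanSpace ℝ (Fin n) → EuclideanSpace ℝ (Fin n) → ℝ} {c : ℝ} (hc : 0 ≤ c)
    (h : ∀ x ∈ Ω, ∀ y ∈ Ω, x ≠ y → 0 ≤ G x y ∧ G x y ≤ c * k x y)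
    (f : EuclideanSpace ℝ (Fin n) → ℝ) {x : EuclideanSpace ℝ (Fin n)} (hx : x ∈ Ω) :
    ‖greenOp Ω G f x‖ₑ ≤ ENNReal.ofReal c * ∫⁻ y in Ω, ENNReal.ofReal (k x y) * ‖f y‖ₑ := by
  rw [greenOp, ← lintegral_const_mul' _ _ ENNReal.ofReal_ne_top]
  refine (enorm_integral_le_lintegral_enorm _).trans (lintegral_mono_ae ?_)
  filter_upwards [ae_mem_and_ne hΩ hn x] with y hy
  obtain ⟨h1, h2⟩ := h x hx y hy.1 hy.2
  rw [enorm_mul, ← mul_assoc, ← ENNReal.ofReal_mul hc, Real.enorm_of_nonneg h1]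
  gcongr

end IsGreenFunction

lemma lintegral_mul_rpow_two_le {α : Type*} [MeasurableSpace α] {μ : Measure α}
    {κ g : α → ENNReal} (hκ : AEMeasurable κ μ) (hg : AEMeasurable g μ) :
    (∫⁻ y, κ y * g y ∂μ) ^ (2 : ℝ) ≤ (∫⁻ y, κ y ∂μ) * ∫⁻ y, κ y * g y ^ (2 : ℝ) ∂μ := by
  have hm : AEMeasurable (fun y => κ y ^ (1 / 2 : ℝ)) μ := hκ.pow_const _
  have hH := ENNReal.lintegral_mul_le_Lp_mul_Lq μ Real.HolderConjugate.two_two hm (hm.mul hg)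
  have e1 : ∀ y, ((fun y => κ y ^ (1 / 2 : ℝ)) * ((fun y => κ y ^ (1 / 2 : ℝ)) * g)) y =
      κ y * g y := fun y => by
    simp only [Pi.mul_apply]
    rw [← mul_assoc, ← ENNReal.rpow_add_of_nonneg _ _ (by norm_num) (by norm_num)]
    norm_num
  have e2 : ∀ y, (κ y ^ (1 / 2 : ℝ)) ^ (2 : ℝ) = κ y := fun y => by
    rw [← ENNReal.rpow_mul]; norm_num
  have e3 : ∀ y, ((fun y => κ y ^ (1 / 2 : ℝ)) * g) y ^ (2 : ℝ) = κ y * g y ^ (2 : ℝ) :=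
    fun y => by
      simp only [Pi.mul_apply]
      rw [ENNReal.mul_rpow_of_nonneg _ _ (by norm_num), e2]
  simp only [e1, e2, e3] at hH
  refine (ENNReal.rpow_le_rpow hH (by norm_num)).trans (le_of_eq ?_)
  rw [ENNReal.mul_rpow_of_nonneg _ _ (by norm_num), ← ENNReal.rpow_mul, ← ENNReal.rpow_mul]
  norm_num

/-- Schur's test: Cauchy–Schwarz with the kernel split into two square roots, then Tonelli. Row and
column integrals have the same bound C, whence C · C. -/
lemma exists_lintegral_rieszPotential_sq_le (hΩ : IsBoundedC11 Ω) (hn : 1 ≤ n) {b : ℝ}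
    (hb : b < n) :
    ∃ C : ℝ, 0 < C ∧ ∀ g : EuclideanSpace ℝ (Fin n) → ENNReal,
      AEMeasurable g (volume.restrict Ω) →
      ∫⁻ x in Ω, (∫⁻ y in Ω, ENNReal.ofReal (‖x - y‖ ^ (-b)) * g y) ^ (2 : ℝ) ≤
        ENNReal.ofReal C * ∫⁻ y in Ω, g y ^ (2 : ℝ) := by
  obtain ⟨C, hC, hR⟩ := exists_lintegral_norm_sub_rpow_le hΩ hn hb
  refine ⟨C * C, by positivity, fun g hg => ?_⟩
  have hκm : Measurable fun z : EuclideanSpace ℝ (Fin n) × EuclideanSpace ℝ (Fin n) =>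
      ENNReal.ofReal (‖z.1 - z.2‖ ^ (-b)) := by fun_prop
  have hsq : ∀ x ∈ Ω, (∫⁻ y in Ω, ENNReal.ofReal (‖x - y‖ ^ (-b)) * g y) ^ (2 : ℝ) ≤
      ENNReal.ofReal C * ∫⁻ y in Ω, ENNReal.ofReal (‖x - y‖ ^ (-b)) * g y ^ (2 : ℝ) := by
    intro x hx
    refine (lintegral_mul_rpow_two_le
      (hκm.comp measurable_prodMk_left).aemeasurable hg).trans ?_
    exact mul_le_mul_left (hR x hx) _
  have hm2 : AEMeasurable (Function.uncurry fun x y : EuclideanSpace ℝ (Fin n) =>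
      ENNReal.ofReal (‖x - y‖ ^ (-b)) * g y ^ (2 : ℝ))
      ((volume.restrict Ω).prod (volume.restrict Ω)) :=
    hκm.aemeasurable.mul (hg.pow_const _).comp_snd
  calc ∫⁻ x in Ω, (∫⁻ y in Ω, ENNReal.ofReal (‖x - y‖ ^ (-b)) * g y) ^ (2 : ℝ)
      ≤ ∫⁻ x in Ω, ENNReal.ofReal C *
          ∫⁻ y in Ω, ENNReal.ofReal (‖x - y‖ ^ (-b)) * g y ^ (2 : ℝ) :=
        setLIntegral_mono' hΩ.isOpen.measurableSet hsq
    _ = ENNReal.ofReal C *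
          ∫⁻ y in Ω, ∫⁻ x in Ω, ENNReal.ofReal (‖x - y‖ ^ (-b)) * g y ^ (2 : ℝ) := by
        rw [lintegral_const_mul' _ _ ENNReal.ofReal_ne_top, lintegral_lintegral_swap hm2]
    _ ≤ ENNReal.ofReal C * ∫⁻ y in Ω, ENNReal.ofReal C * g y ^ (2 : ℝ) := by
        refine mul_le_mul_right (setLIntegral_mono' hΩ.isOpen.measurableSet fun y hy => ?_) _
        have hm3 : Measurable fun x : EuclideanSpace ℝ (Fin n) =>
          ENNReal.ofReal (‖x - y‖ ^ (-b)) := by fun_prop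
        rw [lintegral_mul_const _ hm3]
        have := hR y hy
        simp only [norm_sub_rev y] at this
        exact mul_le_mul_left this _
    _ = _ := by
        rw [lintegral_const_mul' _ _ ENNReal.ofReal_ne_top, ← mul_assoc,
          ENNReal.ofReal_mul hC.le]

namespace IsGreenFunction

lemma aestronglyMeasurable_mul (hG : IsGreenFunction Ω s γ G)
    {f : EuclideanSpace ℝ (Fin n) → ℝ} (hf : AEStronglyMeasurable f (volume.restrict Ω)) :
    AEStronglyMeasurable (Function.uncurry fun x y => G x y * f y)
      ((volume.restrict Ω).prod (volume.restrict Ω)) :=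
  hG.aemeasurable.aestronglyMeasurable.mul hf.comp_snd

lemma aestronglyMeasurable_greenOp (hG : IsGreenFunction Ω s γ G)
    {f : EuclideanSpace ℝ (Fin n) → ℝ} (hf : AEStronglyMeasurable f (volume.restrict Ω)) :
    AEStronglyMeasurable (greenOp Ω G f) (volume.restrict Ω) :=
  (hG.aestronglyMeasurable_mul hf).integral_prod_right'

lemma memLp_two_iff {f : EuclideanSpace ℝ (Fin n) → ℝ} :
    MemLp f 2 (volume.restrict Ω) ↔ AEStronglyMeasurable f (volume.restrict Ω) ∧
      ∫⁻ x in Ω, ‖f x‖ₑ ^ (2 : ℝ) < ⊤ := by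
  rw [MemLp, eLpNorm_lt_top_iff_lintegral_rpow_enorm_lt_top (by norm_num) (by norm_num)]
  simp

lemma lintegral_greenKernel_sq_lt_top (hΩ : IsBoundedC11 Ω) (hn : 1 ≤ n) (hs : 0 < s)
    {f : EuclideanSpace ℝ (Fin n) → ℝ} (hf : MemLp f 2 (volume.restrict Ω)) (c : ℝ) :
    ∫⁻ x in Ω, (ENNReal.ofReal c * ∫⁻ y in Ω,
      ENNReal.ofReal (‖x - y‖ ^ (-((n : ℝ) - 2 * s))) * ‖f y‖ₑ) ^ (2 : ℝ) < ⊤ := by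
  obtain ⟨C, -, hC⟩ := exists_lintegral_rieszPotential_sq_le hΩ hn
    (show (n : ℝ) - 2 * s < n by linarith)
  simp_rw [ENNReal.mul_rpow_of_nonneg _ _ (show (0 : ℝ) ≤ 2 by norm_num)]
  rw [lintegral_const_mul' _ _ (by simp)]
  refine ENNReal.mul_lt_top (by simp) ((hC _ hf.1.aemeasurable.enorm).trans_lt ?_)
  exact ENNReal.mul_lt_top ENNReal.ofReal_lt_top (memLp_two_iff.1 hf).2

lemma memLp_greenOp (hG : IsGreenFunction Ω s γ G) (hΩ : IsBoundedC11 Ω) (hn : 1 ≤ n) (hs : 0 < s)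
    (hγ : γ ∈ Ioc (0 : ℝ) 1) {f : EuclideanSpace ℝ (Fin n) → ℝ}
    (hf : MemLp f 2 (volume.restrict Ω)) : MemLp (greenOp Ω G f) 2 (volume.restrict Ω) := by
  obtain ⟨c, hc, hcG⟩ := hG.exists_bounds hΩ hn hγ
  rw [memLp_two_iff]
  refine ⟨hG.aestronglyMeasurable_greenOp hf.1,
    lt_of_le_of_lt ?_ (lintegral_greenKernel_sq_lt_top hΩ hn hs hf c)⟩
  refine setLIntegral_mono' hΩ.isOpen.measurableSet fun x hx => ?_
  gcongr
  exact enorm_greenOp_le hΩ hn hc.le (fun x hx y hy hxy =>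
    ⟨(hcG x hx y hy hxy).1, (hcG x hx y hy hxy).2.2.2.1⟩) f hx

/-- Absolute integrability that licenses Fubini in `integral_mul_greenOp`: Schur's test puts the
inner integral in L², and ab ≤ a² + b². -/
lemma integrable_mul_mul (hG : IsGreenFunction Ω s γ G) (hΩ : IsBoundedC11 Ω) (hn : 1 ≤ n)
    (hs : 0 < s) (hγ : γ ∈ Ioc (0 : ℝ) 1) {f g : EuclideanSpace ℝ (Fin n) → ℝ}
    (hf : MemLp f 2 (volume.restrict Ω)) (hg : MemLp g 2 (volume.restrict Ω)) :
    Integrable (Function.uncurry fun x y => g x * (G x y * f y))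
      ((volume.restrict Ω).prod (volume.restrict Ω)) := by
  obtain ⟨c, hc, hcG⟩ := hG.exists_bounds hΩ hn hγ
  have hm : AEStronglyMeasurable (Function.uncurry fun x y => g x * (G x y * f y))
      ((volume.restrict Ω).prod (volume.restrict Ω)) :=
    hg.1.comp_fst.mul (hG.aestronglyMeasurable_mul hf.1)
  refine ⟨hm, ?_⟩
  set κ : EuclideanSpace ℝ (Fin n) → ENNReal := fun x => ENNReal.ofReal c * ∫⁻ y in Ω,
    ENNReal.ofReal (‖x - y‖ ^ (-((n : ℝ) - 2 * s))) * ‖f y‖ₑ with hκ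
  have hκ2 : ∫⁻ x in Ω, κ x ^ (2 : ℝ) < ⊤ := lintegral_greenKernel_sq_lt_top hΩ hn hs hf c
  rw [hasFiniteIntegral_iff_enorm, lintegral_prod _ hm.enorm]
  have hgm : AEMeasurable (fun x => ‖g x‖ₑ ^ (2 : ℝ)) (volume.restrict Ω) :=
    hg.1.aemeasurable.enorm.pow_const _
  calc _ ≤ ∫⁻ x in Ω, (‖g x‖ₑ ^ (2 : ℝ) + κ x ^ (2 : ℝ)) := by
        refine setLIntegral_mono' hΩ.isOpen.measurableSet fun x hx => ?_
        calc ∫⁻ y in Ω, ‖g x * (G x y * f y)‖ₑ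
            ≤ ∫⁻ y in Ω, ‖g x‖ₑ * (ENNReal.ofReal c *
              (ENNReal.ofReal (‖x - y‖ ^ (-((n : ℝ) - 2 * s))) * ‖f y‖ₑ)) := by
              refine lintegral_mono_ae ?_
              filter_upwards [ae_mem_and_ne hΩ hn x] with y hy
              obtain ⟨h1, -, -, h2, -⟩ := hcG x hx y hy.1 hy.2
              rw [enorm_mul, enorm_mul, Real.enorm_of_nonneg h1, ← mul_assoc (ENNReal.ofReal c),
                ← ENNReal.ofReal_mul hc.le]
              gcongr
          _ = ‖g x‖ₑ * κ x := by
              rw [lintegral_const_mul' _ _ enorm_ne_top,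
                lintegral_const_mul' _ _ ENNReal.ofReal_ne_top]
          _ ≤ ‖g x‖ₑ ^ (2 : ℝ) + κ x ^ (2 : ℝ) := by
              rw [ENNReal.rpow_two, ENNReal.rpow_two]
              rcases le_total ‖g x‖ₑ (κ x) with h | h
              · calc ‖g x‖ₑ * κ x ≤ κ x * κ x := by gcongr
                  _ = κ x ^ 2 := by ring
                  _ ≤ _ := le_add_self
              · calc ‖g x‖ₑ * κ x ≤ ‖g x‖ₑ * ‖g x‖ₑ := by gcongr
                  _ = ‖g x‖ₑ ^ 2 := by ring
                  _ ≤ _ := le_self_add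
    _ = (∫⁻ x in Ω, ‖g x‖ₑ ^ (2 : ℝ)) + ∫⁻ x in Ω, κ x ^ (2 : ℝ) := lintegral_add_left' hgm _
    _ < ⊤ := ENNReal.add_lt_top.2 ⟨(memLp_two_iff.1 hg).2, hκ2⟩

lemma integral_mul_greenOp (hG : IsGreenFunction Ω s γ G) (hΩ : IsBoundedC11 Ω) (hn : 1 ≤ n)
    (hs : 0 < s) (hγ : γ ∈ Ioc (0 : ℝ) 1) {f g : EuclideanSpace ℝ (Fin n) → ℝ}
    (hf : MemLp f 2 (volume.restrict Ω)) (hg : MemLp g 2 (volume.restrict Ω)) :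
    ∫ x in Ω, g x * greenOp Ω G f x = ∫ x in Ω, greenOp Ω G g x * f x := by
  calc ∫ x in Ω, g x * greenOp Ω G f x = ∫ x in Ω, ∫ y in Ω, g x * (G x y * f y) := by
        congr 1; ext x; rw [greenOp, integral_const_mul]
    _ = ∫ y in Ω, ∫ x in Ω, g x * (G x y * f y) :=
        integral_integral_swap (hG.integrable_mul_mul hΩ hn hs hγ hf hg)
    _ = _ := by
        refine setIntegral_congr_fun hΩ.isOpen.measurableSet fun y hy => ?_
        simp only [greenOp]
        rw [← integral_mul_const]
        refine integral_congr_ae ?_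
        filter_upwards [ae_mem_and_ne hΩ hn y] with x hx
        rw [hG.symm y hy x hx.1 hx.2]; ring

end IsGreenFunction

end GreenOperator

/-! ### Operators diagonal in a Hilbert basis -/

section Multiplier

variable {H : Type*} [NormedAddCommGroup H] [InnerProductSpace ℝ H]

lemma HilbertBasis.eq_of_forall_inner_eq (b : HilbertBasis ℕ ℝ H) {v w : H}
    (h : ∀ j, (inner ℝ (b j) v : ℝ) = inner ℝ (b j) w) : v = w := by
  refine b.repr.injective (lp.ext (funext fun j => ?_))
  rw [b.repr_apply_apply, b.repr_apply_apply, h j]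

lemma HilbertBasis.inner_eq_ite (b : HilbertBasis ℕ ℝ H) (i j : ℕ) :
    (inner ℝ (b i) (b j) : ℝ) = if i = j then 1 else 0 :=
  orthonormal_iff_ite.1 b.orthonormal i j

/-- A bounded multiplier preserves ℓ², and the isometry `b.repr` carries this to H. Boundedness also
ensures that the series converges, so that the `tsum` is not the default value 0. -/
lemma HilbertBasis.tsum_multiplier (b : HilbertBasis ℕ ℝ H) {m : ℕ → ℝ} {B : ℝ}
    (hB : ∀ j, |m j| ≤ B) (ψ : H) :
    (∀ k, (inner ℝ (b k) (∑' j, (m j * (inner ℝ (b j) ψ : ℝ)) • b j) : ℝ) =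
      m k * inner ℝ (b k) ψ) ∧ ‖∑' j, (m j * (inner ℝ (b j) ψ : ℝ)) • b j‖ ≤ B * ‖ψ‖ := by
  have hB0 : 0 ≤ B := (abs_nonneg _).trans (hB 0)
  have hp : (0 : ℝ) < (2 : ENNReal).toReal := by norm_num
  have hle : ∀ j, ‖m j * b.repr ψ j‖ ^ (2 : ENNReal).toReal ≤
      B ^ (2 : ENNReal).toReal * ‖b.repr ψ j‖ ^ (2 : ENNReal).toReal := by
    intro j
    rw [norm_mul, ← Real.mul_rpow hB0 (norm_nonneg _)]
    refine Real.rpow_le_rpow (by positivity) ?_ hp.le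
    exact mul_le_mul_of_nonneg_right (hB j) (norm_nonneg _)
  have hmem : Memℓp (fun j => m j * b.repr ψ j) 2 := by
    refine memℓp_gen (Summable.of_nonneg_of_le (fun j => by positivity) hle ?_)
    exact ((lp.memℓp (b.repr ψ)).summable hp).mul_left _
  set a : lp (fun _ : ℕ => ℝ) 2 := ⟨_, hmem⟩ with ha
  have haj : ∀ j, a j = m j * (inner ℝ (b j) ψ : ℝ) := fun j => by
    rw [← b.repr_apply_apply]
  have hsum : ∑' j, (m j * (inner ℝ (b j) ψ : ℝ)) • b j = b.repr.symm a := by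
    rw [← (b.hasSum_repr_symm a).tsum_eq]
    simp_rw [haj]
  rw [hsum]
  constructor
  · intro k
    rw [← b.repr_apply_apply, LinearIsometryEquiv.apply_symm_apply, haj]
  · rw [LinearIsometryEquiv.norm_map]
    refine lp.norm_le_of_forall_sum_le hp (by positivity) fun S => ?_
    calc ∑ j ∈ S, ‖a j‖ ^ (2 : ENNReal).toReal
        ≤ ∑ j ∈ S, B ^ (2 : ENNReal).toReal * ‖b.repr ψ j‖ ^ (2 : ENNReal).toReal :=
          Finset.sum_le_sum fun j _ => hle j
      _ = B ^ (2 : ENNReal).toReal * ∑ j ∈ S, ‖b.repr ψ j‖ ^ (2 : ENNReal).toReal :=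
          Finset.mul_sum _ _ _ |>.symm
      _ ≤ B ^ (2 : ENNReal).toReal * ‖b.repr ψ‖ ^ (2 : ENNReal).toReal := by
          gcongr
          exact lp.sum_rpow_le_norm_rpow hp _ _
      _ = _ := by
          rw [LinearIsometryEquiv.norm_map, Real.mul_rpow hB0 (norm_nonneg _)]

end Multiplier

/-- The finite geometric series with exact remainder. No smallness of t/e is required, so it applies
for every λ off the spectrum. -/
lemma sum_pow_div_pow_add {t e : ℝ} (he : e ≠ 0) (het : e - t ≠ 0) (N : ℕ) :
    ∑ i ∈ Finset.range N, t ^ i / e ^ (i + 1) + t ^ N / (e ^ N * (e - t)) = 1 / (e - t) := by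
  induction N with
  | zero => simp
  | succ N ih =>
    rw [Finset.sum_range_succ, ← ih, add_assoc]
    congr 1
    field_simp
    ring

/-! ### Spectral form of the solution operator and its Neumann expansion -/

section Spectral

variable {n : ℕ} {Ω : Set (EuclideanSpace ℝ (Fin n))} {s γ : ℝ}
  {G : EuclideanSpace ℝ (Fin n) → EuclideanSpace ℝ (Fin n) → ℝ}
  {ev : ℕ → ℝ} {φ : HilbertBasis ℕ ℝ (L2 Ω)}

lemma inner_L2_eq (f g : L2 Ω) : (inner ℝ f g : ℝ) = ∫ x in Ω, f x * g x := by
  rw [L2.inner_def]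
  congr 1; ext x
  simp [mul_comm]

lemma memLp_L2 (f : L2 Ω) : MemLp f 2 (volume.restrict Ω) := Lp.memLp f

namespace IsEigenbasis

/-- Bridge between spectral calculus and kernel bounds: symmetry of G and the eigenvalue equation
show that both sides have coefficients ⟨φ_j, ψ⟩ / ev_j. -/
lemma helmholtzOp_zero_ae_eq (hφ : IsEigenbasis Ω G ev φ) (hG : IsGreenFunction Ω s γ G)
    (hΩ : IsBoundedC11 Ω) (hn : 1 ≤ n) (hs : 0 < s) (hγ : γ ∈ Ioc (0 : ℝ) 1) (ψ : L2 Ω) :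
    (helmholtzOp ev φ 0 ψ : EuclideanSpace ℝ (Fin n) → ℝ) =ᵐ[volume.restrict Ω]
      greenOp Ω G ψ := by
  have hmem := hG.memLp_greenOp hΩ hn hs hγ (memLp_L2 ψ)
  have hcoef : ∀ j, (inner ℝ (φ j) (hmem.toLp _) : ℝ) = inner ℝ (φ j) ψ / (ev j - 0) := by
    intro j
    have hj := (hφ.pos j).ne'
    have h1 : (inner ℝ (φ j) (hmem.toLp _) : ℝ) =
        ∫ x in Ω, (φ j : L2 Ω) x * greenOp Ω G ψ x := by
      rw [inner_L2_eq]
      refine integral_congr_ae ?_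
      filter_upwards [hmem.coeFn_toLp] with x hx
      rw [hx]
    rw [h1, hG.integral_mul_greenOp hΩ hn hs hγ (memLp_L2 ψ) (memLp_L2 _), inner_L2_eq, sub_zero,
      eq_div_iff hj, ← integral_mul_const]
    refine integral_congr_ae ?_
    filter_upwards [hφ.eigen j] with x hx
    rw [hx]; ring
  have : helmholtzOp ev φ 0 ψ = hmem.toLp _ := by
    rw [helmholtzOp, ← (φ.hasSum_repr (hmem.toLp _)).tsum_eq]
    simp_rw [φ.repr_apply_apply, hcoef]
  rw [this]
  exact hmem.coeFn_toLp

lemma inner_helmholtzOp_zero (hφ : IsEigenbasis Ω G ev φ) (k : ℕ) (ψ : L2 Ω) :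
    (inner ℝ (φ k) (helmholtzOp ev φ 0 ψ) : ℝ) = inner ℝ (φ k) ψ / ev k := by
  have hB : ∀ j, |(ev j)⁻¹| ≤ (ev 0)⁻¹ := fun j => by
    rw [abs_of_pos (inv_pos.2 (hφ.pos j))]
    exact inv_anti₀ (hφ.pos 0) (hφ.mono (Nat.zero_le j))
  have h := (φ.tsum_multiplier hB ψ).1 k
  rw [helmholtzOp]
  simp_rw [sub_zero, div_eq_inv_mul]
  exact h

lemma inner_iterate_helmholtzOp_zero (hφ : IsEigenbasis Ω G ev φ) (k i : ℕ) (ψ : L2 Ω) :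
    (inner ℝ (φ k) ((helmholtzOp ev φ 0)^[i] ψ) : ℝ) = inner ℝ (φ k) ψ / ev k ^ i := by
  induction i with
  | zero => simp
  | succ i ih =>
    rw [Function.iterate_succ_apply', hφ.inner_helmholtzOp_zero, ih, pow_succ, div_div]

lemma iterate_helmholtzOp_zero_basis (hφ : IsEigenbasis Ω G ev φ) (j i : ℕ) :
    (φ j : L2 Ω) = (ev j ^ i) • (helmholtzOp ev φ 0)^[i] (φ j) := by
  refine φ.eq_of_forall_inner_eq fun k => ?_
  rw [inner_smul_right, hφ.inner_iterate_helmholtzOp_zero, φ.inner_eq_ite]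
  split_ifs with h
  · subst h
    have := (hφ.pos k).ne'
    field_simp
  · simp

/-- The part of the solution operator above the cut index. -/
lemma exists_upper_part (hφ : IsEigenbasis Ω G ev φ) {lam : ℝ} {I : ℕ} (hlam : lam ≤ ev I)
    (hI : ev I < ev (I + 1)) (ψ : L2 Ω) :
    ∃ v : L2 Ω, (∀ k, (inner ℝ (φ k) v : ℝ) =
        if k ≤ I then 0 else (inner ℝ (φ k) ψ : ℝ) / (ev k - lam)) ∧
      ‖v‖ ≤ (ev (I + 1) - ev I)⁻¹ * ‖ψ‖ := by
  have hgap : 0 < ev (I + 1) - ev I := by linarith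
  -- Since lam ≤ ev I, every denominator beyond the cut is at least the spectral gap. This is the
  -- source of uniformity in `lam`.
  have hB : ∀ j, |if j ≤ I then 0 else (ev j - lam)⁻¹| ≤ (ev (I + 1) - ev I)⁻¹ := by
    intro j
    split_ifs with h
    · simpa using hgap.le
    · have h1 := hφ.mono (show I + 1 ≤ j by omega)
      rw [abs_of_pos (inv_pos.2 (by linarith))]
      exact inv_anti₀ hgap (by linarith)
  obtain ⟨h1, h2⟩ := φ.tsum_multiplier hB ψ
  refine ⟨_, fun k => ?_, h2⟩
  rw [h1]
  split_ifs
  · simp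
  · rw [div_eq_inv_mul]

lemma inner_helmholtzOp (hφ : IsEigenbasis Ω G ev φ) {lam : ℝ} {I : ℕ} (hlam : lam ≤ ev I)
    (hI : ev I < ev (I + 1)) (k : ℕ) (ψ : L2 Ω) :
    (inner ℝ (φ k) (helmholtzOp ev φ lam ψ) : ℝ) = inner ℝ (φ k) ψ / (ev k - lam) := by
  have hgap : 0 < ev (I + 1) - ev I := by linarith
  -- This bound depends on `lam`, but it only serves convergence of the series. At an eigenvalue,
  -- division by zero returns 0 on both sides of the claim.
  have hB : ∀ j, |(ev j - lam)⁻¹| ≤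
      ∑ i ∈ Finset.range (I + 1), |(ev i - lam)⁻¹| + (ev (I + 1) - ev I)⁻¹ := by
    intro j
    by_cases h : j ≤ I
    · have := Finset.single_le_sum (f := fun i => |(ev i - lam)⁻¹|) (fun i _ => abs_nonneg _)
        (Finset.mem_range.2 (show j < I + 1 by omega))
      have h2 : 0 ≤ (ev (I + 1) - ev I)⁻¹ := (inv_pos.2 hgap).le
      linarith
    · have h1 := hφ.mono (show I + 1 ≤ j by omega)
      have h2 : 0 ≤ ∑ i ∈ Finset.range (I + 1), |(ev i - lam)⁻¹| :=
        Finset.sum_nonneg fun _ _ => abs_nonneg _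
      have h3 : |(ev j - lam)⁻¹| ≤ (ev (I + 1) - ev I)⁻¹ := by
        rw [abs_of_pos (inv_pos.2 (by linarith))]
        exact inv_anti₀ hgap (by linarith)
      linarith
  have h := (φ.tsum_multiplier hB ψ).1 k
  rw [helmholtzOp]
  simp_rw [div_eq_inv_mul]
  exact h

/-- The solution operator is, up to eigenfunctions below the cut, a Neumann sum and a smoothing
remainder. -/
lemma helmholtzOp_eq (hφ : IsEigenbasis Ω G ev φ) {lam : ℝ} {I : ℕ} (hlam : lam ∉ range ev)
    (hlamI : lam ≤ ev I) (hI : ev I < ev (I + 1)) (a : ℕ) (ψ v : L2 Ω)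
    (hv : ∀ k, (inner ℝ (φ k) v : ℝ) = if k ≤ I then 0 else
      (inner ℝ (φ k) ((helmholtzOp ev φ 0)^[a] ψ) : ℝ) / (ev k - lam)) :
    ∃ d : ℕ → ℝ, helmholtzOp ev φ lam ψ =
      (∑ i ∈ Finset.range (2 * a), (lam ^ i) • (helmholtzOp ev φ 0)^[i + 1] ψ +
        (lam ^ (2 * a)) • (helmholtzOp ev φ 0)^[a] v) +
      ∑ j ∈ Finset.range (I + 1), d j • (φ j : L2 Ω) := by
  -- On the modes k ≤ I the remainder vanishes, so `d` is simply the exact coefficient minus that of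
  -- the Neumann sum.
  refine ⟨fun k => (inner ℝ (φ k) ψ : ℝ) / (ev k - lam) -
    ∑ i ∈ Finset.range (2 * a), lam ^ i * ((inner ℝ (φ k) ψ : ℝ) / ev k ^ (i + 1)), ?_⟩
  refine φ.eq_of_forall_inner_eq fun k => ?_
  have hne : ev k - lam ≠ 0 := fun h => hlam ⟨k, by linarith⟩
  have hk := (hφ.pos k).ne'
  rw [hφ.inner_helmholtzOp hlamI hI, inner_add_right, inner_add_right, inner_sum, inner_sum]
  simp_rw [inner_smul_right, hφ.inner_iterate_helmholtzOp_zero, hv, φ.inner_eq_ite,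
    hφ.inner_iterate_helmholtzOp_zero]
  simp only [mul_ite, mul_one, mul_zero, Finset.sum_ite_eq, Finset.mem_range]
  by_cases hkI : k ≤ I
  · simp [hkI, Nat.lt_succ_of_le hkI]
  · rw [if_neg hkI, if_neg (by omega)]
    -- Beyond the cut this is the geometric identity with 2a terms; of the 2a inverse powers of `ev
    -- k` in the remainder, a are inside `v` and a come from the outer iterate.
    rw [div_eq_mul_one_div (inner ℝ (φ k) ψ : ℝ), ← sum_pow_div_pow_add hk hne (2 * a), mul_add,
      Finset.mul_sum, add_zero]
    congr 1
    · refine Finset.sum_congr rfl fun i _ => ?_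
      ring
    · field_simp
      ring

end IsEigenbasis

end Spectral

/-! ### Pointwise domination of the solution operator -/

section Estimates

variable {n : ℕ} {Ω : Set (EuclideanSpace ℝ (Fin n))} {s γ : ℝ}
  {G : EuclideanSpace ℝ (Fin n) → EuclideanSpace ℝ (Fin n) → ℝ}
  {ev : ℕ → ℝ} {φ : HilbertBasis ℕ ℝ (L2 Ω)}

lemma aemeasurable_enorm_L2 (ψ : L2 Ω) : AEMeasurable (fun x => ‖ψ x‖ₑ) (volume.restrict Ω) :=
  (Lp.aestronglyMeasurable ψ).enorm

lemma enorm_L2_eq (v : L2 Ω) : ‖v‖ₑ = (∫⁻ x in Ω, ‖v x‖ₑ ^ (2 : ℝ)) ^ (1 / 2 : ℝ) := by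
  rw [Lp.enorm_def, eLpNorm_eq_lintegral_rpow_enorm_toReal (by norm_num) (by norm_num)]
  simp

lemma exists_lintegral_bdist_rpow_sq_eq (hΩ : IsBoundedC11 Ω) (hn : 1 ≤ n) (hγ : 0 < γ) :
    ∃ S : ℝ, 0 ≤ S ∧
      (∫⁻ x in Ω, ENNReal.ofReal (bdist Ω x ^ γ) ^ (2 : ℝ)) ^ (1 / 2 : ℝ) = ENNReal.ofReal S := by
  have hfin : ∫⁻ x in Ω, ENNReal.ofReal (bdist Ω x ^ γ) ^ (2 : ℝ) < ⊤ := by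
    have h := hΩ.lintegral_bdist_rpow_lt_top hn (β := γ * 2) (by linarith)
    convert h using 4 with x
    rw [ENNReal.ofReal_rpow_of_nonneg (Real.rpow_nonneg (bdist_nonneg _) _) (by norm_num),
      ← Real.rpow_mul (bdist_nonneg _)]
  refine ⟨_, ENNReal.toReal_nonneg, (ENNReal.ofReal_toReal ?_).symm⟩
  exact ENNReal.rpow_ne_top_of_nonneg (by norm_num) hfin.ne

lemma lintegral_bdist_rpow_mul_enorm_le {S : ℝ}
    (hS : (∫⁻ x in Ω, ENNReal.ofReal (bdist Ω x ^ γ) ^ (2 : ℝ)) ^ (1 / 2 : ℝ) = ENNReal.ofReal S)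
    (v : L2 Ω) :
    ∫⁻ x in Ω, ENNReal.ofReal (bdist Ω x ^ γ) * ‖v x‖ₑ ≤ ENNReal.ofReal S * ‖v‖ₑ := by
  have hm : AEMeasurable (fun x => ENNReal.ofReal (bdist Ω x ^ γ)) (volume.restrict Ω) :=
    (continuous_bdist.measurable.pow_const γ).ennreal_ofReal.aemeasurable
  rw [enorm_L2_eq, ← hS]
  exact ENNReal.lintegral_mul_le_Lp_mul_Lq (volume.restrict Ω) Real.HolderConjugate.two_two hm
    (aemeasurable_enorm_L2 v)

lemma enorm_L2_le_of_le_pot_zero {S : ℝ}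
    (hS : (∫⁻ x in Ω, ENNReal.ofReal (bdist Ω x ^ γ) ^ (2 : ℝ)) ^ (1 / 2 : ℝ) = ENNReal.ofReal S)
    {C : ℝ} {v : L2 Ω} {g : EuclideanSpace ℝ (Fin n) → ENNReal}
    (hJ : ∫⁻ y in Ω, ENNReal.ofReal (bdist Ω y ^ γ) * g y ≠ ⊤)
    (h : ∀ᵐ x ∂(volume.restrict Ω), ‖v x‖ₑ ≤ ENNReal.ofReal C * pot Ω s γ 0 g x) :
    ‖v‖ₑ ≤ ENNReal.ofReal C * (∫⁻ y in Ω, ENNReal.ofReal (bdist Ω y ^ γ) * g y) *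
      ENNReal.ofReal S := by
  set J := ∫⁻ y in Ω, ENNReal.ofReal (bdist Ω y ^ γ) * g y with hJd
  rw [enorm_L2_eq, ← hS]
  have h1 : ∫⁻ x in Ω, ‖v x‖ₑ ^ (2 : ℝ) ≤
      (ENNReal.ofReal C * J) ^ (2 : ℝ) *
        ∫⁻ x in Ω, ENNReal.ofReal (bdist Ω x ^ γ) ^ (2 : ℝ) := by
    have hne : (ENNReal.ofReal C * J) ^ (2 : ℝ) ≠ ⊤ :=
      ENNReal.rpow_ne_top_of_nonneg (by norm_num) (ENNReal.mul_ne_top ENNReal.ofReal_ne_top hJ)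
    rw [← lintegral_const_mul' _ _ hne]
    refine lintegral_mono_ae ?_
    filter_upwards [h] with x hx
    rw [pot_zero, ← hJd] at hx
    rw [← ENNReal.mul_rpow_of_nonneg _ _ (by norm_num)]
    refine ENNReal.rpow_le_rpow (hx.trans (le_of_eq ?_)) (by norm_num)
    ring
  refine (ENNReal.rpow_le_rpow h1 (by norm_num)).trans (le_of_eq ?_)
  rw [ENNReal.mul_rpow_of_nonneg _ _ (by norm_num), ← ENNReal.rpow_mul]
  norm_num

lemma lintegral_bdist_rpow_mul_enorm_ne_top (hΩ : IsBoundedC11 Ω) (hn : 1 ≤ n) (hγ : 0 < γ)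
    (v : L2 Ω) : ∫⁻ x in Ω, ENNReal.ofReal (bdist Ω x ^ γ) * ‖v x‖ₑ ≠ ⊤ := by
  obtain ⟨S, -, hS⟩ := exists_lintegral_bdist_rpow_sq_eq hΩ hn hγ
  exact ne_top_of_le_ne_top (ENNReal.mul_ne_top ENNReal.ofReal_ne_top enorm_ne_top)
    (lintegral_bdist_rpow_mul_enorm_le hS v)

namespace IsEigenbasis

lemma exists_enorm_helmholtzOp_zero_le (hφ : IsEigenbasis Ω G ev φ) (hG : IsGreenFunction Ω s γ G)
    (hΩ : IsBoundedC11 Ω) (hn : 1 ≤ n) (hs : 0 < s) (hγ : γ ∈ Ioc (0 : ℝ) 1) :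
    ∃ A : ℝ, 0 < A ∧ ∀ ψ : L2 Ω, ∀ᵐ x ∂(volume.restrict Ω),
      ‖helmholtzOp ev φ 0 ψ x‖ₑ ≤ ENNReal.ofReal A * pot Ω s γ 1 (fun y => ‖ψ y‖ₑ) x := by
  obtain ⟨c, hc, hcG⟩ := hG.exists_bounds hΩ hn hγ
  refine ⟨c, hc, fun ψ => ?_⟩
  filter_upwards [hφ.helmholtzOp_zero_ae_eq hG hΩ hn hs hγ ψ,
    ae_restrict_mem hΩ.isOpen.measurableSet] with x hx hxΩ
  rw [hx]
  exact IsGreenFunction.enorm_greenOp_le hΩ hn hc.le (fun x hx y hy hxy =>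
    ⟨(hcG x hx y hy hxy).1, (hcG x hx y hy hxy).2.2.1⟩) _ hxΩ

/-- The first application gives τ = 1 and each further one lowers τ by ε, so i + 1 applications
reach 1 - i ε. -/
lemma exists_enorm_iterate_le (hφ : IsEigenbasis Ω G ev φ) (hG : IsGreenFunction Ω s γ G)
    (hΩ : IsBoundedC11 Ω) (hn : 1 ≤ n) (hs : 0 < s) (hs2 : 2 * s < n) (hγ : γ ∈ Ioc (0 : ℝ) 1)
    {ε : ℝ} (hε : 0 ≤ ε) (hεn : ((n : ℝ) - 2 * s) * (1 + ε) + 2 * γ * ε < n) (i : ℕ)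
    (hi : i * ε ≤ 1) :
    ∃ C : ℝ, 0 < C ∧ ∀ ψ : L2 Ω, ∀ᵐ x ∂(volume.restrict Ω),
      ‖(helmholtzOp ev φ 0)^[i + 1] ψ x‖ₑ ≤
        ENNReal.ofReal C * pot Ω s γ (1 - i * ε) (fun y => ‖ψ y‖ₑ) x := by
  obtain ⟨A, hA, hT⟩ := hφ.exists_enorm_helmholtzOp_zero_le hG hΩ hn hs hγ
  obtain ⟨B, hB, hpp⟩ := exists_pot_pot_le hΩ hn hs2 hγ.1 hε hεn
  induction i with
  | zero =>
    refine ⟨A, hA, fun ψ => ?_⟩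
    simpa using hT ψ
  | succ i ih =>
    push_cast at hi
    obtain ⟨C, hC, hi'⟩ := ih (by nlinarith)
    refine ⟨A * (C * B), by positivity, fun ψ => ?_⟩
    filter_upwards [hT ((helmholtzOp ev φ 0)^[i + 1] ψ),
      ae_restrict_mem hΩ.isOpen.measurableSet] with x hx hxΩ
    rw [Function.iterate_succ_apply']
    refine hx.trans ?_
    have h1 := pot_mono_ae (s := s) (γ := γ) (τ := 1) (hi' ψ) x
    rw [pot_const_mul ENNReal.ofReal_ne_top] at h1
    have h2 := hpp (1 - i * ε) (by nlinarith) (by nlinarith [mul_nonneg (Nat.cast_nonneg (α := ℝ) i) hε])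
      _ (aemeasurable_enorm_L2 ψ) x hxΩ
    have e : (1 : ℝ) - i * ε - ε = 1 - ((i + 1 : ℕ) : ℝ) * ε := by push_cast; ring
    rw [e] at h2
    calc _ ≤ ENNReal.ofReal A * (ENNReal.ofReal C * (ENNReal.ofReal B *
          pot Ω s γ (1 - ((i + 1 : ℕ) : ℝ) * ε) (fun y => ‖ψ y‖ₑ) x)) := by
          gcongr
          exact h1.trans (by gcongr)
      _ = _ := by
          rw [ENNReal.ofReal_mul hA.le, ENNReal.ofReal_mul hC.le]; ring

/-- With ε = 0 the composition gains nothing, but every iterate keeps the bound of the first: this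
controls each term of the Neumann sum. -/
lemma exists_enorm_iterate_le_pot_one (hφ : IsEigenbasis Ω G ev φ)
    (hG : IsGreenFunction Ω s γ G) (hΩ : IsBoundedC11 Ω) (hn : 1 ≤ n) (hs : 0 < s)
    (hs2 : 2 * s < n) (hγ : γ ∈ Ioc (0 : ℝ) 1) (i : ℕ) :
    ∃ C : ℝ, 0 < C ∧ ∀ ψ : L2 Ω, ∀ᵐ x ∂(volume.restrict Ω),
      ‖(helmholtzOp ev φ 0)^[i + 1] ψ x‖ₑ ≤
        ENNReal.ofReal C * pot Ω s γ 1 (fun y => ‖ψ y‖ₑ) x := by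
  have := hφ.exists_enorm_iterate_le hG hΩ hn hs hs2 hγ (ε := 0) le_rfl (by linarith) i (by simp)
  simpa using this

lemma exists_enorm_iterate_le_pot_zero (hφ : IsEigenbasis Ω G ev φ)
    (hG : IsGreenFunction Ω s γ G) (hΩ : IsBoundedC11 Ω) (hn : 1 ≤ n) (hs : 0 < s)
    (hs2 : 2 * s < n) (hγ : γ ∈ Ioc (0 : ℝ) 1) :
    ∃ (a : ℕ) (C : ℝ), 0 < C ∧ ∀ ψ : L2 Ω, ∀ᵐ x ∂(volume.restrict Ω),
      ‖(helmholtzOp ev φ 0)^[a] ψ x‖ₑ ≤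
        ENNReal.ofReal C * pot Ω s γ 0 (fun y => ‖ψ y‖ₑ) x := by
  -- With ε = 1/N this choice of N makes (n - 2s)(1 + ε) + 2γε < n, and N steps of size ε bring τ
  -- from 1 to exactly 0.
  obtain ⟨N, hN⟩ := exists_nat_gt (((n : ℝ) - 2 * s + 2 * γ) / (2 * s))
  have hpos : 0 < (n : ℝ) - 2 * s + 2 * γ := by linarith [hγ.1]
  have hN0 : (0 : ℝ) < N := lt_trans (by positivity) hN
  rw [div_lt_iff₀ (by positivity)] at hN
  have hε : ((n : ℝ) - 2 * s) * (1 + 1 / N) + 2 * γ * (1 / N) < n := by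
    have : ((n : ℝ) - 2 * s + 2 * γ) * (1 / N) < 2 * s := by
      rw [mul_one_div, div_lt_iff₀ hN0]; linarith
    linarith
  have e : (N : ℝ) * (1 / N) = 1 := by field_simp
  obtain ⟨C, hC, h⟩ := hφ.exists_enorm_iterate_le hG hΩ hn hs hs2 hγ (ε := 1 / N) (by positivity)
    hε N e.le
  refine ⟨N + 1, C, hC, fun ψ => ?_⟩
  have := h ψ
  rwa [e, sub_self] at this

/-- The eigenfunctions are bounded by a multiple of `δ^γ`. -/
lemma exists_abs_basis_le (hφ : IsEigenbasis Ω G ev φ)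
    (hG : IsGreenFunction Ω s γ G) (hΩ : IsBoundedC11 Ω) (hn : 1 ≤ n) (hs : 0 < s)
    (hs2 : 2 * s < n) (hγ : γ ∈ Ioc (0 : ℝ) 1) (j : ℕ) :
    ∃ M : ℝ, ∀ᵐ x ∂(volume.restrict Ω), |(φ j : L2 Ω) x| ≤ M * bdist Ω x ^ γ := by
  obtain ⟨a, C, hC, h⟩ := hφ.exists_enorm_iterate_le_pot_zero hG hΩ hn hs hs2 hγ
  set J := ∫⁻ y in Ω, ENNReal.ofReal (bdist Ω y ^ γ) * ‖(φ j : L2 Ω) y‖ₑ with hJ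
  have hJt : J ≠ ⊤ := lintegral_bdist_rpow_mul_enorm_ne_top hΩ hn hγ.1 _
  have hev := hφ.pos j
  -- An eigenfunction equals ev_j^a times its own image under 𝔾₀^a, so the rank-one bound applies to
  -- it.
  refine ⟨ev j ^ a * (C * J.toReal), ?_⟩
  have hsm := Lp.coeFn_smul (ev j ^ a) ((helmholtzOp ev φ 0)^[a] (φ j : L2 Ω))
  rw [← hφ.iterate_helmholtzOp_zero_basis j a] at hsm
  filter_upwards [hsm, h (φ j)] with x hx1 hx2
  rw [pot_zero, ← hJ, ← ENNReal.ofReal_toReal hJt,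
    ← ENNReal.ofReal_mul (Real.rpow_nonneg (bdist_nonneg _) _), ← ENNReal.ofReal_mul hC.le,
    Real.enorm_eq_ofReal_abs, ENNReal.ofReal_le_ofReal_iff (mul_nonneg hC.le (mul_nonneg
      (Real.rpow_nonneg (bdist_nonneg _) _) ENNReal.toReal_nonneg))] at hx2
  rw [hx1, Pi.smul_apply, smul_eq_mul, abs_mul, abs_of_pos (by positivity)]
  calc _ ≤ ev j ^ a * (C * (bdist Ω x ^ γ * J.toReal)) := by gcongr
    _ = _ := by ring

/-- Up to eigenfunctions below the cut, the solution operator is dominated by the Green operator,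
uniformly in the spectral parameter. -/
lemma exists_helmholtzOp_decomposition (hφ : IsEigenbasis Ω G ev φ)
    (hG : IsGreenFunction Ω s γ G) (hΩ : IsBoundedC11 Ω) (hn : 1 ≤ n) (hs : 0 < s)
    (hs2 : 2 * s < n) (hγ : γ ∈ Ioc (0 : ℝ) 1) {I : ℕ} (hI : ev I < ev (I + 1)) (m : ℝ) :
    ∃ C : ℝ, 0 < C ∧ ∀ lam : ℝ, lam ∉ range ev → -m ≤ lam → lam ≤ ev I → ∀ ψ : L2 Ω,
      ∃ (w : L2 Ω) (d : ℕ → ℝ),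
        helmholtzOp ev φ lam ψ = w + ∑ j ∈ Finset.range (I + 1), d j • (φ j : L2 Ω) ∧
        ∀ᵐ x ∂(volume.restrict Ω),
          ‖w x‖ₑ ≤ ENNReal.ofReal C * pot Ω s γ 1 (fun y => ‖ψ y‖ₑ) x := by
  obtain ⟨a, A, hA, hTa⟩ := hφ.exists_enorm_iterate_le_pot_zero hG hΩ hn hs hs2 hγ
  choose Ci hCi hTi using hφ.exists_enorm_iterate_le_pot_one hG hΩ hn hs hs2 hγ
  obtain ⟨S, hS0, hS⟩ := exists_lintegral_bdist_rpow_sq_eq hΩ hn hγ.1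
  obtain ⟨P, hP1, hP⟩ := exists_pot_le_pot hΩ hn hs2 hγ.1
  -- `Λ` bounds |lam|, because -m ≤ lam ≤ ev I.
  set Λ : ℝ := max |m| (ev I) with hΛ
  have hΛ0 : 0 < Λ := lt_max_of_lt_right (hφ.pos I)
  set q : ℝ := (ev (I + 1) - ev I)⁻¹ with hq
  have hq0 : 0 < q := inv_pos.2 (by linarith)
  have hP0 : 0 < P := by linarith
  -- The sum bounds the Neumann terms. In the remainder, A belongs to the outer iterate; S q A S
  -- bounds ∫ δ^γ |v| by ∫ δ^γ |ψ| through the L² norms of v and of the inner iterate; P passes from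
  -- τ = 0 back to τ = 1. The final 1 ensures positivity.
  refine ⟨∑ i ∈ Finset.range (2 * a), Λ ^ i * Ci i + Λ ^ (2 * a) * (A * (S * q * A * S * P)) + 1,
    ?_, ?_⟩
  · have : 0 ≤ ∑ i ∈ Finset.range (2 * a), Λ ^ i * Ci i :=
      Finset.sum_nonneg fun i _ => mul_nonneg (by positivity) (hCi i).le
    have h2 : 0 ≤ Λ ^ (2 * a) * (A * (S * q * A * S * P)) := by positivity
    linarith
  intro lam hlam hm hlI ψ
  have hlamΛ : |lam| ≤ Λ := by
    rw [abs_le]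
    constructor
    · have : -|m| ≤ -m := neg_le_neg (le_abs_self m)
      linarith [le_max_left |m| (ev I)]
    · exact hlI.trans (le_max_right _ _)
  have hpow : ∀ i : ℕ, ‖lam ^ i‖ₑ ≤ ENNReal.ofReal (Λ ^ i) := fun i => by
    rw [Real.enorm_eq_ofReal_abs, abs_pow]
    gcongr
  obtain ⟨v, hv, hvn⟩ := hφ.exists_upper_part hlI hI ((helmholtzOp ev φ 0)^[a] ψ)
  obtain ⟨d, hd⟩ := hφ.helmholtzOp_eq hlam hlI hI a ψ v hv
  refine ⟨_, d, hd, ?_⟩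
  set J := ∫⁻ y in Ω, ENNReal.ofReal (bdist Ω y ^ γ) * ‖ψ y‖ₑ with hJ
  have hJt : J ≠ ⊤ := lintegral_bdist_rpow_mul_enorm_ne_top hΩ hn hγ.1 _
  have hvn' : ‖v‖ₑ ≤ ENNReal.ofReal q * ‖(helmholtzOp ev φ 0)^[a] ψ‖ₑ := by
    rw [← ofReal_norm, ← ofReal_norm, ← ENNReal.ofReal_mul hq0.le]
    exact ENNReal.ofReal_le_ofReal hvn
  have hTan := enorm_L2_le_of_le_pot_zero hS hJt (hTa ψ)
  have hvJ : ∫⁻ x in Ω, ENNReal.ofReal (bdist Ω x ^ γ) * ‖v x‖ₑ ≤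
      ENNReal.ofReal (S * q * A * S) * J := by
    calc _ ≤ ENNReal.ofReal S * (ENNReal.ofReal q *
          (ENNReal.ofReal A * J * ENNReal.ofReal S)) :=
          (lintegral_bdist_rpow_mul_enorm_le hS v).trans (by gcongr; exact hvn'.trans (by gcongr))
      _ = _ := by
          rw [ENNReal.ofReal_mul (by positivity), ENNReal.ofReal_mul (by positivity),
            ENNReal.ofReal_mul hS0]
          ring
  have hsum : ∀ᵐ x ∂(volume.restrict Ω),
      (∑ i ∈ Finset.range (2 * a), (lam ^ i) • (helmholtzOp ev φ 0)^[i + 1] ψ +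
        (lam ^ (2 * a)) • (helmholtzOp ev φ 0)^[a] v : L2 Ω) x =
      ∑ i ∈ Finset.range (2 * a), lam ^ i * (helmholtzOp ev φ 0)^[i + 1] ψ x +
        lam ^ (2 * a) * (helmholtzOp ev φ 0)^[a] v x := by
    have h1 : ∀ᵐ x ∂(volume.restrict Ω), ∀ i : ℕ,
        ((lam ^ i) • (helmholtzOp ev φ 0)^[i + 1] ψ : L2 Ω) x =
          lam ^ i * (helmholtzOp ev φ 0)^[i + 1] ψ x := by
      rw [ae_all_iff]
      intro i
      filter_upwards [Lp.coeFn_smul (lam ^ i) ((helmholtzOp ev φ 0)^[i + 1] ψ)] with x hx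
      rw [hx]; simp
    filter_upwards [Lp.coeFn_add (∑ i ∈ Finset.range (2 * a),
        (lam ^ i) • (helmholtzOp ev φ 0)^[i + 1] ψ) ((lam ^ (2 * a)) • (helmholtzOp ev φ 0)^[a] v),
      Lp.coeFn_smul (lam ^ (2 * a)) ((helmholtzOp ev φ 0)^[a] v),
      Lp.coeFn_finsetSum (Finset.range (2 * a))
        (fun i => (lam ^ i) • (helmholtzOp ev φ 0)^[i + 1] ψ), h1] with x e1 e2 e3 e4
    rw [e1, Pi.add_apply, e2, Pi.smul_apply, smul_eq_mul, e3, Finset.sum_apply]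
    simp_rw [e4]
  have hall : ∀ᵐ x ∂(volume.restrict Ω), ∀ i : ℕ, ‖(helmholtzOp ev φ 0)^[i + 1] ψ x‖ₑ ≤
      ENNReal.ofReal (Ci i) * pot Ω s γ 1 (fun y => ‖ψ y‖ₑ) x :=
    ae_all_iff.2 fun i => hTi i ψ
  filter_upwards [hsum, hall, hTa v, ae_restrict_mem hΩ.isOpen.measurableSet] with x hx h1 h2 hxΩ
  rw [hx]
  set p := pot Ω s γ 1 (fun y => ‖ψ y‖ₑ) x with hp
  have h3 : pot Ω s γ 0 (fun y => ‖v y‖ₑ) x ≤ ENNReal.ofReal (S * q * A * S * P) * p := by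
    calc pot Ω s γ 0 (fun y => ‖v y‖ₑ) x
        ≤ ENNReal.ofReal (bdist Ω x ^ γ) * (ENNReal.ofReal (S * q * A * S) * J) := by
          rw [pot_zero]; gcongr
      _ = ENNReal.ofReal (S * q * A * S) * pot Ω s γ 0 (fun y => ‖ψ y‖ₑ) x := by
          rw [pot_zero]; ring
      _ ≤ ENNReal.ofReal (S * q * A * S) * (ENNReal.ofReal P * p) := by
          gcongr
          exact hP 0 1 le_rfl zero_le_one le_rfl _ x hxΩ
      _ = _ := by rw [ENNReal.ofReal_mul (by positivity) (q := P)]; ring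
  calc _ ≤ ∑ i ∈ Finset.range (2 * a), ‖lam ^ i * (helmholtzOp ev φ 0)^[i + 1] ψ x‖ₑ +
        ‖lam ^ (2 * a) * (helmholtzOp ev φ 0)^[a] v x‖ₑ :=
        (enorm_add_le _ _).trans (by gcongr; exact enorm_sum_le _ _)
    _ ≤ ∑ i ∈ Finset.range (2 * a), ENNReal.ofReal (Λ ^ i * Ci i) * p +
        ENNReal.ofReal (Λ ^ (2 * a) * (A * (S * q * A * S * P))) * p := by
        gcongr with i hi
        · rw [enorm_mul, ENNReal.ofReal_mul (by positivity), mul_assoc]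
          exact mul_le_mul' (hpow i) (h1 i)
        · rw [enorm_mul, ENNReal.ofReal_mul (by positivity), mul_assoc,
            ENNReal.ofReal_mul hA.le, mul_assoc]
          exact mul_le_mul' (hpow _) (h2.trans (by gcongr))
    _ = ENNReal.ofReal (∑ i ∈ Finset.range (2 * a), Λ ^ i * Ci i +
          Λ ^ (2 * a) * (A * (S * q * A * S * P))) * p := by
        rw [ENNReal.ofReal_add (Finset.sum_nonneg fun i _ => mul_nonneg (by positivity) (hCi i).le)
          (by positivity), ENNReal.ofReal_sum_of_nonneg
          (fun i _ => mul_nonneg (by positivity) (hCi i).le), add_mul, Finset.sum_mul]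
    _ ≤ _ := by
        exact mul_le_mul_left (ENNReal.ofReal_le_ofReal (by linarith)) _

end IsEigenbasis

end Estimates

/-! ### From the solution operator to weak solutions -/

section Duality

variable {n : ℕ} {Ω : Set (EuclideanSpace ℝ (Fin n))} {s γ : ℝ}
  {G : EuclideanSpace ℝ (Fin n) → EuclideanSpace ℝ (Fin n) → ℝ}
  {ev : ℕ → ℝ} {φ : HilbertBasis ℕ ℝ (L2 Ω)}

lemma MemWeightedL1.aemeasurable (hΩ : IsBoundedC11 Ω) (hn : 1 ≤ n)
    {f : EuclideanSpace ℝ (Fin n) → ℝ} (hf : MemWeightedL1 Ω (fun x => bdist Ω x ^ γ) f) :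
    AEMeasurable f (volume.restrict Ω) := by
  have hm : AEMeasurable (fun x => bdist Ω x ^ γ) (volume.restrict Ω) :=
    (continuous_bdist.measurable.pow_const γ).aemeasurable
  have h : AEMeasurable (fun x => f x * bdist Ω x ^ γ) (volume.restrict Ω) :=
    Integrable.aemeasurable hf
  refine (h.div hm).congr ?_
  filter_upwards [ae_restrict_mem hΩ.isOpen.measurableSet] with x hx
  have := Real.rpow_pos_of_pos (hΩ.bdist_pos hn hx) γ
  simp only [Pi.div_apply]
  field_simp

lemma MemWeightedL1.integrable_mul (hΩ : IsBoundedC11 Ω) (hn : 1 ≤ n)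
    {f g : EuclideanSpace ℝ (Fin n) → ℝ} (hf : MemWeightedL1 Ω (fun x => bdist Ω x ^ γ) f)
    (hg : AEStronglyMeasurable g (volume.restrict Ω)) {M : ℝ}
    (hM : ∀ᵐ x ∂(volume.restrict Ω), |g x| ≤ M * bdist Ω x ^ γ) :
    Integrable (fun x => f x * g x) (volume.restrict Ω) := by
  have h : Integrable (fun x => f x * bdist Ω x ^ γ) (volume.restrict Ω) := hf
  refine (h.norm.const_mul M).mono' ((hf.aemeasurable hΩ hn).aestronglyMeasurable.mul hg) ?_
  filter_upwards [hM] with x hx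
  rw [norm_mul, norm_mul, Real.norm_of_nonneg (Real.rpow_nonneg (bdist_nonneg x) γ)]
  calc ‖f x‖ * ‖g x‖ ≤ ‖f x‖ * (M * bdist Ω x ^ γ) := by gcongr; exact hx
    _ = _ := by ring

namespace IsEigenbasis

/-- Integration against f removes the eigenfunctions up to I, whose coefficients are not controlled
uniformly in `lam`. Only the dominated part `w` survives. -/
lemma exists_enorm_integral_mul_helmholtzOp_le (hφ : IsEigenbasis Ω G ev φ)
    (hG : IsGreenFunction Ω s γ G) (hΩ : IsBoundedC11 Ω) (hn : 1 ≤ n) (hs : 0 < s)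
    (hs2 : 2 * s < n) (hγ : γ ∈ Ioc (0 : ℝ) 1) {I : ℕ} (hI : ev I < ev (I + 1)) (m : ℝ) :
    ∃ C : ℝ, 0 < C ∧ ∀ lam : ℝ, lam ∉ range ev → -m ≤ lam → lam ≤ ev I →
      ∀ f : EuclideanSpace ℝ (Fin n) → ℝ, MemPerp Ω γ φ I f → ∀ ψ : L2 Ω,
        ‖∫ x in Ω, f x * helmholtzOp ev φ lam ψ x‖ₑ ≤
          ENNReal.ofReal C * ∫⁻ x in Ω, ‖f x‖ₑ * pot Ω s γ 1 (fun y => ‖ψ y‖ₑ) x := by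
  obtain ⟨C, hC, hdec⟩ := hφ.exists_helmholtzOp_decomposition hG hΩ hn hs hs2 hγ hI m
  refine ⟨C, hC, fun lam hlam hm hlI f hf ψ => ?_⟩
  obtain ⟨w, d, hw, hwb⟩ := hdec lam hlam hm hlI ψ
  have hfm := hf.1.aemeasurable hΩ hn
  have hle : ∫⁻ x in Ω, ‖f x * w x‖ₑ ≤
      ENNReal.ofReal C * ∫⁻ x in Ω, ‖f x‖ₑ * pot Ω s γ 1 (fun y => ‖ψ y‖ₑ) x := by
    rw [← lintegral_const_mul' _ _ ENNReal.ofReal_ne_top]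
    refine lintegral_mono_ae ?_
    filter_upwards [hwb] with x hx
    rw [enorm_mul]
    calc _ ≤ ‖f x‖ₑ * (ENNReal.ofReal C * pot Ω s γ 1 (fun y => ‖ψ y‖ₑ) x) := by gcongr
      _ = _ := by ring
  -- If f w is not integrable, the right-hand side is infinite and there is nothing to prove;
  -- otherwise the integral may be split.
  rcases eq_or_ne (∫⁻ x in Ω, ‖f x * w x‖ₑ) ⊤ with htop | htop
  · rw [htop, top_le_iff] at hle
    rw [hle]; exact le_top
  have hint : Integrable (fun x => f x * w x) (volume.restrict Ω) :=
    ⟨hfm.aestronglyMeasurable.mul (Lp.aestronglyMeasurable w), lt_top_iff_ne_top.2 htop⟩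
  have hintφ : ∀ j, Integrable (fun x => f x * (φ j : L2 Ω) x) (volume.restrict Ω) := fun j => by
    obtain ⟨M, hM⟩ := hφ.exists_abs_basis_le hG hΩ hn hs hs2 hγ j
    exact hf.1.integrable_mul hΩ hn (Lp.aestronglyMeasurable _) hM
  have hae : ∀ᵐ x ∂(volume.restrict Ω), f x * helmholtzOp ev φ lam ψ x =
      f x * w x + ∑ j ∈ Finset.range (I + 1), d j * (f x * (φ j : L2 Ω) x) := by
    have h1 : ∀ᵐ x ∂(volume.restrict Ω), ∀ j : ℕ,
        (d j • (φ j : L2 Ω) : L2 Ω) x = d j * (φ j : L2 Ω) x := by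
      rw [ae_all_iff]
      intro j
      filter_upwards [Lp.coeFn_smul (d j) (φ j : L2 Ω)] with x hx
      rw [hx]; simp
    rw [hw]
    filter_upwards [Lp.coeFn_add w (∑ j ∈ Finset.range (I + 1), d j • (φ j : L2 Ω)),
      Lp.coeFn_finsetSum (Finset.range (I + 1)) (fun j => d j • (φ j : L2 Ω)), h1] with x e1 e2 e3
    rw [e1, Pi.add_apply, e2, Finset.sum_apply, mul_add, Finset.mul_sum]
    simp_rw [e3]
    congr 1
    exact Finset.sum_congr rfl fun j _ => by ring
  have hzero : ∫ x in Ω, ∑ j ∈ Finset.range (I + 1), d j * (f x * (φ j : L2 Ω) x) = 0 := by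
    rw [integral_finsetSum _ fun j _ => (hintφ j).const_mul (d j)]
    refine Finset.sum_eq_zero fun j hj => ?_
    rw [integral_const_mul, hf.2 j (by simpa [Nat.lt_succ_iff] using hj), mul_zero]
  rw [integral_congr_ae hae, integral_add hint
    (integrable_finsetSum _ fun j _ => (hintφ j).const_mul (d j)), hzero, add_zero]
  exact (enorm_integral_le_lintegral_enorm _).trans hle

end IsEigenbasis

/-- Domination by a potential, tested against bounded multiples of `δ^γ`. -/
lemma setLIntegral_mul_bdist_rpow_le (hΩ : IsBoundedC11 Ω) (hn : 1 ≤ n) (hγ : 0 < γ) {C : ℝ}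
    {f u : EuclideanSpace ℝ (Fin n) → ℝ} (hfm : AEMeasurable f (volume.restrict Ω))
    (hu : MemWeightedL1 Ω (fun x => bdist Ω x ^ γ) u)
    (hdual : ∀ ψ : L2 Ω, (∃ M : ℝ, ∀ᵐ x ∂(volume.restrict Ω), |ψ x| ≤ M * bdist Ω x ^ γ) →
      ‖∫ x in Ω, u x * ψ x‖ₑ ≤
        ENNReal.ofReal C * ∫⁻ x in Ω, ‖f x‖ₑ * pot Ω s γ 1 (fun y => ‖ψ y‖ₑ) x)
    {S : Set (EuclideanSpace ℝ (Fin n))} (hS : MeasurableSet S) :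
    ∫⁻ x in S, ‖u x‖ₑ * ENNReal.ofReal (bdist Ω x ^ γ) ∂(volume.restrict Ω) ≤
      ∫⁻ x in S, ENNReal.ofReal C * pot Ω s γ 1 (fun y => ‖f y‖ₑ) x *
        ENNReal.ofReal (bdist Ω x ^ γ) ∂(volume.restrict Ω) := by
  have hum := hu.aemeasurable hΩ hn
  have hδm : Measurable fun x => bdist Ω x ^ γ := continuous_bdist.measurable.pow_const γ
  have hfe : AEMeasurable (fun x => ‖f x‖ₑ) (volume.restrict Ω) := hfm.enorm
  obtain ⟨D, hD1, hD, -⟩ := hΩ.exists_bound hn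
  have : IsFiniteMeasure (volume.restrict Ω) := ⟨by simpa using hΩ.volume_lt_top⟩
  -- The test function sign(u) δ^γ on S, with u / |u| = 0 where u vanishes. It lies in δ^γ L^∞ and
  -- turns the pairing with u into ∫_S |u| δ^γ.
  set g : EuclideanSpace ℝ (Fin n) → ℝ := S.indicator fun x => u x / |u x| * bdist Ω x ^ γ
    with hg
  have hgm : AEMeasurable g (volume.restrict Ω) :=
    ((hum.div (continuous_abs.measurable.comp_aemeasurable hum)).mul
      hδm.aemeasurable).indicator hS
  have hgle : ∀ x, |g x| ≤ S.indicator (fun x => bdist Ω x ^ γ) x := by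
    intro x
    by_cases hx : x ∈ S
    · rw [hg, indicator_of_mem hx, indicator_of_mem hx, abs_mul, abs_div, abs_abs,
        abs_of_nonneg (Real.rpow_nonneg (bdist_nonneg x) γ)]
      exact mul_le_of_le_one_left (Real.rpow_nonneg (bdist_nonneg x) γ) (div_self_le_one _)
    · rw [hg, indicator_of_notMem hx, indicator_of_notMem hx, abs_zero]
  have hgle' : ∀ x, |g x| ≤ 1 * bdist Ω x ^ γ := fun x => by
    refine (hgle x).trans ?_
    rw [one_mul]
    by_cases hx : x ∈ S
    · rw [indicator_of_mem hx]
    · rw [indicator_of_notMem hx]; exact Real.rpow_nonneg (bdist_nonneg x) γ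
  have hgL2 : MemLp g 2 (volume.restrict Ω) := by
    refine MemLp.of_bound hgm.aestronglyMeasurable (D ^ γ) ?_
    filter_upwards [ae_restrict_mem hΩ.isOpen.measurableSet] with x hx
    refine (hgle' x).trans ?_
    rw [one_mul]
    exact Real.rpow_le_rpow (bdist_nonneg x) (hD x hx) hγ.le
  have hco := hgL2.coeFn_toLp
  have hw := hdual (hgL2.toLp g) ⟨1, by
    filter_upwards [hco] with x hx
    rw [hx]; exact hgle' x⟩
  have hug : ∀ x, u x * g x = S.indicator (fun x => |u x| * bdist Ω x ^ γ) x := by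
    intro x
    by_cases hx : x ∈ S
    · rw [hg, indicator_of_mem hx, indicator_of_mem hx, ← mul_assoc, mul_div_assoc']
      congr 1
      rcases eq_or_ne (u x) 0 with h | h
      · simp [h]
      · rw [← abs_mul_abs_self (u x)]
        have : |u x| ≠ 0 := abs_ne_zero.2 h
        field_simp
    · rw [hg, indicator_of_notMem hx, indicator_of_notMem hx, mul_zero]
  have hint : Integrable (fun x => u x * g x) (volume.restrict Ω) :=
    hu.integrable_mul hΩ hn hgm.aestronglyMeasurable (ae_of_all _ hgle')
  have hnn : ∀ x, 0 ≤ u x * g x := fun x => by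
    rw [hug]
    by_cases hx : x ∈ S
    · rw [indicator_of_mem hx]
      exact mul_nonneg (abs_nonneg _) (Real.rpow_nonneg (bdist_nonneg x) γ)
    · rw [indicator_of_notMem hx]
  have hL : ∫⁻ x in S, ‖u x‖ₑ * ENNReal.ofReal (bdist Ω x ^ γ) ∂(volume.restrict Ω) =
      ‖∫ x in Ω, u x * (hgL2.toLp g : L2 Ω) x‖ₑ := by
    have e1 : ∫ x in Ω, u x * (hgL2.toLp g : L2 Ω) x = ∫ x in Ω, u x * g x := by
      refine integral_congr_ae ?_
      filter_upwards [hco] with x hx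
      rw [hx]
    rw [e1, Real.enorm_of_nonneg (integral_nonneg hnn),
      ofReal_integral_eq_lintegral_ofReal hint (ae_of_all _ hnn), ← lintegral_indicator hS]
    congr 1; ext x
    rw [hug]
    by_cases hx : x ∈ S
    · rw [indicator_of_mem hx, indicator_of_mem hx, ENNReal.ofReal_mul (abs_nonneg _),
        Real.enorm_eq_ofReal_abs]
    · rw [indicator_of_notMem hx, indicator_of_notMem hx, ENNReal.ofReal_zero]
  have hSm : AEMeasurable (S.indicator fun x => ENNReal.ofReal (bdist Ω x ^ γ))
      (volume.restrict Ω) := (hδm.ennreal_ofReal.indicator hS).aemeasurable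
  rw [hL]
  calc _ ≤ ENNReal.ofReal C * ∫⁻ x in Ω, ‖f x‖ₑ *
        pot Ω s γ 1 (fun y => ‖(hgL2.toLp g : L2 Ω) y‖ₑ) x :=
        hw
    _ ≤ ENNReal.ofReal C * ∫⁻ x in Ω, ‖f x‖ₑ *
        pot Ω s γ 1 (S.indicator fun x => ENNReal.ofReal (bdist Ω x ^ γ)) x := by
        gcongr with x
        refine pot_mono_ae ?_ x
        filter_upwards [hco] with y hy
        rw [hy, Real.enorm_eq_ofReal_abs]
        refine (ENNReal.ofReal_le_ofReal (hgle y)).trans (le_of_eq ?_)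
        by_cases hy : y ∈ S <;> simp [hy]
    -- The kernel is symmetric, so the potential moves from the test function to the datum.
    _ = ENNReal.ofReal C * ∫⁻ x in Ω, pot Ω s γ 1 (fun y => ‖f y‖ₑ) x *
        S.indicator (fun x => ENNReal.ofReal (bdist Ω x ^ γ)) x := by
        rw [lintegral_mul_pot hSm hfe]
    _ = _ := by
        rw [← lintegral_const_mul' _ _ ENNReal.ofReal_ne_top, ← lintegral_indicator hS]
        congr 1; ext x
        by_cases hx : x ∈ S
        · rw [indicator_of_mem hx, indicator_of_mem hx, mul_assoc]
        · rw [indicator_of_notMem hx, indicator_of_notMem hx, mul_zero, mul_zero]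

/-- Weak solutions are dominated by the potential of the datum. -/
lemma IsEigenbasis.exists_enorm_le_pot (hφ : IsEigenbasis Ω G ev φ)
    (hG : IsGreenFunction Ω s γ G) (hΩ : IsBoundedC11 Ω) (hn : 1 ≤ n) (hs : 0 < s)
    (hs2 : 2 * s < n) (hγ : γ ∈ Ioc (0 : ℝ) 1) {I : ℕ} (hI : ev I < ev (I + 1)) (m : ℝ) :
    ∃ C : ℝ, 0 < C ∧ ∀ lam : ℝ, lam ∉ range ev → -m ≤ lam → lam ≤ ev I →
      ∀ f u : EuclideanSpace ℝ (Fin n) → ℝ, MemPerp Ω γ φ I f → IsWeakSolution Ω γ ev φ lam f u →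
        ∀ᵐ x ∂(volume.restrict Ω),
          ‖u x‖ₑ ≤ ENNReal.ofReal C * pot Ω s γ 1 (fun y => ‖f y‖ₑ) x := by
  obtain ⟨C, hC, hdual⟩ := hφ.exists_enorm_integral_mul_helmholtzOp_le hG hΩ hn hs hs2 hγ hI m
  refine ⟨C, hC, fun lam hlam hm hlI f u hf hu => ?_⟩
  obtain ⟨-, hu1, hweak⟩ := hu
  have hfm := hf.1.aemeasurable hΩ hn
  have hum := hu1.aemeasurable hΩ hn
  have hδm : Measurable fun x => bdist Ω x ^ γ := continuous_bdist.measurable.pow_const γ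
  have hd : ∀ ψ : L2 Ω, (∃ M : ℝ, ∀ᵐ x ∂(volume.restrict Ω), |ψ x| ≤ M * bdist Ω x ^ γ) →
      ‖∫ x in Ω, u x * ψ x‖ₑ ≤
        ENNReal.ofReal C * ∫⁻ x in Ω, ‖f x‖ₑ * pot Ω s γ 1 (fun y => ‖ψ y‖ₑ) x := by
    intro ψ hψ
    rw [hweak ψ hψ]
    exact hdual lam hlam hm hlI f hf ψ
  -- The inequality of integrals over every measurable S localizes to an a.e. inequality; δ^γ is
  -- positive on Ω and cancels afterwards.
  have key : (fun x => ‖u x‖ₑ * ENNReal.ofReal (bdist Ω x ^ γ)) ≤ᵐ[volume.restrict Ω]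
      fun x => ENNReal.ofReal C * pot Ω s γ 1 (fun y => ‖f y‖ₑ) x *
        ENNReal.ofReal (bdist Ω x ^ γ) :=
    ae_le_of_forall_setLIntegral_le_of_sigmaFinite₀
      (hum.enorm.mul hδm.ennreal_ofReal.aemeasurable) fun S hS _ =>
        setLIntegral_mul_bdist_rpow_le hΩ hn hγ.1 hfm hu1 hd hS
  filter_upwards [key, ae_restrict_mem hΩ.isOpen.measurableSet] with x hx hxΩ
  have hp : ENNReal.ofReal (bdist Ω x ^ γ) ≠ 0 := by
    simpa using Real.rpow_pos_of_pos (hΩ.bdist_pos hn hxΩ) γ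
  exact (ENNReal.mul_le_mul_iff_left hp ENNReal.ofReal_ne_top).1 hx

/-- Since φ_j is O(δ^γ), it is itself an admissible test function, and the solution operator only
multiplies it by a scalar. -/
lemma IsEigenbasis.memPerp_of_isWeakSolution (hφ : IsEigenbasis Ω G ev φ)
    (hG : IsGreenFunction Ω s γ G) (hΩ : IsBoundedC11 Ω) (hn : 1 ≤ n) (hs : 0 < s)
    (hs2 : 2 * s < n) (hγ : γ ∈ Ioc (0 : ℝ) 1) {I : ℕ} (hI : ev I < ev (I + 1)) {lam : ℝ}
    (hlI : lam ≤ ev I) {f u : EuclideanSpace ℝ (Fin n) → ℝ} (hf : MemPerp Ω γ φ I f)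
    (hu : IsWeakSolution Ω γ ev φ lam f u) : MemPerp Ω γ φ I u := by
  refine ⟨hu.2.1, fun j hj => ?_⟩
  obtain ⟨M, hM⟩ := hφ.exists_abs_basis_le hG hΩ hn hs hs2 hγ j
  rw [hu.2.2 (φ j) ⟨M, hM⟩]
  have h : helmholtzOp ev φ lam (φ j) = (1 / (ev j - lam)) • (φ j : L2 Ω) := by
    refine φ.eq_of_forall_inner_eq fun k => ?_
    rw [hφ.inner_helmholtzOp hlI hI, inner_smul_right, φ.inner_eq_ite]
    split_ifs with h
    · subst h; ring
    · simp
  rw [h]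
  have h2 : ∫ x in Ω, f x * ((1 / (ev j - lam)) • (φ j : L2 Ω) : L2 Ω) x =
      ∫ x in Ω, 1 / (ev j - lam) * (f x * (φ j : L2 Ω) x) := by
    refine integral_congr_ae ?_
    filter_upwards [Lp.coeFn_smul (1 / (ev j - lam)) (φ j : L2 Ω)] with x hx
    rw [hx, Pi.smul_apply, smul_eq_mul]; ring
  rw [h2, integral_const_mul, hf.2 j hj, mul_zero]

end Duality

/-! ### Mapping properties of the potential -/

section Items

variable {n : ℕ} {Ω : Set (EuclideanSpace ℝ (Fin n))} {s γ : ℝ}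
  {G : EuclideanSpace ℝ (Fin n) → EuclideanSpace ℝ (Fin n) → ℝ}

/-- Hölder (or Jensen for the measure g dμ), splitting g as g^{1/p} g^{1-1/p}. -/
lemma lintegral_mul_rpow_le {α : Type*} [MeasurableSpace α] {μ : Measure α}
    {κ g : α → ENNReal} (hκ : AEMeasurable κ μ) (hg : AEMeasurable g μ) {p : ℝ} (hp : 1 ≤ p) :
    (∫⁻ y, κ y * g y ∂μ) ^ p ≤ (∫⁻ y, g y ∂μ) ^ (p - 1) * ∫⁻ y, κ y ^ p * g y ∂μ := by
  rcases hp.eq_or_lt with rfl | hp1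
  · simp
  have hp0 : 0 < p := by linarith
  have hconj : p.HolderConjugate (p / (p - 1)) := Real.HolderConjugate.conjExponent hp1
  have hq0 : 0 < p / (p - 1) := hconj.symm.pos
  have hadd : 1 / p + 1 / (p / (p - 1)) = 1 := by
    field_simp
    ring
  have hH := ENNReal.lintegral_mul_le_Lp_mul_Lq μ hconj (hκ.mul (hg.pow_const (1 / p)))
    (hg.pow_const (1 / (p / (p - 1))))
  have e1 : ∀ y, ((κ * fun y => g y ^ (1 / p)) * fun y => g y ^ (1 / (p / (p - 1)))) y =
      κ y * g y := fun y => by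
    simp only [Pi.mul_apply]
    rw [mul_assoc, ← ENNReal.rpow_add_of_nonneg _ _ (by positivity) (by positivity), hadd,
      ENNReal.rpow_one]
  have e2 : ∀ y, (κ * fun y => g y ^ (1 / p)) y ^ p = κ y ^ p * g y := fun y => by
    simp only [Pi.mul_apply]
    rw [ENNReal.mul_rpow_of_nonneg _ _ hp0.le, ← ENNReal.rpow_mul, one_div_mul_cancel hp0.ne',
      ENNReal.rpow_one]
  have e3 : ∀ y, (g y ^ (1 / (p / (p - 1)))) ^ (p / (p - 1)) = g y := fun y => by
    rw [← ENNReal.rpow_mul, one_div_mul_cancel hq0.ne', ENNReal.rpow_one]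
  simp only [e2, e3] at hH
  rw [lintegral_congr e1] at hH
  refine (ENNReal.rpow_le_rpow hH hp0.le).trans (le_of_eq ?_)
  rw [ENNReal.mul_rpow_of_nonneg _ _ hp0.le, ← ENNReal.rpow_mul, ← ENNReal.rpow_mul,
    one_div_mul_cancel hp0.ne', ENNReal.rpow_one, mul_comm]
  congr 2
  have : p - 1 ≠ 0 := by linarith
  field_simp

/-- The Riesz potential maps `L¹` to `L^p` below the critical exponent. -/
lemma exists_lintegral_rieszPotential_rpow_le (hΩ : IsBoundedC11 Ω) (hn : 1 ≤ n) {b p : ℝ}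
    (hp : 1 ≤ p) (hb : b * p < n) :
    ∃ C : ℝ, 0 < C ∧ ∀ g : EuclideanSpace ℝ (Fin n) → ENNReal,
      AEMeasurable g (volume.restrict Ω) →
      (∫⁻ x in Ω, (∫⁻ y in Ω, ENNReal.ofReal (‖x - y‖ ^ (-b)) * g y) ^ p) ^ (1 / p) ≤
        ENNReal.ofReal C * ∫⁻ y in Ω, g y := by
  have hp0 : 0 < p := by linarith
  obtain ⟨C, hC, hR⟩ := exists_lintegral_norm_sub_rpow_le hΩ hn hb
  refine ⟨C ^ (1 / p), by positivity, fun g hg => ?_⟩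
  have hκm : Measurable fun z : EuclideanSpace ℝ (Fin n) × EuclideanSpace ℝ (Fin n) =>
      ENNReal.ofReal (‖z.1 - z.2‖ ^ (-b)) := by fun_prop
  have hκp : Measurable fun z : EuclideanSpace ℝ (Fin n) × EuclideanSpace ℝ (Fin n) =>
      ENNReal.ofReal (‖z.1 - z.2‖ ^ (-(b * p))) := by fun_prop
  have hpow : ∀ x y : EuclideanSpace ℝ (Fin n), ENNReal.ofReal (‖x - y‖ ^ (-b)) ^ p =
      ENNReal.ofReal (‖x - y‖ ^ (-(b * p))) := fun x y => by
    rw [ENNReal.ofReal_rpow_of_nonneg (by positivity) hp0.le, ← Real.rpow_mul (norm_nonneg _),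
      neg_mul]
  have hm2 : AEMeasurable (Function.uncurry fun x y : EuclideanSpace ℝ (Fin n) =>
      ENNReal.ofReal (‖x - y‖ ^ (-(b * p))) * g y)
      ((volume.restrict Ω).prod (volume.restrict Ω)) :=
    hκp.aemeasurable.mul hg.comp_snd
  -- Genuine measurability is obtained from a measurable representative of g: the factor (∫ g)^{p-1}
  -- to be pulled out below may be infinite.
  have hm3 : Measurable fun x => ∫⁻ y in Ω, ENNReal.ofReal (‖x - y‖ ^ (-(b * p))) * hg.mk g y :=
    Measurable.lintegral_prod_right (hκp.mul (hg.measurable_mk.comp measurable_snd))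
  have hm4 : Measurable fun x => ∫⁻ y in Ω, ENNReal.ofReal (‖x - y‖ ^ (-(b * p))) * g y := by
    convert hm3 using 2 with x
    refine lintegral_congr_ae ?_
    filter_upwards [hg.ae_eq_mk] with y hy
    rw [hy]
  have hmain : ∫⁻ x in Ω, (∫⁻ y in Ω, ENNReal.ofReal (‖x - y‖ ^ (-b)) * g y) ^ p ≤
      ENNReal.ofReal C * (∫⁻ y in Ω, g y) ^ p := by
    calc _ ≤ ∫⁻ x in Ω, (∫⁻ y in Ω, g y) ^ (p - 1) *
          ∫⁻ y in Ω, ENNReal.ofReal (‖x - y‖ ^ (-(b * p))) * g y := by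
          refine lintegral_mono fun x => ?_
          have := lintegral_mul_rpow_le (hκm.comp (measurable_prodMk_left (x := x))).aemeasurable
            hg hp
          simp only [Function.comp_def, hpow] at this
          exact this
      _ = (∫⁻ y in Ω, g y) ^ (p - 1) *
          ∫⁻ y in Ω, ∫⁻ x in Ω, ENNReal.ofReal (‖x - y‖ ^ (-(b * p))) * g y := by
          rw [lintegral_const_mul _ hm4, lintegral_lintegral_swap hm2]
      _ ≤ (∫⁻ y in Ω, g y) ^ (p - 1) * ∫⁻ y in Ω, ENNReal.ofReal C * g y := by
          refine mul_le_mul_right (setLIntegral_mono' hΩ.isOpen.measurableSet fun y hy => ?_) _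
          have hm5 : Measurable fun x : EuclideanSpace ℝ (Fin n) =>
            ENNReal.ofReal (‖x - y‖ ^ (-(b * p))) := by fun_prop
          rw [lintegral_mul_const _ hm5]
          have := hR y hy
          simp only [norm_sub_rev y] at this
          exact mul_le_mul_left this _
      _ = _ := by
          have : (∫⁻ y in Ω, g y) ^ p = (∫⁻ y in Ω, g y) ^ (p - 1) * ∫⁻ y in Ω, g y := by
            conv_rhs => rw [← ENNReal.rpow_one (∫⁻ y in Ω, g y), ← ENNReal.rpow_mul,
              ← ENNReal.rpow_add_of_nonneg _ _ (by linarith) zero_le_one]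
            congr 1; ring
          rw [lintegral_const_mul' _ _ ENNReal.ofReal_ne_top, this]
          ring
  refine (ENNReal.rpow_le_rpow hmain (by positivity)).trans (le_of_eq ?_)
  rw [ENNReal.mul_rpow_of_nonneg _ _ (by positivity), ← ENNReal.rpow_mul,
    mul_one_div_cancel hp0.ne', ENNReal.rpow_one,
    ENNReal.ofReal_rpow_of_nonneg hC.le (by positivity)]

lemma potKernel_one_le_norm_rpow (hΩ : IsBoundedC11 Ω) (hn : 1 ≤ n) (hγ : γ ∈ Ioc (0 : ℝ) 1)
    {x y : EuclideanSpace ℝ (Fin n)} (hx : x ∈ Ω) (hy : y ∈ Ω) (hxy : x ≠ y) :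
    potKernel Ω s γ 1 x y ≤ ‖x - y‖ ^ (-((n : ℝ) - 2 * s)) :=
  (potKernel_le_modelKernel hΩ hn hγ hx hy hxy).trans (modelKernel_le_norm_rpow x y)

/-- The boundary factor at x is dropped and the one at y kept. This extracts the weight δ^γ(y) and
raises the singularity to n - 2s + γ, which sets the critical exponent of the last estimate. -/
lemma potKernel_one_le_norm_rpow_mul (hΩ : IsBoundedC11 Ω) (hn : 1 ≤ n)
    (hγ : γ ∈ Ioc (0 : ℝ) 1)
    {x y : EuclideanSpace ℝ (Fin n)} (hx : x ∈ Ω) (hy : y ∈ Ω) (hxy : x ≠ y) :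
    potKernel Ω s γ 1 x y ≤ ‖x - y‖ ^ (-((n : ℝ) - 2 * s + γ)) * bdist Ω y ^ γ := by
  have hr : 0 < ‖x - y‖ := norm_pos_iff.2 (sub_ne_zero.2 hxy)
  refine (potKernel_le_modelKernel hΩ hn hγ hx hy hxy).trans ?_
  have h : ∀ a : ℝ, 0 ≤ a → 0 ≤ min (a ^ γ / ‖x - y‖ ^ γ) 1 :=
    fun a ha => le_min (by positivity) zero_le_one
  have hδ := bdist_nonneg (Ω := Ω) y
  have h0 : (0 : ℝ) ≤ 1 / ‖x - y‖ ^ ((n : ℝ) - 2 * s) := by positivity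
  calc modelKernel Ω s γ x y ≤ 1 / ‖x - y‖ ^ ((n : ℝ) - 2 * s) * 1 *
        (bdist Ω y ^ γ / ‖x - y‖ ^ γ) := by
        refine mul_le_mul (mul_le_mul_of_nonneg_left (min_le_right _ _) h0) (min_le_left _ _)
          (h _ hδ) (by positivity)
    _ = _ := by
        rw [neg_add, Real.rpow_add hr, Real.rpow_neg hr.le, Real.rpow_neg hr.le]
        field_simp

lemma pot_one_le (hΩ : IsBoundedC11 Ω) (hn : 1 ≤ n)
    {k w : EuclideanSpace ℝ (Fin n) → EuclideanSpace ℝ (Fin n) → ENNReal}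
    (h : ∀ x ∈ Ω, ∀ y ∈ Ω, x ≠ y → ENNReal.ofReal (potKernel Ω s γ 1 x y) ≤ k x y * w x y)
    (g : EuclideanSpace ℝ (Fin n) → ENNReal) {x : EuclideanSpace ℝ (Fin n)} (hx : x ∈ Ω) :
    pot Ω s γ 1 g x ≤ ∫⁻ y in Ω, k x y * (w x y * g y) := by
  refine lintegral_mono_ae ?_
  filter_upwards [ae_mem_and_ne hΩ hn x] with y hy
  rw [← mul_assoc]
  exact mul_le_mul_left (h x hx y hy.1 hy.2) _

lemma eLpNorm_ofReal_eq {p : ℝ} (hp : 0 < p) (u : EuclideanSpace ℝ (Fin n) → ℝ) :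
    eLpNorm u (ENNReal.ofReal p) (volume.restrict Ω) =
      (∫⁻ x in Ω, ‖u x‖ₑ ^ p) ^ (1 / p) := by
  rw [eLpNorm_eq_lintegral_rpow_enorm_toReal (by simpa using hp) ENNReal.ofReal_ne_top,
    ENNReal.toReal_ofReal hp.le]

/-- `L^p` bounds for functions dominated by a Riesz potential of a weighted `L¹` function. -/
lemma exists_eLpNorm_le_lintegral (hΩ : IsBoundedC11 Ω) (hn : 1 ≤ n) {b p : ℝ}
    (hp : 1 ≤ p) (hb : b * p < n) {w : EuclideanSpace ℝ (Fin n) → ENNReal} (hw : Measurable w)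
    (h : ∀ x ∈ Ω, ∀ y ∈ Ω, x ≠ y → ENNReal.ofReal (potKernel Ω s γ 1 x y) ≤
      ENNReal.ofReal (‖x - y‖ ^ (-b)) * w y) (C : ℝ) :
    ∃ K : ℝ, ∀ f u : EuclideanSpace ℝ (Fin n) → ℝ, AEMeasurable f (volume.restrict Ω) →
      (∀ᵐ x ∂(volume.restrict Ω),
        ‖u x‖ₑ ≤ ENNReal.ofReal C * pot Ω s γ 1 (fun y => ‖f y‖ₑ) x) →
      eLpNorm u (ENNReal.ofReal p) (volume.restrict Ω) ≤
        ENNReal.ofReal K * ∫⁻ y in Ω, w y * ‖f y‖ₑ := by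
  have hp0 : 0 < p := by linarith
  obtain ⟨K, hK, hR⟩ := exists_lintegral_rieszPotential_rpow_le hΩ hn hp hb
  refine ⟨K * max C 0, fun f u hf hu => ?_⟩
  rw [eLpNorm_ofReal_eq hp0]
  calc (∫⁻ x in Ω, ‖u x‖ₑ ^ p) ^ (1 / p)
      ≤ (∫⁻ x in Ω, ENNReal.ofReal C ^ p * (∫⁻ y in Ω, ENNReal.ofReal (‖x - y‖ ^ (-b)) *
          (w y * ‖f y‖ₑ)) ^ p) ^ (1 / p) := by
        refine ENNReal.rpow_le_rpow (lintegral_mono_ae ?_) (by positivity)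
        filter_upwards [hu, ae_restrict_mem hΩ.isOpen.measurableSet] with x hx hxΩ
        rw [← ENNReal.mul_rpow_of_nonneg _ _ hp0.le]
        refine ENNReal.rpow_le_rpow (hx.trans (mul_le_mul_right ?_ _)) hp0.le
        exact pot_one_le hΩ hn (w := fun _ y => w y) h _ hxΩ
    _ = ENNReal.ofReal C * (∫⁻ x in Ω, (∫⁻ y in Ω, ENNReal.ofReal (‖x - y‖ ^ (-b)) *
          (w y * ‖f y‖ₑ)) ^ p) ^ (1 / p) := by
        rw [lintegral_const_mul' _ _ (ENNReal.rpow_ne_top_of_nonneg hp0.le ENNReal.ofReal_ne_top),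
          ENNReal.mul_rpow_of_nonneg _ _ (by positivity), ← ENNReal.rpow_mul,
          mul_one_div_cancel hp0.ne', ENNReal.rpow_one]
    _ ≤ ENNReal.ofReal C * (ENNReal.ofReal K * ∫⁻ y in Ω, w y * ‖f y‖ₑ) :=
        mul_le_mul_right (hR _ (hw.aemeasurable.mul hf.enorm)) _
    _ = _ := by
        have : ENNReal.ofReal C = ENNReal.ofReal (max C 0) := by simp
        rw [ENNReal.ofReal_mul hK.le, this]; ring

/-- The Hardy–Littlewood–Sobolev bound for functions dominated by the potential. -/
lemma exists_eLpNorm_le_eLpNorm (hΩ : IsBoundedC11 Ω) (hn : 1 ≤ n) (hs : 0 < s)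
    (hγ : γ ∈ Ioc (0 : ℝ) 1) {p q : ℝ} (hp : 1 < p) (hpn : p < n / (2 * s))
    (hq : 1 / q = 1 / p - 2 * s / n) {C : ℝ} (hC : 0 < C) :
    ∃ K : ℝ, ∀ f u : EuclideanSpace ℝ (Fin n) → ℝ, MemLp f (ENNReal.ofReal p) (volume.restrict Ω) →
      AEMeasurable u (volume.restrict Ω) →
      (∀ᵐ x ∂(volume.restrict Ω),
        ‖u x‖ₑ ≤ ENNReal.ofReal C * pot Ω s γ 1 (fun y => ‖f y‖ₑ) x) →
      eLpNorm u (ENNReal.ofReal q) (volume.restrict Ω) ≤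
        ENNReal.ofReal K * eLpNorm f (ENNReal.ofReal p) (volume.restrict Ω) := by
  have hp0 : 0 < p := by linarith
  have hn0 : (0 : ℝ) < n := by exact_mod_cast hn
  have hq0 : 0 < q := by
    have : 0 < 1 / q := by
      rw [hq, sub_pos, div_lt_div_iff₀ hn0 hp0]
      rw [lt_div_iff₀ (by positivity)] at hpn
      linarith
    simpa using this
  obtain ⟨K, hK, hHLS⟩ := exists_lintegral_rpow_le_of_le_rieszPotential hn (σ := 2 * s)
    (by positivity) hp hpn hq
  refine ⟨C * K ^ (1 / q), fun f u hf hu hfu => ?_⟩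
  have hΩm : MeasurableSet Ω := hΩ.isOpen.measurableSet
  have hfm : AEMeasurable f (volume.restrict Ω) := hf.1.aemeasurable
  have hfin := hf.2
  -- The Hardy–Littlewood–Sobolev bound is available for normalized functions, so f = 0 a.e. is
  -- treated apart.
  rcases eq_or_ne (eLpNorm f (ENNReal.ofReal p) (volume.restrict Ω)) 0 with h0 | h0
  · rw [eLpNorm_eq_zero_iff hf.1 (by simpa using hp0)] at h0
    have hu0 : u =ᵐ[volume.restrict Ω] 0 := by
      filter_upwards [hfu] with x hx
      have : pot Ω s γ 1 (fun y => ‖f y‖ₑ) x = 0 := by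
        rw [pot, ← lintegral_zero (μ := volume.restrict Ω)]
        refine lintegral_congr_ae ?_
        filter_upwards [h0] with y hy
        simp [hy]
      rw [this, mul_zero] at hx
      simpa using hx
    rw [eLpNorm_congr_ae hu0, eLpNorm_zero]
    exact zero_le
  set A := (eLpNorm f (ENNReal.ofReal p) (volume.restrict Ω)).toReal with hA
  have hA0 : 0 < A := ENNReal.toReal_pos h0 hfin.ne
  have hAe : eLpNorm f (ENNReal.ofReal p) (volume.restrict Ω) = ENNReal.ofReal A :=
    (ENNReal.ofReal_toReal hfin.ne).symm
  -- Normalization by the norm A of f, extended by zero off Ω and made measurable. Correspondingly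
  -- |u| is divided by C A below.
  set F : EuclideanSpace ℝ (Fin n) → ℝ := Ω.indicator fun y => |hfm.mk f y| / A with hF
  have hFm : Measurable F :=
    ((continuous_abs.measurable.comp hfm.measurable_mk).div_const A).indicator hΩm
  have hFe : ∀ᵐ y ∂(volume.restrict Ω), ENNReal.ofReal (F y) = ENNReal.ofReal A⁻¹ * ‖f y‖ₑ := by
    filter_upwards [hfm.ae_eq_mk, ae_restrict_mem hΩm] with y hy hyΩ
    rw [hF, indicator_of_mem hyΩ, ← hy, div_eq_inv_mul, ENNReal.ofReal_mul (by positivity),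
      Real.enorm_eq_ofReal_abs]
  have hF0 : ∀ y ∉ Ω, F y = 0 := fun y hy => indicator_of_notMem hy _
  have hFnorm : ∫⁻ y, ENNReal.ofReal (F y) ^ p ≤ 1 := by
    have e1 : ∫⁻ y, ENNReal.ofReal (F y) ^ p = ∫⁻ y in Ω, ENNReal.ofReal (F y) ^ p := by
      rw [← lintegral_indicator hΩm]
      congr 1; ext y
      by_cases hy : y ∈ Ω
      · rw [indicator_of_mem hy]
      · rw [indicator_of_notMem hy, hF0 y hy, ENNReal.ofReal_zero, ENNReal.zero_rpow_of_pos hp0]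
    have e2 : ∫⁻ y in Ω, ENNReal.ofReal (F y) ^ p =
        ENNReal.ofReal A⁻¹ ^ p * ∫⁻ y in Ω, ‖f y‖ₑ ^ p := by
      rw [← lintegral_const_mul' _ _ (ENNReal.rpow_ne_top_of_nonneg hp0.le ENNReal.ofReal_ne_top)]
      refine lintegral_congr_ae ?_
      filter_upwards [hFe] with y hy
      rw [hy, ENNReal.mul_rpow_of_nonneg _ _ hp0.le]
    have e3 : ∫⁻ y in Ω, ‖f y‖ₑ ^ p = ENNReal.ofReal A ^ p := by
      rw [← hAe, eLpNorm_ofReal_eq hp0, ← ENNReal.rpow_mul, one_div_mul_cancel hp0.ne',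
        ENNReal.rpow_one]
    rw [e1, e2, e3, ← ENNReal.mul_rpow_of_nonneg _ _ hp0.le, ← ENNReal.ofReal_mul (by positivity),
      inv_mul_cancel₀ hA0.ne']
    simp
  set U : EuclideanSpace ℝ (Fin n) → ℝ := Ω.indicator fun x => |u x| / (C * A) with hU
  have hUm : AEMeasurable U :=
    (aemeasurable_indicator_iff hΩm).2 ((continuous_abs.measurable.comp_aemeasurable hu).div_const _)
  have hU0 : ∀ x, 0 ≤ U x := fun x => by
    by_cases hx : x ∈ Ω
    · rw [hU, indicator_of_mem hx]; positivity
    · rw [hU, indicator_of_notMem hx]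
  have hUT : ∀ᵐ x, ENNReal.ofReal (U x) ≤
      ∫⁻ y, ENNReal.ofReal (‖x - y‖ ^ (-((n : ℝ) - 2 * s))) * ENNReal.ofReal (F y) := by
    have h1 := (ae_restrict_iff' hΩm).1 hfu
    filter_upwards [h1] with x hx
    by_cases hxΩ : x ∈ Ω
    · rw [hU, indicator_of_mem hxΩ, div_eq_inv_mul, ENNReal.ofReal_mul (by positivity),
        ← Real.enorm_eq_ofReal_abs]
      have h2 : pot Ω s γ 1 (fun y => ‖f y‖ₑ) x ≤ ∫⁻ y in Ω,
          ENNReal.ofReal (‖x - y‖ ^ (-((n : ℝ) - 2 * s))) * (1 * ‖f y‖ₑ) :=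
        pot_one_le hΩ hn (k := fun x y => ENNReal.ofReal (‖x - y‖ ^ (-((n : ℝ) - 2 * s))))
          (w := fun _ _ => 1) (fun x hx y hy hxy => by
            rw [mul_one]
            exact ENNReal.ofReal_le_ofReal (potKernel_one_le_norm_rpow hΩ hn hγ hx hy hxy)) _ hxΩ
      calc ENNReal.ofReal (C * A)⁻¹ * ‖u x‖ₑ
          ≤ ENNReal.ofReal (C * A)⁻¹ * (ENNReal.ofReal C * ∫⁻ y in Ω,
            ENNReal.ofReal (‖x - y‖ ^ (-((n : ℝ) - 2 * s))) * (1 * ‖f y‖ₑ)) :=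
            mul_le_mul_right ((hx hxΩ).trans (mul_le_mul_right h2 _)) _
        _ = ∫⁻ y in Ω, ENNReal.ofReal (‖x - y‖ ^ (-((n : ℝ) - 2 * s))) *
            ENNReal.ofReal (F y) := by
            rw [← mul_assoc, ← ENNReal.ofReal_mul (by positivity),
              show (C * A)⁻¹ * C = A⁻¹ by field_simp,
              ← lintegral_const_mul' _ _ ENNReal.ofReal_ne_top]
            refine lintegral_congr_ae ?_
            filter_upwards [hFe] with y hy
            rw [hy]; ring
        _ ≤ _ := setLIntegral_le_lintegral _ _
    · rw [hU, indicator_of_notMem hxΩ, ENNReal.ofReal_zero]; exact zero_le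
  have hres := hHLS F hFm hFnorm U hUm (ae_of_all _ hU0) hUT
  have hconv : ∫⁻ x in Ω, ‖u x‖ₑ ^ q ≤ ENNReal.ofReal (C * A) ^ q * ENNReal.ofReal K := by
    calc ∫⁻ x in Ω, ‖u x‖ₑ ^ q
        = ∫⁻ x in Ω, ENNReal.ofReal (C * A) ^ q * ENNReal.ofReal (U x ^ q) := by
          refine setLIntegral_congr_fun hΩm fun x hx => ?_
          rw [← ENNReal.ofReal_rpow_of_nonneg (hU0 x) hq0.le,
            ← ENNReal.mul_rpow_of_nonneg _ _ hq0.le, ← ENNReal.ofReal_mul (by positivity),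
            Real.enorm_eq_ofReal_abs, hU, indicator_of_mem hx]
          congr 2
          field_simp
      _ = ENNReal.ofReal (C * A) ^ q * ∫⁻ x in Ω, ENNReal.ofReal (U x ^ q) :=
          lintegral_const_mul' _ _ (ENNReal.rpow_ne_top_of_nonneg hq0.le ENNReal.ofReal_ne_top)
      _ ≤ _ := mul_le_mul_right ((setLIntegral_le_lintegral _ _).trans hres) _
  rw [eLpNorm_ofReal_eq hq0, hAe]
  refine (ENNReal.rpow_le_rpow hconv (by positivity)).trans (le_of_eq ?_)
  rw [ENNReal.mul_rpow_of_nonneg _ _ (by positivity), ← ENNReal.rpow_mul,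
    mul_one_div_cancel hq0.ne', ENNReal.rpow_one, ENNReal.ofReal_rpow_of_nonneg hK.le
    (by positivity), ← ENNReal.ofReal_mul (by positivity), ← ENNReal.ofReal_mul (by positivity)]
  congr 1; ring

/-- For fixed x the integrand is at most δ(x)^{-γ} |x-y|^{2s-n} δ(y)^{γ+α}. Away from x the Riesz
factor is bounded and γ + α > -1 gives integrability; near x the factor δ(y)^{γ+α} is bounded and
the Riesz kernel is integrable. -/
lemma pot_one_bdist_rpow_lt_top (hΩ : IsBoundedC11 Ω) (hn : 1 ≤ n) (hs : 0 < s)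
    (hs2 : 2 * s < n) (hγ : 0 < γ) {α : ℝ} (hα : -1 - γ < α)
    {x : EuclideanSpace ℝ (Fin n)} (hx : x ∈ Ω) :
    pot Ω s γ 1 (fun y => ENNReal.ofReal (bdist Ω y ^ α)) x < ⊤ := by
  obtain ⟨C, hC, hR⟩ := exists_lintegral_norm_sub_rpow_le hΩ hn
    (show (n : ℝ) - 2 * s < n by linarith)
  have hxp := hΩ.bdist_pos hn hx
  set a := bdist Ω x with ha
  set K₁ : ℝ := a ^ (-γ) * (a / 2) ^ (-((n : ℝ) - 2 * s)) with hK₁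
  -- For |x-y| ≤ a/2 the value δ(y) lies in [a/2, 2a]; the maximum covers both signs of γ + α.
  set K₂ : ℝ := a ^ (-γ) * max ((a / 2) ^ (γ + α)) ((2 * a) ^ (γ + α)) with hK₂
  have hK₁0 : 0 ≤ K₁ := by positivity
  have hK₂0 : 0 ≤ K₂ := mul_nonneg (by positivity) (le_max_of_le_left (by positivity))
  have hpt : ∀ y ∈ Ω, x ≠ y → ENNReal.ofReal (potKernel Ω s γ 1 x y) *
      ENNReal.ofReal (bdist Ω y ^ α) ≤ ENNReal.ofReal K₁ * ENNReal.ofReal (bdist Ω y ^ (γ + α)) +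
        ENNReal.ofReal K₂ * ENNReal.ofReal (‖x - y‖ ^ (-((n : ℝ) - 2 * s))) := by
    intro y hy hxy
    have hyp := hΩ.bdist_pos hn hy
    have hr : 0 < ‖x - y‖ := norm_pos_iff.2 (sub_ne_zero.2 hxy)
    have hM := maxDist_pos (Ω := Ω) hxy
    have haM : a ≤ maxDist Ω x y := le_max_of_le_right (le_max_left _ _)
    rw [← ENNReal.ofReal_mul (potKernel_nonneg _ _), ← ENNReal.ofReal_mul hK₁0,
      ← ENNReal.ofReal_mul hK₂0, ← ENNReal.ofReal_add (by positivity) (by positivity)]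
    refine ENNReal.ofReal_le_ofReal ?_
    have h1 : potKernel Ω s γ 1 x y * bdist Ω y ^ α ≤
        a ^ (-γ) * (‖x - y‖ ^ (-((n : ℝ) - 2 * s)) * bdist Ω y ^ (γ + α)) := by
      have h2 : maxDist Ω x y ^ (-(2 * γ)) ≤ a ^ (-(2 * γ)) :=
        Real.rpow_le_rpow_of_nonpos hxp haM (by linarith)
      have e : a ^ (-γ) = a ^ γ * a ^ (-(2 * γ)) := by
        rw [← Real.rpow_add hxp]; congr 1; ring
      rw [potKernel, quasiDist, Real.mul_rpow (by positivity) (by positivity),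
        ← Real.rpow_mul hr.le, ← Real.rpow_mul hM.le, mul_neg_one, mul_neg_one,
        Real.rpow_add hyp, e]
      calc _ = a ^ γ * maxDist Ω x y ^ (-(2 * γ)) * (‖x - y‖ ^ (-((n : ℝ) - 2 * s)) *
            (bdist Ω y ^ γ * bdist Ω y ^ α)) := by ring
        _ ≤ _ := by gcongr
    refine h1.trans ?_
    rcases le_total (a / 2) ‖x - y‖ with hfar | hnear
    · have h3 : ‖x - y‖ ^ (-((n : ℝ) - 2 * s)) ≤ (a / 2) ^ (-((n : ℝ) - 2 * s)) :=
        Real.rpow_le_rpow_of_nonpos (by positivity) hfar (by linarith)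
      calc _ ≤ a ^ (-γ) * ((a / 2) ^ (-((n : ℝ) - 2 * s)) * bdist Ω y ^ (γ + α)) := by gcongr
        _ = K₁ * bdist Ω y ^ (γ + α) := by rw [hK₁]; ring
        _ ≤ _ := le_add_of_nonneg_right (by positivity)
    · have h4 := bdist_le_add (Ω := Ω) x y
      have h5 := bdist_le_add (Ω := Ω) y x
      rw [norm_sub_rev] at h5
      have h6 : bdist Ω y ^ (γ + α) ≤ max ((a / 2) ^ (γ + α)) ((2 * a) ^ (γ + α)) := by
        rcases le_total 0 (γ + α) with h | h
        · exact le_max_of_le_right (Real.rpow_le_rpow hyp.le (by linarith) h)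
        · exact le_max_of_le_left (Real.rpow_le_rpow_of_nonpos (by positivity) (by linarith) h)
      calc _ ≤ a ^ (-γ) * (‖x - y‖ ^ (-((n : ℝ) - 2 * s)) *
            max ((a / 2) ^ (γ + α)) ((2 * a) ^ (γ + α))) := by gcongr
        _ = K₂ * ‖x - y‖ ^ (-((n : ℝ) - 2 * s)) := by rw [hK₂]; ring
        _ ≤ _ := le_add_of_nonneg_left (by positivity)
  have hm : Measurable fun y => ENNReal.ofReal K₁ * ENNReal.ofReal (bdist Ω y ^ (γ + α)) :=
    ((continuous_bdist.measurable.pow_const _).ennreal_ofReal).const_mul _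
  calc pot Ω s γ 1 (fun y => ENNReal.ofReal (bdist Ω y ^ α)) x
      ≤ ∫⁻ y in Ω, (ENNReal.ofReal K₁ * ENNReal.ofReal (bdist Ω y ^ (γ + α)) +
        ENNReal.ofReal K₂ * ENNReal.ofReal (‖x - y‖ ^ (-((n : ℝ) - 2 * s)))) := by
        refine lintegral_mono_ae ?_
        filter_upwards [ae_mem_and_ne hΩ hn x] with y hy
        exact hpt y hy.1 hy.2
    _ = ENNReal.ofReal K₁ * (∫⁻ y in Ω, ENNReal.ofReal (bdist Ω y ^ (γ + α))) +
        ENNReal.ofReal K₂ * ∫⁻ y in Ω, ENNReal.ofReal (‖x - y‖ ^ (-((n : ℝ) - 2 * s))) := by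
        rw [lintegral_add_left hm, lintegral_const_mul' _ _ ENNReal.ofReal_ne_top,
          lintegral_const_mul' _ _ ENNReal.ofReal_ne_top]
    _ < ⊤ := ENNReal.add_lt_top.2 ⟨ENNReal.mul_lt_top ENNReal.ofReal_lt_top
        (hΩ.lintegral_bdist_rpow_lt_top hn (by linarith)),
        ENNReal.mul_lt_top ENNReal.ofReal_lt_top ((hR x hx).trans_lt ENNReal.ofReal_lt_top)⟩

/-- The potential of `δ^α` is bounded by its Green potential. -/
lemma IsGreenFunction.exists_pot_bdist_rpow_le (hG : IsGreenFunction Ω s γ G)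
    (hΩ : IsBoundedC11 Ω) (hn : 1 ≤ n) (hs : 0 < s) (hs2 : 2 * s < n) (hγ : γ ∈ Ioc (0 : ℝ) 1) :
    ∃ c : ℝ, 0 < c ∧ ∀ α : ℝ, -1 - γ < α → ∀ᵐ x ∂(volume.restrict Ω),
      0 ≤ greenOp Ω G (fun y => bdist Ω y ^ α) x ∧
      pot Ω s γ 1 (fun y => ENNReal.ofReal (bdist Ω y ^ α)) x ≤
        ENNReal.ofReal c * ENNReal.ofReal (greenOp Ω G (fun y => bdist Ω y ^ α) x) := by
  obtain ⟨c, hc, hcG⟩ := hG.exists_bounds hΩ hn hγ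
  refine ⟨c, hc, fun α hα => ?_⟩
  have hδm : AEStronglyMeasurable (fun y => bdist Ω y ^ α) (volume.restrict Ω) :=
    (continuous_bdist.measurable.pow_const α).aestronglyMeasurable
  filter_upwards [(hG.aestronglyMeasurable_mul hδm).prodMk_left,
    ae_restrict_mem hΩ.isOpen.measurableSet] with x hxm hx
  have hδ : ∀ y, 0 ≤ bdist Ω y ^ α := fun y => Real.rpow_nonneg (bdist_nonneg y) α
  have hnn : ∀ᵐ y ∂(volume.restrict Ω), 0 ≤ G x y * bdist Ω y ^ α := by
    filter_upwards [ae_mem_and_ne hΩ hn x] with y hy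
    exact mul_nonneg (hcG x hx y hy.1 hy.2).1 (hδ y)
  -- Without integrability the Bochner integral defining the Green potential would be 0 and could
  -- not dominate the potential.
  have hint : Integrable (fun y => G x y * bdist Ω y ^ α) (volume.restrict Ω) := by
    refine ⟨hxm, ?_⟩
    rw [hasFiniteIntegral_iff_enorm]
    refine lt_of_le_of_lt ?_ (ENNReal.mul_lt_top (ENNReal.ofReal_lt_top (r := c))
      (pot_one_bdist_rpow_lt_top hΩ hn hs hs2 hγ.1 hα hx))
    rw [pot, ← lintegral_const_mul' _ _ ENNReal.ofReal_ne_top]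
    refine lintegral_mono_ae ?_
    filter_upwards [ae_mem_and_ne hΩ hn x] with y hy
    obtain ⟨h1, -, h2, -⟩ := hcG x hx y hy.1 hy.2
    rw [Real.enorm_of_nonneg (mul_nonneg h1 (hδ y)), ← ENNReal.ofReal_mul (potKernel_nonneg _ _),
      ← ENNReal.ofReal_mul hc.le, ← mul_assoc]
    exact ENNReal.ofReal_le_ofReal (mul_le_mul_of_nonneg_right h2 (hδ y))
  refine ⟨integral_nonneg_of_ae hnn, ?_⟩
  rw [greenOp, ofReal_integral_eq_lintegral_ofReal hint hnn, pot,
    ← lintegral_const_mul' _ _ ENNReal.ofReal_ne_top]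
  refine lintegral_mono_ae ?_
  filter_upwards [ae_mem_and_ne hΩ hn x] with y hy
  obtain ⟨h1, h2, -⟩ := hcG x hx y hy.1 hy.2
  rw [← ENNReal.ofReal_mul (potKernel_nonneg _ _), ← ENNReal.ofReal_mul hc.le, ← mul_assoc]
  exact ENNReal.ofReal_le_ofReal (mul_le_mul_of_nonneg_right h2 (hδ y))

/-- Weighted `L¹` bounds for functions dominated by the potential. -/
lemma IsGreenFunction.exists_integral_mul_bdist_rpow_le (hG : IsGreenFunction Ω s γ G)
    (hΩ : IsBoundedC11 Ω) (hn : 1 ≤ n) (hs : 0 < s) (hs2 : 2 * s < n) (hγ : γ ∈ Ioc (0 : ℝ) 1)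
    {C : ℝ} (hC : 0 < C) :
    ∃ K : ℝ, ∀ f u : EuclideanSpace ℝ (Fin n) → ℝ, AEMeasurable f (volume.restrict Ω) →
      AEMeasurable u (volume.restrict Ω) →
      (∀ᵐ x ∂(volume.restrict Ω),
        ‖u x‖ₑ ≤ ENNReal.ofReal C * pot Ω s γ 1 (fun y => ‖f y‖ₑ) x) →
      ∀ α : ℝ, -1 - γ < α → MemWeightedL1 Ω (greenOp Ω G fun x => bdist Ω x ^ α) f →
        MemWeightedL1 Ω (fun x => bdist Ω x ^ α) u ∧
          ∫ x in Ω, |u x| * bdist Ω x ^ α ≤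
            K * ∫ x in Ω, |f x| * greenOp Ω G (fun y => bdist Ω y ^ α) x := by
  obtain ⟨c, hc, hpot⟩ := hG.exists_pot_bdist_rpow_le hΩ hn hs hs2 hγ
  -- C comes from the domination of u and c from comparing the kernels; neither depends on α.
  refine ⟨C * c, fun f u hf hu hfu α hα hfα => ?_⟩
  have hδm : Measurable fun y => bdist Ω y ^ α := continuous_bdist.measurable.pow_const α
  have hδ : ∀ y, 0 ≤ bdist Ω y ^ α := fun y => Real.rpow_nonneg (bdist_nonneg y) α
  set g := greenOp Ω G (fun y => bdist Ω y ^ α) with hg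
  have hp := hpot α hα
  have hnn : ∀ᵐ x ∂(volume.restrict Ω), 0 ≤ |f x| * g x := by
    filter_upwards [hp] with x hx
    exact mul_nonneg (abs_nonneg _) hx.1
  have hfi : Integrable (fun x => |f x| * g x) (volume.restrict Ω) := by
    have h1 : Integrable (fun x => f x * g x) (volume.restrict Ω) := hfα
    refine h1.norm.congr ?_
    filter_upwards [hp] with x hx
    rw [norm_mul, Real.norm_eq_abs, Real.norm_of_nonneg hx.1]
  have hkey : ∫⁻ x in Ω, ‖u x‖ₑ * ENNReal.ofReal (bdist Ω x ^ α) ≤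
      ENNReal.ofReal (C * c * ∫ x in Ω, |f x| * g x) := by
    calc ∫⁻ x in Ω, ‖u x‖ₑ * ENNReal.ofReal (bdist Ω x ^ α)
        ≤ ∫⁻ x in Ω, ENNReal.ofReal C * (pot Ω s γ 1 (fun y => ‖f y‖ₑ) x *
          ENNReal.ofReal (bdist Ω x ^ α)) := by
          refine lintegral_mono_ae ?_
          filter_upwards [hfu] with x hx
          rw [← mul_assoc]
          exact mul_le_mul_left hx _
      _ = ENNReal.ofReal C * ∫⁻ x in Ω, ‖f x‖ₑ *
          pot Ω s γ 1 (fun y => ENNReal.ofReal (bdist Ω y ^ α)) x := by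
          rw [lintegral_const_mul' _ _ ENNReal.ofReal_ne_top,
            lintegral_mul_pot hδm.ennreal_ofReal.aemeasurable hf.enorm]
      _ ≤ ENNReal.ofReal C * ∫⁻ x in Ω, ENNReal.ofReal c * ENNReal.ofReal (|f x| * g x) := by
          refine mul_le_mul_right (lintegral_mono_ae ?_) _
          filter_upwards [hp] with x hx
          rw [ENNReal.ofReal_mul (abs_nonneg _), ← Real.enorm_eq_ofReal_abs]
          calc _ ≤ ‖f x‖ₑ * (ENNReal.ofReal c * ENNReal.ofReal (g x)) := mul_le_mul_right hx.2 _
            _ = _ := by ring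
      _ = _ := by
          rw [lintegral_const_mul' _ _ ENNReal.ofReal_ne_top,
            ← ofReal_integral_eq_lintegral_ofReal hfi hnn, ← mul_assoc,
            ← ENNReal.ofReal_mul hC.le, ← ENNReal.ofReal_mul (by positivity)]
  have he : ∀ x, ENNReal.ofReal (|u x| * bdist Ω x ^ α) =
      ‖u x‖ₑ * ENNReal.ofReal (bdist Ω x ^ α) := fun x => by
    rw [ENNReal.ofReal_mul (abs_nonneg _), Real.enorm_eq_ofReal_abs]
  have hui : Integrable (fun x => u x * bdist Ω x ^ α) (volume.restrict Ω) := by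
    refine ⟨(hu.mul hδm.aemeasurable).aestronglyMeasurable, ?_⟩
    rw [hasFiniteIntegral_iff_enorm]
    refine lt_of_le_of_lt (le_of_eq ?_) (hkey.trans_lt ENNReal.ofReal_lt_top)
    congr 1; ext x
    rw [enorm_mul, Real.enorm_of_nonneg (hδ x)]
  refine ⟨hui, ?_⟩
  have hui' : Integrable (fun x => |u x| * bdist Ω x ^ α) (volume.restrict Ω) := by
    refine hui.norm.congr (ae_of_all _ fun x => ?_)
    simp only
    rw [norm_mul, Real.norm_eq_abs, Real.norm_of_nonneg (hδ x)]
  have h0 : 0 ≤ C * c * ∫ x in Ω, |f x| * g x :=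
    mul_nonneg (by positivity) (integral_nonneg_of_ae hnn)
  rw [← ENNReal.ofReal_le_ofReal_iff h0, ofReal_integral_eq_lintegral_ofReal hui'
    (ae_of_all _ fun x => mul_nonneg (abs_nonneg _) (hδ x))]
  simp_rw [he]
  exact hkey

end Items

/-! ### Exclusion of the case n < 2s -/

section LowDimension

variable {n : ℕ} {Ω : Set (EuclideanSpace ℝ (Fin n))} {s γ : ℝ}
  {G : EuclideanSpace ℝ (Fin n) → EuclideanSpace ℝ (Fin n) → ℝ}
  {ev : ℕ → ℝ} {φ : HilbertBasis ℕ ℝ (L2 Ω)}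

/-- The Green operator is positive semidefinite. -/
lemma IsEigenbasis.integral_mul_greenOp_nonneg (hφ : IsEigenbasis Ω G ev φ)
    (hG : IsGreenFunction Ω s γ G) (hΩ : IsBoundedC11 Ω) (hn : 1 ≤ n) (hs : 0 < s)
    (hγ : γ ∈ Ioc (0 : ℝ) 1) {f : EuclideanSpace ℝ (Fin n) → ℝ}
    (hf : MemLp f 2 (volume.restrict Ω)) : 0 ≤ ∫ x in Ω, f x * greenOp Ω G f x := by
  have h1 : (0 : ℝ) ≤ inner ℝ (hf.toLp f) (helmholtzOp ev φ 0 (hf.toLp f)) := by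
    refine (φ.hasSum_inner_mul_inner _ _).nonneg fun i => ?_
    rw [hφ.inner_helmholtzOp_zero, real_inner_comm, mul_div_assoc']
    exact div_nonneg (mul_self_nonneg _) (hφ.pos i).le
  rw [inner_L2_eq] at h1
  refine h1.trans (le_of_eq (integral_congr_ae ?_))
  filter_upwards [hφ.helmholtzOp_zero_ae_eq hG hΩ hn hs hγ (hf.toLp f), hf.coeFn_toLp] with x e1 e2
  rw [e1, e2]
  congr 1
  refine integral_congr_ae ?_
  filter_upwards [hf.coeFn_toLp] with y hy
  rw [hy]

lemma memLp_indicator_sub (hΩ : IsBoundedC11 Ω) {A B : Set (EuclideanSpace ℝ (Fin n))}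
    (hA : MeasurableSet A) (hB : MeasurableSet B) :
    MemLp (fun x => A.indicator (1 : EuclideanSpace ℝ (Fin n) → ℝ) x - B.indicator 1 x) 2
      (volume.restrict Ω) := by
  have : IsFiniteMeasure (volume.restrict Ω) := ⟨by simpa using hΩ.volume_lt_top⟩
  exact ((memLp_const (1 : ℝ)).indicator hA).sub ((memLp_const (1 : ℝ)).indicator hB)

/-- At points of A the positive mass on A contributes at most κV/2, while the equal negative mass on
B contributes at most -κV. -/
lemma IsGreenFunction.greenOp_indicator_sub_le (hG : IsGreenFunction Ω s γ G)
    (hΩ : IsBoundedC11 Ω) (hn : 1 ≤ n) (hs : 0 < s) (hγ : γ ∈ Ioc (0 : ℝ) 1)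
    {A B : Set (EuclideanSpace ℝ (Fin n))} (hA : MeasurableSet A) (hB : MeasurableSet B)
    (hAΩ : A ⊆ Ω) (hBΩ : B ⊆ Ω) (hAB : Disjoint A B) {κ V : ℝ}
    (hVA : volume.real A = V) (hVB : volume.real B = V)
    (hAA : ∀ x ∈ A, ∀ y ∈ A, x ≠ y → G x y ≤ κ / 2) (hGB : ∀ x ∈ A, ∀ y ∈ B, κ ≤ G x y) :
    ∀ᵐ x ∂(volume.restrict Ω), x ∈ A → greenOp Ω G
      (fun x => A.indicator (1 : EuclideanSpace ℝ (Fin n) → ℝ) x - B.indicator 1 x) x ≤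
        -(κ / 2 * V) := by
  have : IsFiniteMeasure (volume.restrict Ω) := ⟨by simpa using hΩ.volume_lt_top⟩
  have h1 := (hG.integrable_mul_mul hΩ hn hs hγ (memLp_indicator_sub hΩ hA hB)
    (memLp_const (1 : ℝ))).prod_right_ae
  have hreal : ∀ S ⊆ Ω, (volume.restrict Ω).real S = volume.real S := fun S hS => by
    rw [Measure.real, Measure.real, Measure.restrict_eq_self _ hS]
  filter_upwards [h1] with x hx hxA
  simp only [Function.uncurry_apply_pair, one_mul] at hx
  have hi1 : Integrable (fun y => κ / 2 * A.indicator (1 : EuclideanSpace ℝ (Fin n) → ℝ) y)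
      (volume.restrict Ω) := ((integrable_const (1 : ℝ)).indicator hA).const_mul _
  have hi2 : Integrable (fun y => κ * B.indicator (1 : EuclideanSpace ℝ (Fin n) → ℝ) y)
      (volume.restrict Ω) := ((integrable_const (1 : ℝ)).indicator hB).const_mul _
  have hmono : greenOp Ω G
      (fun x => A.indicator (1 : EuclideanSpace ℝ (Fin n) → ℝ) x - B.indicator 1 x) x ≤
      ∫ y in Ω, (κ / 2 * A.indicator (1 : EuclideanSpace ℝ (Fin n) → ℝ) y -
        κ * B.indicator (1 : EuclideanSpace ℝ (Fin n) → ℝ) y) := by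
    refine integral_mono_ae hx (hi1.sub hi2) ?_
    filter_upwards [ae_mem_and_ne hΩ hn x] with y hy
    by_cases hyA : y ∈ A
    · have hyB : y ∉ B := disjoint_left.1 hAB hyA
      rw [indicator_of_mem hyA, indicator_of_notMem hyB]
      simpa using hAA x hxA y hyA hy.2
    · by_cases hyB : y ∈ B
      · rw [indicator_of_notMem hyA, indicator_of_mem hyB]
        simpa using hGB x hxA y hyB
      · rw [indicator_of_notMem hyA, indicator_of_notMem hyB]
        simp
  refine hmono.trans (le_of_eq ?_)
  rw [integral_sub hi1 hi2, integral_const_mul, integral_const_mul, integral_indicator_one hA,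
    integral_indicator_one hB, hreal A hAΩ, hreal B hBΩ, hVA, hVB]
  ring

/-- A positive operator cannot have a kernel that vanishes on the diagonal and is positive
elsewhere. -/
lemma IsEigenbasis.two_mul_le (hφ : IsEigenbasis Ω G ev φ) (hG : IsGreenFunction Ω s γ G)
    (hΩ : IsBoundedC11 Ω) (hn : 1 ≤ n) (hs : 0 < s) (hγ : γ ∈ Ioc (0 : ℝ) 1) :
    2 * s ≤ n := by
  by_contra hcon
  have hns : (n : ℝ) < 2 * s := not_le.1 hcon
  have : Nontrivial (EuclideanSpace ℝ (Fin n)) :=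
    Module.nontrivial_of_finrank_pos (R := ℝ) (by simpa using Nat.lt_of_lt_of_le Nat.zero_lt_one hn)
  obtain ⟨c, hc, hcG⟩ := hG.exists_bounds hΩ hn hγ
  obtain ⟨D, hD1, hδD, hD⟩ := hΩ.exists_bound hn
  have hD0 : 0 < D := by linarith
  obtain ⟨a, ha⟩ := hΩ.nonempty
  obtain ⟨ρ, hρ, hball⟩ := Metric.isOpen_iff.1 hΩ.isOpen a ha
  obtain ⟨b, hb, hab⟩ : ∃ b ∈ Ω, b ≠ a := by
    obtain ⟨e, he⟩ := exists_ne (0 : EuclideanSpace ℝ (Fin n))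
    have he0 : 0 < ‖e‖ := norm_pos_iff.2 he
    refine ⟨a + (ρ / (2 * ‖e‖)) • e, hball ?_, ?_⟩
    · rw [mem_ball_iff_norm, add_sub_cancel_left, norm_smul, Real.norm_of_nonneg (by positivity)]
      have : ρ / (2 * ‖e‖) * ‖e‖ = ρ / 2 := by field_simp
      linarith
    · intro h
      rw [add_eq_left] at h
      rcases smul_eq_zero.1 h with h | h
      · have : 0 < ρ / (2 * ‖e‖) := by positivity
        linarith
      · exact he h
  obtain ⟨ρ', hρ', hball'⟩ := Metric.isOpen_iff.1 hΩ.isOpen b hb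
  have hδa := hΩ.bdist_pos hn ha
  have hδb := hΩ.bdist_pos hn hb
  have hba : 0 < ‖b - a‖ := norm_pos_iff.2 (sub_ne_zero.2 hab)
  -- The radius r keeps both balls inside Ω, at depth at least r, and at mutual distance at least r.
  obtain ⟨r, hr, hra, hrb, hrρ, hrρ', hrab⟩ : ∃ r > 0, r ≤ bdist Ω a / 2 ∧ r ≤ bdist Ω b / 2 ∧
      r ≤ ρ ∧ r ≤ ρ' ∧ r ≤ ‖b - a‖ / 4 := by
    refine ⟨min (min (bdist Ω a / 2) (bdist Ω b / 2)) (min (min ρ ρ') (‖b - a‖ / 4)), ?_, ?_⟩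
    · simp only [gt_iff_lt, lt_min_iff]
      refine ⟨⟨?_, ?_⟩, ⟨?_, ?_⟩, ?_⟩ <;> positivity
    · simp
  -- A lower bound for G between the balls: separation and boundary distances are at least r, and
  -- the largest distance is at most D.
  set κ : ℝ := r ^ (-((n : ℝ) - 2 * s)) * (r * r / D ^ 2) ^ γ / c with hκ
  have hκ0 : 0 < κ := by positivity
  set e : ℝ := 2 * s - n with he
  have he0 : 0 < e := by linarith
  -- Since G ≤ c |x-y|^e with e = 2s - n > 0, points less than 2ε apart interact by at most κ/2.
  set ε : ℝ := min r ((κ / (2 * c)) ^ (1 / e) / 2) with hε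
  have hε0 : 0 < ε := lt_min hr (by positivity)
  have hεr : ε ≤ r := min_le_left _ _
  have hnear : ∀ z ∈ Ω, ∀ x ∈ Metric.ball z ε, ∀ y ∈ Metric.ball z ε, x ∈ Ω → y ∈ Ω → x ≠ y →
      G x y ≤ κ / 2 := by
    intro z _ x hx y hy hxΩ hyΩ hxy
    have h1 := (hcG x hxΩ y hyΩ hxy).2.2.2.1
    have h2 : ‖x - y‖ ≤ (κ / (2 * c)) ^ (1 / e) := by
      have := dist_triangle_right x y z
      rw [Metric.mem_ball] at hx hy
      rw [← dist_eq_norm]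
      have h3 : ε ≤ (κ / (2 * c)) ^ (1 / e) / 2 := min_le_right _ _
      linarith
    have h4 : ‖x - y‖ ^ (-((n : ℝ) - 2 * s)) ≤ κ / (2 * c) := by
      have e1 : -((n : ℝ) - 2 * s) = e := by rw [he]; ring
      rw [e1]
      calc ‖x - y‖ ^ e ≤ ((κ / (2 * c)) ^ (1 / e)) ^ e :=
            Real.rpow_le_rpow (norm_nonneg _) h2 he0.le
        _ = _ := by
            rw [← Real.rpow_mul (by positivity), one_div_mul_cancel he0.ne', Real.rpow_one]
    calc G x y ≤ c * (κ / (2 * c)) := h1.trans (by gcongr)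
      _ = κ / 2 := by field_simp
  have hfar : ∀ x ∈ Ω, ∀ y ∈ Ω, r ≤ bdist Ω x → r ≤ bdist Ω y → r ≤ ‖x - y‖ → κ ≤ G x y := by
    intro x hx y hy hrx hry hrxy
    have hxy : x ≠ y := by
      rintro rfl
      rw [sub_self, norm_zero] at hrxy
      linarith
    have h1 := (hcG x hx y hy hxy).2.1
    have hM := maxDist_pos (Ω := Ω) hxy
    have hMD : maxDist Ω x y ≤ D := max_le (hD x hx y hy) (max_le (hδD x hx) (hδD y hy))
    rw [hκ, div_le_iff₀ hc, mul_comm _ c]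
    refine le_trans ?_ h1
    rw [potKernel_one_eq hxy]
    have h2 : r ^ (-((n : ℝ) - 2 * s)) ≤ ‖x - y‖ ^ (-((n : ℝ) - 2 * s)) :=
      Real.rpow_le_rpow hr.le hrxy (by linarith)
    have h3 : r * r / D ^ 2 ≤ bdist Ω x * bdist Ω y / maxDist Ω x y ^ 2 := by
      have h4 := bdist_nonneg (Ω := Ω) x
      have h5 := mul_nonneg h4 (bdist_nonneg (Ω := Ω) y)
      gcongr
    exact mul_le_mul h2 (Real.rpow_le_rpow (by positivity) h3 hγ.1.le) (by positivity)
      (by positivity)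
  set A := Metric.ball a ε with hA
  set B := Metric.ball b ε with hB
  have hAΩ : A ⊆ Ω := (Metric.ball_subset_ball (hεr.trans hrρ)).trans hball
  have hBΩ : B ⊆ Ω := (Metric.ball_subset_ball (hεr.trans hrρ')).trans hball'
  have hAδ : ∀ x ∈ A, r ≤ bdist Ω x := fun x hx => by
    have h1 := bdist_le_add (Ω := Ω) a x
    have h2 := Metric.mem_ball'.1 hx
    rw [dist_eq_norm] at h2
    linarith
  have hBδ : ∀ x ∈ B, r ≤ bdist Ω x := fun x hx => by
    have h1 := bdist_le_add (Ω := Ω) b x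
    have h2 := Metric.mem_ball'.1 hx
    rw [dist_eq_norm] at h2
    linarith
  have hABd : ∀ x ∈ A, ∀ y ∈ B, r ≤ ‖x - y‖ := fun x hx y hy => by
    have h1 := Metric.mem_ball.1 hx
    have h2 := Metric.mem_ball'.1 hy
    have h3 := dist_triangle4 b y x a
    rw [← dist_eq_norm, dist_comm]
    rw [← dist_eq_norm] at hrab
    linarith
  have hdisj : Disjoint A B := disjoint_left.2 fun x hxA hxB => by
    have := hABd x hxA x hxB
    rw [sub_self, norm_zero] at this
    linarith
  have hVB : volume.real B = volume.real A := by
    rw [Measure.real, Measure.real, hA, hB, Measure.addHaar_ball_center volume a,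
      Measure.addHaar_ball_center volume b]
  have hV0 : 0 < volume.real A :=
    ENNReal.toReal_pos (Metric.measure_ball_pos volume a hε0).ne' Metric.isBounded_ball.measure_lt_top.ne
  have hAm : MeasurableSet A := measurableSet_ball
  have hBm : MeasurableSet B := measurableSet_ball
  set V := volume.real A with hV
  have k1 := hG.greenOp_indicator_sub_le hΩ hn hs hγ hAm hBm hAΩ hBΩ hdisj (κ := κ) hV.symm hVB
    (fun x hx y hy => hnear a ha x hx y hy (hAΩ hx) (hAΩ hy))
    (fun x hx y hy => hfar x (hAΩ hx) y (hBΩ hy) (hAδ x hx) (hBδ y hy) (hABd x hx y hy))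
  have k2 := hG.greenOp_indicator_sub_le hΩ hn hs hγ hBm hAm hBΩ hAΩ hdisj.symm (κ := κ) hVB hV.symm
    (fun x hx y hy => hnear b hb x hx y hy (hBΩ hx) (hBΩ hy))
    (fun x hx y hy => hfar x (hBΩ hx) y (hAΩ hy) (hBδ x hx) (hAδ y hy)
      (by rw [norm_sub_rev]; exact hABd y hy x hx))
  set f : EuclideanSpace ℝ (Fin n) → ℝ :=
    fun x => A.indicator (1 : EuclideanSpace ℝ (Fin n) → ℝ) x - B.indicator 1 x with hf
  have hfL : MemLp f 2 (volume.restrict Ω) := memLp_indicator_sub hΩ hAm hBm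
  have hneg : ∀ x, greenOp Ω G
      (fun x => B.indicator (1 : EuclideanSpace ℝ (Fin n) → ℝ) x - A.indicator 1 x) x =
        -greenOp Ω G f x := fun x => by
    rw [greenOp, greenOp, ← integral_neg]
    congr 1; ext y
    simp only [hf]; ring
  simp only [hneg] at k2
  have : IsFiniteMeasure (volume.restrict Ω) := ⟨by simpa using hΩ.volume_lt_top⟩
  have hi : Integrable (fun y => -(κ / 2 * V) * A.indicator (1 : EuclideanSpace ℝ (Fin n) → ℝ) y)
      (volume.restrict Ω) := ((integrable_const (1 : ℝ)).indicator hAm).const_mul _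
  -- On A the integrand is at most -κV/2; on B it is nonpositive and is discarded. The energy is
  -- thus at most -κV²/2 < 0.
  have hle : ∫ x in Ω, f x * greenOp Ω G f x ≤
      ∫ x in Ω, -(κ / 2 * V) * A.indicator (1 : EuclideanSpace ℝ (Fin n) → ℝ) x := by
    refine integral_mono_ae (hfL.integrable_mul (hG.memLp_greenOp hΩ hn hs hγ hfL)) hi ?_
    filter_upwards [k1, k2] with x h1 h2
    have hκV : 0 < κ / 2 * V := by positivity
    by_cases hxA : x ∈ A
    · have hxB : x ∉ B := disjoint_left.1 hdisj hxA
      have := h1 hxA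
      simp only [hf, indicator_of_mem hxA, indicator_of_notMem hxB] at this ⊢
      simpa using this
    · by_cases hxB : x ∈ B
      · have h3 := h2 hxB
        have e1 : f x = -1 := by simp [hf, hxA, hxB]
        simp only [e1, indicator_of_notMem hxA]
        linarith
      · have e1 : f x = 0 := by simp [hf, hxA, hxB]
        simp [e1, hxA]
  have hnonneg := hφ.integral_mul_greenOp_nonneg hG hΩ hn hs hγ hfL
  rw [integral_const_mul, integral_indicator_one hAm, Measure.real,
    Measure.restrict_eq_self _ hAΩ] at hle
  have : 0 < κ / 2 * V * V := by positivity
  have e2 : -(κ / 2 * V) * (volume A).toReal = -(κ / 2 * V * V) := by rw [hV, Measure.real]; ring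
  linarith

end LowDimension

/-! ### Assembly of the uniform estimates -/

theorem mainTheorem3 (n : ℕ) (hn : 1 ≤ n) (s γ : ℝ) (hs : s ∈ Ioo (0 : ℝ) 1)
    (hγ : γ ∈ Ioc (0 : ℝ) 1) (hns : (n : ℝ) ≠ 2 * s)
    (Ω : Set (EuclideanSpace ℝ (Fin n))) (hΩ : IsBoundedC11 Ω)
    (G : EuclideanSpace ℝ (Fin n) → EuclideanSpace ℝ (Fin n) → ℝ)
    (hG : IsGreenFunction Ω s γ G)
    (ev : ℕ → ℝ) (φ : HilbertBasis ℕ ℝ (L2 Ω)) (hφ : IsEigenbasis Ω G ev φ)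
    (lamBar m : ℝ) :
    ∃ (C₀ : ℝ) (C₁ C₂ C₃ : ℝ → ℝ),
      ∀ (lam : ℝ) (I : ℕ), lam ∉ range ev → -m ≤ lam → IsCutIndex ev lam I →
        ev (I + 1) = lamBar →
      ∀ f u : EuclideanSpace ℝ (Fin n) → ℝ,
        MemPerp Ω γ φ I f → IsWeakSolution Ω γ ev φ lam f u →
        MemPerp Ω γ φ I u ∧
        (∀ α : ℝ, -1 - γ < α →
          MemWeightedL1 Ω (greenOp Ω G fun x => bdist Ω x ^ α) f →
          MemWeightedL1 Ω (fun x => bdist Ω x ^ α) u ∧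
          ∫ x in Ω, |u x| * bdist Ω x ^ α ≤
            C₀ * ∫ x in Ω, |f x| * greenOp Ω G (fun y => bdist Ω y ^ α) x) ∧
        (∀ p : ℝ, 1 ≤ p → p < n / (n - 2 * s) →
          MemLp f 1 (volume.restrict Ω) →
          MemLp u (ENNReal.ofReal p) (volume.restrict Ω) ∧
          eLpNorm u (ENNReal.ofReal p) (volume.restrict Ω) ≤
            ENNReal.ofReal (C₁ p) * eLpNorm f 1 (volume.restrict Ω)) ∧
        (∀ p₀ p₁ : ℝ, 1 < p₀ → p₀ < n / (2 * s) → 1 / p₁ = 1 / p₀ - 2 * s / n →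
          MemLp f (ENNReal.ofReal p₀) (volume.restrict Ω) →
          MemLp u (ENNReal.ofReal p₁) (volume.restrict Ω) ∧
          eLpNorm u (ENNReal.ofReal p₁) (volume.restrict Ω) ≤
            ENNReal.ofReal (C₂ p₀) * eLpNorm f (ENNReal.ofReal p₀) (volume.restrict Ω)) ∧
        (γ < 2 * s → ∀ p : ℝ, 1 ≤ p → p < n / (n - 2 * s + γ) →
          MemLp u (ENNReal.ofReal p) (volume.restrict Ω) ∧
          eLpNorm u (ENNReal.ofReal p) (volume.restrict Ω) ≤
            ENNReal.ofReal (C₃ p * ∫ x in Ω, |f x| * bdist Ω x ^ γ)) := by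
  obtain ⟨hs0, hs1⟩ := hs
  have hs2 : 2 * s < n :=
    lt_of_le_of_ne (hφ.two_mul_le hG hΩ hn hs0 hγ) fun h => hns h.symm
  -- The constants must be fixed before `lam`. The value `lamBar` alone determines the cut index; if
  -- no spectral gap ends at `lamBar`, the claim is vacuous.
  by_cases hI : ∃ I, ev I < ev (I + 1) ∧ ev (I + 1) = lamBar
  swap
  · exact ⟨0, 0, 0, 0, fun lam I _ _ hcut hbar => absurd ⟨I, hcut.1.2, hbar⟩ hI⟩
  obtain ⟨I₀, hgap, hbar₀⟩ := hI
  obtain ⟨C, hC, hdom⟩ := hφ.exists_enorm_le_pot hG hΩ hn hs0 hs2 hγ hgap m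
  obtain ⟨K₀, h0⟩ := hG.exists_integral_mul_bdist_rpow_le hΩ hn hs0 hs2 hγ hC
  have hpos : 0 < (n : ℝ) - 2 * s := by linarith
  -- The constant is given for every real p, with the idle value 0 outside the admissible range, so
  -- that `choose` yields a function of p. The same is done for the next two estimates.
  have h1 : ∀ p : ℝ, ∃ K : ℝ, 1 ≤ p → p < n / (n - 2 * s) →
      ∀ f u : EuclideanSpace ℝ (Fin n) → ℝ, AEMeasurable f (volume.restrict Ω) →
        (∀ᵐ x ∂(volume.restrict Ω),
          ‖u x‖ₑ ≤ ENNReal.ofReal C * pot Ω s γ 1 (fun y => ‖f y‖ₑ) x) →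
        eLpNorm u (ENNReal.ofReal p) (volume.restrict Ω) ≤
          ENNReal.ofReal K * eLpNorm f 1 (volume.restrict Ω) := by
    intro p
    by_cases hp : 1 ≤ p ∧ p < n / (n - 2 * s)
    · obtain ⟨K, hK⟩ := exists_eLpNorm_le_lintegral (s := s) (γ := γ) hΩ hn (b := n - 2 * s)
        (p := p) hp.1 (by rw [mul_comm]; exact (lt_div_iff₀ hpos).1 hp.2)
        (w := fun _ => 1) measurable_const (fun x hx y hy hxy => by
          rw [mul_one]
          exact ENNReal.ofReal_le_ofReal (potKernel_one_le_norm_rpow hΩ hn hγ hx hy hxy)) C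
      refine ⟨K, fun _ _ f u hf hu => ?_⟩
      simpa [eLpNorm_one_eq_lintegral_enorm] using hK f u hf hu
    · exact ⟨0, fun h h' => absurd ⟨h, h'⟩ hp⟩
  have h2 : ∀ p : ℝ, ∃ K : ℝ, 1 < p → p < n / (2 * s) → ∀ q : ℝ, 1 / q = 1 / p - 2 * s / n →
      ∀ f u : EuclideanSpace ℝ (Fin n) → ℝ, MemLp f (ENNReal.ofReal p) (volume.restrict Ω) →
        AEMeasurable u (volume.restrict Ω) →
        (∀ᵐ x ∂(volume.restrict Ω),
          ‖u x‖ₑ ≤ ENNReal.ofReal C * pot Ω s γ 1 (fun y => ‖f y‖ₑ) x) →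
        eLpNorm u (ENNReal.ofReal q) (volume.restrict Ω) ≤
          ENNReal.ofReal K * eLpNorm f (ENNReal.ofReal p) (volume.restrict Ω) := by
    intro p
    by_cases hp : 1 < p ∧ p < n / (2 * s)
    · obtain ⟨K, hK⟩ := exists_eLpNorm_le_eLpNorm hΩ hn hs0 hγ hp.1 hp.2
        (q := (1 / p - 2 * s / n)⁻¹) (by rw [one_div, inv_inv]) hC
      refine ⟨K, fun _ _ q hq f u hf hum hu => ?_⟩
      have e : q = (1 / p - 2 * s / n)⁻¹ := by rw [← hq, one_div, inv_inv]
      rw [e]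
      exact hK f u hf hum hu
    · exact ⟨0, fun h h' => absurd ⟨h, h'⟩ hp⟩
  have h3 : ∀ p : ℝ, ∃ K : ℝ, 1 ≤ p → p < n / (n - 2 * s + γ) →
      ∀ f u : EuclideanSpace ℝ (Fin n) → ℝ, AEMeasurable f (volume.restrict Ω) →
        (∀ᵐ x ∂(volume.restrict Ω),
          ‖u x‖ₑ ≤ ENNReal.ofReal C * pot Ω s γ 1 (fun y => ‖f y‖ₑ) x) →
        eLpNorm u (ENNReal.ofReal p) (volume.restrict Ω) ≤
          ENNReal.ofReal K * ∫⁻ y in Ω, ENNReal.ofReal (bdist Ω y ^ γ) * ‖f y‖ₑ := by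
    intro p
    by_cases hp : 1 ≤ p ∧ p < n / (n - 2 * s + γ)
    · obtain ⟨K, hK⟩ := exists_eLpNorm_le_lintegral (s := s) (γ := γ) hΩ hn
        (b := n - 2 * s + γ) (p := p) hp.1
        (by rw [mul_comm]; exact (lt_div_iff₀ (by linarith [hγ.1])).1 hp.2)
        (w := fun y => ENNReal.ofReal (bdist Ω y ^ γ))
        (continuous_bdist.measurable.pow_const γ).ennreal_ofReal (fun x hx y hy hxy => by
          rw [← ENNReal.ofReal_mul (by positivity)]
          exact ENNReal.ofReal_le_ofReal (potKernel_one_le_norm_rpow_mul hΩ hn hγ hx hy hxy)) C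
      exact ⟨K, fun _ _ => hK⟩
    · exact ⟨0, fun h h' => absurd ⟨h, h'⟩ hp⟩
  choose K₁ h1 using h1
  choose K₂ h2 using h2
  choose K₃ h3 using h3
  -- A nonnegative last constant lets `ENNReal.ofReal` split over its product with the weighted
  -- norm.
  refine ⟨K₀, K₁, K₂, fun p => max (K₃ p) 0, ?_⟩
  intro lam I hlam hm hcut hbar f u hf hu
  -- By monotonicity, two distinct indices cannot both precede a jump to the same value.
  obtain rfl : I = I₀ := by
    rcases lt_trichotomy I I₀ with h | h | h
    · have := hφ.mono (show I + 1 ≤ I₀ by omega)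
      linarith
    · exact h
    · have := hφ.mono (show I₀ + 1 ≤ I by omega)
      have := hcut.1.2
      linarith
  have hlI : lam ≤ ev I := hcut.1.1
  have hfm := hf.1.aemeasurable hΩ hn
  have hum := hu.2.1.aemeasurable hΩ hn
  have hfu := hdom lam hlam hm hlI f u hf hu
  refine ⟨hφ.memPerp_of_isWeakSolution hG hΩ hn hs0 hs2 hγ hgap hlI hf hu,
    h0 f u hfm hum hfu, fun p hp1 hp2 hf1 => ?_, fun p₀ p₁ hp1 hp2 hp hf1 => ?_,
    fun _ p hp1 hp2 => ?_⟩
  · have h := h1 p hp1 hp2 f u hfm hfu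
    exact ⟨⟨hum.aestronglyMeasurable,
      h.trans_lt (ENNReal.mul_lt_top ENNReal.ofReal_lt_top hf1.2)⟩, h⟩
  · have h := h2 p₀ hp1 hp2 p₁ hp f u hf1 hum hfu
    exact ⟨⟨hum.aestronglyMeasurable,
      h.trans_lt (ENNReal.mul_lt_top ENNReal.ofReal_lt_top hf1.2)⟩, h⟩
  · have h := h3 p hp1 hp2 f u hfm hfu
    have hδ : ∀ y, 0 ≤ bdist Ω y ^ γ := fun y => Real.rpow_nonneg (bdist_nonneg y) γ
    have hfi : Integrable (fun x => |f x| * bdist Ω x ^ γ) (volume.restrict Ω) := by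
      have hi : Integrable (fun x => f x * bdist Ω x ^ γ) (volume.restrict Ω) := hf.1
      refine hi.norm.congr (ae_of_all _ fun x => ?_)
      simp only [norm_mul, Real.norm_eq_abs]
      rw [abs_of_nonneg (hδ x)]
    have e : ∫⁻ y in Ω, ENNReal.ofReal (bdist Ω y ^ γ) * ‖f y‖ₑ =
        ENNReal.ofReal (∫ x in Ω, |f x| * bdist Ω x ^ γ) := by
      rw [ofReal_integral_eq_lintegral_ofReal hfi
        (ae_of_all _ fun x => mul_nonneg (abs_nonneg _) (hδ x))]
      congr 1; ext x
      rw [ENNReal.ofReal_mul (abs_nonneg _), Real.enorm_eq_ofReal_abs, mul_comm]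
    have h4 : eLpNorm u (ENNReal.ofReal p) (volume.restrict Ω) ≤
        ENNReal.ofReal (max (K₃ p) 0 * ∫ x in Ω, |f x| * bdist Ω x ^ γ) := by
      rw [ENNReal.ofReal_mul (le_max_right _ _), ← e]
      refine h.trans (mul_le_mul_left (ENNReal.ofReal_le_ofReal (le_max_left _ _)) _)
    exact ⟨⟨hum.aestronglyMeasurable, h4.trans_lt ENNReal.ofReal_lt_top⟩, h4⟩
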